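/- Write $\mathbb S^1=\mathbb R/\mathbb Z$ (so $|\mathbb S^1|=1$), and let $\mathcal C$ be the set of constant maps $\mathbb S^1\to\mathbb R^2$. For $\gamma\in H^1(\mathbb S^1,\mathbb R^2)$ let $\mathcal L(\gamma)=\int_0^1|\gamma'|\,du$ be its length, $s_\gamma(u)=\int_0^u|\gamma'|$ its arclength function for $0\le u<1$, $\|\gamma\|_\infty=\sup_u|\gamma(u)|$, $A(\gamma)=\frac12\int_0^1(xy'-yx')\,du$ its signed enclosed area (where $\gamma=(x,y)$), and $\mathcal D_\gamma=\mathcal L(\gamma)^2-4\pi A(\gamma)$ its isoperimetric deficit. For $\gamma\in H^1(\mathbb S^1,\mathbb R^2)\setminus\mathcal C$ set $$F(\gamma)(u)=-\gamma(u)-\int_0^1\gamma(v)\,\frac{\cosh\big(|s_\gamma(u)-s_\gamma(v)|-\frac{\mathcal L(\gamma)}2\big)}{2\sinh\big(-\frac{\mathcal L(\gamma)}2\big)}\,|\gamma'(v)|\,dv .$$ An (eternal) $H^1(ds)$ curve shortening flow is a map $X\in C^1(\mathbb R;H^1(\mathbb S^1,\mathbb R^2)\setminus\mathcal C)$ with $\partial_tX(t)=F(X(t))$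 for all $t$; its asymptotic profile is $Y(t,u)=e^t\big(X(t,u)-X(t,0)\big)$. We say that $\gamma$ satisfies the chord–arc condition if $$\inf_{u\ne v}\frac{|\gamma(u)-\gamma(v)|}{\mathcal S_\gamma(u,v)}>\theta e^{\theta},\qquad \theta=\frac{\mathcal L(\gamma)^2\sqrt{2+\|\gamma\|_\infty^2}}{4},$$ where $\mathcal S_\gamma(u,v)$ is the length of the shorter one of the two arcs of $\gamma$ between the parameters $u$ and $v$, and the quotient counts as $0$ when $\mathcal S_\gamma(u,v)=0$. **Theorem.** There is a function $c:\mathbb R\to\mathbb R$ with the following property. Let $k\in\mathbb N_0$, and let $X_0\in H^1(\mathbb S^1,\mathbb R^2)\setminus\mathcal C$ if $k=0$ and $X_0\in C^k(\mathbb S^1,\mathbb R^2)\setminus\mathcal C$ if $k\ge1$. Then there is a unique $H^1(ds)$ curve shortening flow $X$ with $X(0)=X_0$, and there is a (non-trivial) $Y_\infty\in H^1(\mathbb S^1,\mathbb R^2)\setminus\mathcal C$ such that its asymptotic profile satisfies $Y(t)\to Y_\infty$ in $C^0$, that is, uniformly on $\mathbb S^1$, as $t\to\infty$. Furthermore: -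 If $X(t)$ satisfies the chord–arc condition at some time $t\in\mathbb R$, then $Y_\infty$ is embedded, that is, continuous and injective on $\mathbb S^1$; if in addition $X_0$ is a $C^1$ immersion, then so is $Y_\infty$ (hence $Y_\infty$ is a $C^1$ embedding). - If $k\ge2$ and $X_0$ is immersed, then $Y_\infty$ is a $C^2$ immersion with bounded curvature. - $\mathcal D_{Y_\infty}\le c(\|X_0\|_\infty)\,\mathcal D_{X_0}$. -/

import Mathlib

open Filter Topology MeasureTheory

noncomputable section

namespace H1CSF

/-- The Euclidean plane. Closed curves `γ : 𝕊¹ → ℝ²`, with `𝕊¹ = ℝ / ℤ`, are written as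
`1`-periodic functions `γ : ℝ → Plane`. -/
abbrev Plane : Type := EuclideanSpace ℝ (Fin 2)

/-- The Sobolev space `H¹(𝕊¹, ℝ²)` (continuous representatives): `γ` is `1`-periodic, its
almost everywhere defined derivative lies in `L²(0, 1)`, and `γ` is the primitive of it. -/
def MemH1 (γ : ℝ → Plane) : Prop :=
  Function.Periodic γ 1 ∧
  MemLp (deriv γ) 2 (volume.restrict (Set.Ioc (0 : ℝ) 1)) ∧
  ∀ u ∈ Set.Icc (0 : ℝ) 1, γ u = γ 0 + ∫ x in (0 : ℝ)..u, deriv γ x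

/-- The constant maps. -/
def IsConstantMap (γ : ℝ → Plane) : Prop := ∃ p : Plane, ∀ u, γ u = p

/-- The space `C^k(𝕊¹, ℝ²)`. -/
def MemCk (k : ℕ) (γ : ℝ → Plane) : Prop :=
  Function.Periodic γ 1 ∧ ContDiff ℝ (k : WithTop ℕ∞) γ

/-- The immersions of class `C^k` (used for `1 ≤ k`). -/
def MemImm (k : ℕ) (γ : ℝ → Plane) : Prop :=
  MemCk k γ ∧ ∀ u, deriv γ u ≠ 0

/-- The spaces of initial data: non-constant maps in `H¹` for `k = 0`, and non-constant maps
in `C^k` for `1 ≤ k`. -/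
def InitialData (k : ℕ) (γ : ℝ → Plane) : Prop :=
  (if k = 0 then MemH1 γ else MemCk k γ) ∧ ¬ IsConstantMap γ

/-- The norm of `H¹(𝕊¹, ℝ²)`. -/
def h1Norm (γ : ℝ → Plane) : ℝ :=
  Real.sqrt ((∫ u in (0 : ℝ)..1, ‖γ u‖ ^ 2) + ∫ u in (0 : ℝ)..1, ‖deriv γ u‖ ^ 2)

/-- The norm `‖γ‖_∞`. -/
def supNorm (γ : ℝ → Plane) : ℝ := ⨆ u : ℝ, ‖γ u‖

/-- The length of a closed curve. -/
def length (γ : ℝ → Plane) : ℝ := ∫ u in (0 : ℝ)..1, ‖deriv γ u‖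

/-- The arclength function `s_γ`, as a function on `𝕊¹ = [0, 1)`. -/
def arcParam (γ : ℝ → Plane) (u : ℝ) : ℝ := ∫ x in (0 : ℝ)..(Int.fract u), ‖deriv γ x‖

/-- The kernel `G(γ; u, v)`. -/
def kernelG (γ : ℝ → Plane) (u v : ℝ) : ℝ :=
  Real.cosh (|arcParam γ u - arcParam γ v| - length γ / 2) / (2 * Real.sinh (-(length γ / 2)))

/-- The velocity `F(γ)` of the flow:
`F(γ)(u) = -γ(u) - ∫₀¹ γ(v) G(γ; u, v) |γ'(v)| dv`.
On immersed curves this is minus the `H¹(ds)`-gradient of length. -/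
def velocity (γ : ℝ → Plane) (u : ℝ) : Plane :=
  -γ u - ∫ v in (0 : ℝ)..1, (kernelG γ u v * ‖deriv γ v‖) • γ v

/-- An eternal `H¹(ds)` curve shortening flow: a map `X` in `C¹(ℝ; H¹ \ {constants})`,
where `X t` is the curve at time `t`, with `X_t = F(X)`. Differentiability in `t` and continuity
of the time derivative are with respect to the norm of `H¹(𝕊¹, ℝ²)`. -/
structure IsFlow (X : ℝ → ℝ → Plane) : Prop where
  mem : ∀ t, MemH1 (X t)
  nonconstant : ∀ t, ¬ IsConstantMap (X t)
  velocity_mem : ∀ t, MemH1 (velocity (X t))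
  hasDeriv : ∀ t, Tendsto
    (fun h : ℝ => h1Norm (fun u => h⁻¹ • (X (t + h) u - X t u) - velocity (X t) u))
    (𝓝[≠] 0) (𝓝 0)
  continuous_deriv : ∀ t, Tendsto
    (fun τ : ℝ => h1Norm (fun u => velocity (X τ) u - velocity (X t) u)) (𝓝 t) (𝓝 0)

/-- The asymptotic profile `Y(t, u) = e^t (X(t, u) - X(t, 0))`. -/
def profile (X : ℝ → ℝ → Plane) (t u : ℝ) : Plane := Real.exp t • (X t u - X t 0)

/-- The arclength distance along the closed curve between the points with parameters
`0 ≤ u ≤ v ≤ 1`: the length of the shorter one of the two arcs joining them. -/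
def arcDist (γ : ℝ → Plane) (u v : ℝ) : ℝ :=
  min (∫ x in u..v, ‖deriv γ x‖) (length γ - ∫ x in u..v, ‖deriv γ x‖)

/-- The infimum of chord length over arclength over all pairs of distinct points of `𝕊¹`. If `γ`
is constant on some arc, the pairs on that arc count with ratio `0` (the value of `0 / 0`). -/
def chordArcInf (γ : ℝ → Plane) : ℝ :=
  sInf {r : ℝ | ∃ u v : ℝ, 0 ≤ u ∧ u < v ∧ v < 1 ∧ r = dist (γ u) (γ v) / arcDist γ u v}

/-- The chord-arc condition. -/
def ChordArcCondition (γ : ℝ → Plane) : Prop :=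
  length γ ^ 2 * Real.sqrt (2 + supNorm γ ^ 2) / 4 *
    Real.exp (length γ ^ 2 * Real.sqrt (2 + supNorm γ ^ 2) / 4) < chordArcInf γ

/-- Embeddedness of a continuous closed curve: it is injective on `𝕊¹ = [0, 1)` (and thus a
homeomorphism of the circle onto its image, by compactness). -/
def IsEmbedded (γ : ℝ → Plane) : Prop :=
  Continuous γ ∧ Function.Periodic γ 1 ∧ Set.InjOn γ (Set.Ico (0 : ℝ) 1)

/-- The signed curvature `k = (x' y'' - y' x'') / |γ'|³` of a `C²` immersion `γ = (x, y)`. -/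
def curvature (γ : ℝ → Plane) (u : ℝ) : ℝ :=
  (deriv γ u 0 * deriv (deriv γ) u 1 - deriv γ u 1 * deriv (deriv γ) u 0) / ‖deriv γ u‖ ^ 3

/-- The signed enclosed area `A = -½ ∫ ⟨γ, N⟩ ds = ½ ∫ (x y' - y x') du`, where
`N = (-y_s, x_s)`. -/
def signedArea (γ : ℝ → Plane) : ℝ :=
  (1 / 2) * ∫ u in (0 : ℝ)..1, (γ u 0 * deriv γ u 1 - γ u 1 * deriv γ u 0)

/-- The isoperimetric deficit `𝒟 = L² - 4πA`. -/
def deficit (γ : ℝ → Plane) : ℝ := length γ ^ 2 - 4 * Real.pi * signedArea γ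

end H1CSF

end

/-! The proof turns the flow into a linear evolution in Minkowski space. If a closed curve has
derivative `f` and length `L`, its velocity has derivative `-f + ‖f‖ q`, where `q = qn f` is the
convolution of `f`, in arclength, with the Green function of `1 - ∂_s²` on a circle of length `L`.
For `Z = e^t f` and `E = ‖Z‖` the flow therefore reads `Z' = E q`, `E' = ⟨q, Z⟩`: the lightlike
vector `(E, Z)` is moved by the infinitesimal boost with vector `q`. Hence `(E, Z)(t, u) = Λ(t, u)
(‖z₀ u‖, z₀ u)` with `Λ' = boost(q) Λ` and `Λ(0) = 1`. The family `Λ(t)` is continuous in `u` even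
when `z₀` is merely in `L²`, so the flow becomes an ordinary differential equation in the Banach
algebra `Fam`. Its field has norm at most that of `Λ` and is locally Lipschitz once the length is
kept away from zero (`exists_evolution`). Since `|q| ≤ 1` the cut-off of the length is never active
(`le_len_f`), and `isFlow_curve` translates back to `H¹`. Uniqueness is a Gronwall argument for the
derivatives in `L¹` (`IsFlow.len_deriv_sub`).

For the asymptotics, the length weighted by `exp (2 ‖X‖²)` and multiplied by `e^t` does not increase
(`weighted_length_inequality`), so `L = O(e^{-t})`. The derivative of a closed curve has mean zero,
which improves `|q| ≤ 1` to `|q| ≤ L² / 8` (`norm_qf_le_sq`). The generator is thus `O(e^{-2t})`,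
and `Λ` and `Λ⁻¹` both converge. The limit of `Λ` gives the profile, and the limit of the inverse
shows that it is non-constant and immersed wherever `z₀ ≠ 0`.

Embeddedness: after a time `t₀` with `L ≤ 2`, the rescaled derivative changes by at most `(e^{L²/8}
- 1) E` (`norm_Zlim_sub_le`). A double point of the limit would force a chord at time `t₀` to be at
most that fraction of both arcs between its ends, which the chord-arc condition excludes.
Regularity: `Λ(t, u)⁻¹ Λ(t, v)` has a time derivative involving only `q(v) - q(u)`, so the limit of
`Λ` can be differentiated in `u` under a time integral (`hasDerivAt_invLim_mul`).

Deficit: in the constant-speed parametrization the deficit is a Fourier series with weights `4π²(n²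
- n) ≥ 0`. The same series bounds the growth rate of the rescaled deficit by `L² / (2π²)` times
itself (`isoperimetric_and_velocity_inequality`), which is integrable in time. For an initial curve
that is long compared with its sup norm the deficit is comparable to `L²`, and a direct comparison
suffices (`deficit_limit_le`). -/

open Filter Topology MeasureTheory

noncomputable section

namespace H1CSF

/-! ### Absolutely continuous functions as primitives -/

section Primitives

variable {E E' : Type*} [NormedAddCommGroup E] [NormedSpace ℝ E]
  [NormedAddCommGroup E'] [NormedSpace ℝ E']

/-- `F` is a primitive of the locally integrable function `f`. -/
structure IsPrim (F f : ℝ → E) : Prop where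
  integrable : ∀ a b, IntervalIntegrable f volume a b
  sub_eq : ∀ a b, F b - F a = ∫ x in a..b, f x

theorem IsPrim.eq_add {F f : ℝ → E} (h : IsPrim F f) (a b : ℝ) :
    F b = F a + ∫ x in a..b, f x := by
  rw [← h.sub_eq a b]; abel

theorem isPrim_integral {f : ℝ → E} (h : ∀ a b, IntervalIntegrable f volume a b) (c : ℝ) :
    IsPrim (fun u => ∫ x in c..u, f x) f :=
  ⟨h, fun a b => intervalIntegral.integral_interval_sub_left (h c b) (h c a)⟩

theorem IsPrim.locallyIntegrable {F f : ℝ → E} (h : IsPrim F f) :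
    LocallyIntegrable f volume := by
  intro x
  refine ⟨Set.Ioc (x - 1) (x + 1), Ioc_mem_nhds (by linarith) (by linarith), ?_⟩
  exact (intervalIntegrable_iff_integrableOn_Ioc_of_le (by linarith)).1 (h.integrable _ _)

theorem IsPrim.continuous {F f : ℝ → E} (h : IsPrim F f) : Continuous F := by
  have : F = fun u => F 0 + ∫ x in (0 : ℝ)..u, f x := funext fun u => h.eq_add 0 u
  rw [this]
  exact continuous_const.add (intervalIntegral.continuous_primitive h.integrable 0)

theorem IsPrim.ae_hasDerivAt [CompleteSpace E] {F f : ℝ → E} (h : IsPrim F f) :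
    ∀ᵐ u, HasDerivAt F (f u) u := by
  filter_upwards [LocallyIntegrable.ae_hasDerivAt_integral h.locallyIntegrable] with u hu
  have : F = fun u => F 0 + ∫ x in (0 : ℝ)..u, f x := funext fun u => h.eq_add 0 u
  rw [this]
  exact (hu 0).const_add _

theorem IsPrim.ae_deriv [CompleteSpace E] {F f : ℝ → E} (h : IsPrim F f) :
    ∀ᵐ u, deriv F u = f u := by
  filter_upwards [h.ae_hasDerivAt] with u hu using hu.deriv

theorem IsPrim.norm {F f : ℝ → E} (h : IsPrim F f) (c : ℝ) :
    IsPrim (fun u => ∫ x in c..u, ‖f x‖) (fun u => ‖f u‖) :=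
  isPrim_integral (fun a b => (h.integrable a b).norm) c

theorem IsPrim.norm_sub_le {F f : ℝ → E} (h : IsPrim F f) (c a b : ℝ) :
    ‖F b - F a‖ ≤ |(∫ x in c..b, ‖f x‖) - ∫ x in c..a, ‖f x‖| := by
  rw [h.sub_eq, (h.norm c).sub_eq a b]
  exact intervalIntegral.norm_integral_le_abs_integral_norm

theorem IsPrim.congr_ae {F f g : ℝ → E} (h : IsPrim F f) (hfg : ∀ᵐ u, f u = g u) :
    IsPrim F g := by
  have hfg' : f =ᵐ[volume] g := hfg
  refine ⟨fun a b => ?_, fun a b => ?_⟩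
  · exact (h.integrable a b).congr_ae (ae_restrict_of_ae hfg')
  · rw [h.sub_eq]
    exact intervalIntegral.integral_congr_ae (hfg.mono fun x hx _ => hx)

/-- A map that is Lipschitz relative to an absolutely continuous scalar function inherits absolute
continuity. Taking `S` to be an arclength reduces the vector-valued cases to the scalar one. -/
theorem absolutelyContinuous_of_dist_le {X : Type*} [PseudoMetricSpace X] {H : ℝ → X}
    {S : ℝ → ℝ} {a b C : ℝ}
    (hS : AbsolutelyContinuousOnInterval S a b)
    (hH : ∀ x ∈ Set.uIcc a b, ∀ y ∈ Set.uIcc a b, dist (H x) (H y) ≤ C * dist (S x) (S y)) :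
    AbsolutelyContinuousOnInterval H a b := by
  rw [absolutelyContinuousOnInterval_iff] at hS ⊢
  intro ε hε
  obtain ⟨δ, hδ, h⟩ := hS (ε / (|C| + 1)) (by positivity)
  refine ⟨δ, hδ, fun I hI hlt => ?_⟩
  have h1 := h I hI hlt
  calc ∑ i ∈ Finset.range I.1, dist (H (I.2 i).1) (H (I.2 i).2)
      ≤ ∑ i ∈ Finset.range I.1, (|C| + 1) * dist (S (I.2 i).1) (S (I.2 i).2) := by
        refine Finset.sum_le_sum fun i hi => ?_
        have := hI.1 i hi
        refine (hH _ this.1 _ this.2).trans ?_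
        gcongr
        exact (le_abs_self C).trans (by linarith)
    _ = (|C| + 1) * ∑ i ∈ Finset.range I.1, dist (S (I.2 i).1) (S (I.2 i).2) := by
        rw [Finset.mul_sum]
    _ < (|C| + 1) * (ε / (|C| + 1)) := by gcongr
    _ = ε := by field_simp

theorem IsPrim.absolutelyContinuous_norm {F f : ℝ → E} (h : IsPrim F f) (a b : ℝ) :
    AbsolutelyContinuousOnInterval (fun u => ∫ x in a..u, ‖f x‖) a b :=
  (h.integrable a b).norm.absolutelyContinuousOnInterval_intervalIntegral Set.left_mem_uIcc

theorem IsPrim.absolutelyContinuous {F f : ℝ → E} (h : IsPrim F f) (a b : ℝ) :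
    AbsolutelyContinuousOnInterval F a b := by
  refine absolutelyContinuous_of_dist_le (C := 1) (h.absolutelyContinuous_norm a b) ?_
  intro x _ y _
  rw [dist_eq_norm, Real.dist_eq, one_mul]
  exact h.norm_sub_le a y x

/-- Subtracting the integral of `f` leaves an absolutely continuous function with derivative zero
almost everywhere, hence a constant. The chain and product rules below rest on this criterion. -/
theorem isPrim_of_absolutelyContinuous [CompleteSpace E] {F f : ℝ → E}
    (hf : ∀ a b, IntervalIntegrable f volume a b)
    (hF : ∀ a b, AbsolutelyContinuousOnInterval F a b)
    (hd : ∀ᵐ u, HasDerivAt F (f u) u) : IsPrim F f := by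
  refine ⟨hf, fun a b => ?_⟩
  have hG := isPrim_integral hf a
  have hac : AbsolutelyContinuousOnInterval (fun u => F u - ∫ x in a..u, f x) a b :=
    (hF a b).sub (hG.absolutelyContinuous a b)
  obtain ⟨C, hC⟩ := hac.const_of_ae_hasDerivAt_zero (by
    filter_upwards [hd, hG.ae_hasDerivAt] with u h1 h2 _
    have h3 := h1.sub h2
    rw [sub_self] at h3
    exact h3)
  have h1 := hC a Set.left_mem_uIcc
  have h2 := hC b Set.right_mem_uIcc
  simp only [intervalIntegral.integral_same, sub_zero] at h1
  rw [h1]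
  rw [sub_eq_iff_eq_add] at h2 ⊢
  rw [h2]; abel

theorem intervalIntegrable_clm_apply {A : ℝ → E →L[ℝ] E'} {f : ℝ → E} (hA : Continuous A)
    {a b : ℝ} (hf : IntervalIntegrable f volume a b) :
    IntervalIntegrable (fun u => A u (f u)) volume a b := by
  obtain ⟨K, hK⟩ := isCompact_uIcc.exists_bound_of_continuousOn (f := A) (s := Set.uIcc a b)
    hA.continuousOn
  rw [intervalIntegrable_iff] at hf ⊢
  refine Integrable.mono' (hf.norm.const_mul K) ?_ ?_
  · exact (ContinuousLinearMap.apply ℝ E').flip.aestronglyMeasurable_comp₂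
      hA.aestronglyMeasurable hf.aestronglyMeasurable
  · refine (ae_restrict_iff' measurableSet_uIoc).2 (Eventually.of_forall fun x hx => ?_)
    exact (A x).le_of_opNorm_le (hK x (Set.uIoc_subset_uIcc hx)) _

/-- On a compact interval `F` stays in a ball, which is compact in finite dimension. There `φ` is
Lipschitz, so the composition is absolutely continuous and the chain rule at almost every point
identifies its derivative. -/
theorem IsPrim.comp [FiniteDimensional ℝ E] [CompleteSpace E'] {F f : ℝ → E} (h : IsPrim F f)
    {φ : E → E'} (hφ : ContDiff ℝ 1 φ) :
    IsPrim (fun u => φ (F u)) (fun u => fderiv ℝ φ (F u) (f u)) := by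
  have : CompleteSpace E := FiniteDimensional.complete ℝ E
  have : ProperSpace E := FiniteDimensional.proper ℝ E
  refine isPrim_of_absolutelyContinuous
    (fun a b => intervalIntegrable_clm_apply
      ((hφ.continuous_fderiv one_ne_zero).comp h.continuous) (h.integrable a b)) (fun a b => ?_) ?_
  · obtain ⟨R, hR⟩ := isCompact_uIcc.exists_bound_of_continuousOn (s := Set.uIcc a b)
      h.continuous.continuousOn
    obtain ⟨K, hK⟩ := (isCompact_closedBall (0 : E) R).exists_bound_of_continuousOn
      (hφ.continuous_fderiv one_ne_zero).continuousOn
    refine absolutelyContinuous_of_dist_le (C := K) (h.absolutelyContinuous a b |> fun _ =>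
      h.absolutelyContinuous_norm a b) ?_
    intro x hx y hy
    have hmem : ∀ z ∈ Set.uIcc a b, F z ∈ Metric.closedBall (0 : E) R := fun z hz => by
      simpa using hR z hz
    have h1 := (convex_closedBall (0 : E) R).norm_image_sub_le_of_norm_fderiv_le
      (fun z _ => (hφ.differentiable one_ne_zero).differentiableAt) hK (hmem y hy) (hmem x hx)
    have hK0 : 0 ≤ K := (norm_nonneg _).trans (hK _ (hmem x hx))
    rw [dist_eq_norm, Real.dist_eq]
    exact h1.trans (mul_le_mul_of_nonneg_left (h.norm_sub_le a y x) hK0)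
  · filter_upwards [h.ae_hasDerivAt] with u hu
    exact ((hφ.differentiable one_ne_zero).differentiableAt.hasFDerivAt).comp_hasDerivAt u hu

theorem IsPrim.comp' [FiniteDimensional ℝ E] [CompleteSpace E'] {F f : ℝ → E} (h : IsPrim F f)
    {φ : E → E'} (hφ : ContDiff ℝ 1 φ) {g : ℝ → E'}
    (hg : ∀ u d, HasDerivAt F d u → f u = d → HasDerivAt (fun u => φ (F u)) (g u) u) :
    IsPrim (fun u => φ (F u)) g := by
  refine (h.comp hφ).congr_ae ?_
  filter_upwards [h.ae_hasDerivAt] with u hu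
  have : CompleteSpace E := FiniteDimensional.complete ℝ E
  have h1 := ((hφ.differentiable one_ne_zero).differentiableAt.hasFDerivAt
    (x := F u)).comp_hasDerivAt u hu
  exact h1.unique (hg u _ hu rfl)

theorem IsPrim.prodMk {F f : ℝ → E} {G g : ℝ → E'} [CompleteSpace E] [CompleteSpace E']
    (h : IsPrim F f) (h' : IsPrim G g) :
    IsPrim (fun u => (F u, G u)) (fun u => (f u, g u)) := by
  have hi : ∀ a b, IntervalIntegrable (fun u => (f u, g u)) volume a b := fun a b => by
    have h1 := h.integrable a b
    have h2 := h'.integrable a b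
    rw [intervalIntegrable_iff] at h1 h2 ⊢
    exact h1.prodMk h2
  refine ⟨hi, fun a b => ?_⟩
  rw [Prod.mk_sub_mk, h.sub_eq, h'.sub_eq]
  have h3 := (ContinuousLinearMap.fst ℝ E E').intervalIntegral_comp_comm (hi a b)
  have h4 := (ContinuousLinearMap.snd ℝ E E').intervalIntegral_comp_comm (hi a b)
  exact Prod.ext h3 h4

/-- The chain rule for a bilinear map applied to the pair; integrated over a period it becomes
integration by parts. -/
theorem IsPrim.bilin {E'' : Type*} [NormedAddCommGroup E''] [NormedSpace ℝ E'']
    [FiniteDimensional ℝ E] [FiniteDimensional ℝ E'] [CompleteSpace E'']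
    (B : E →L[ℝ] E' →L[ℝ] E'') {F f : ℝ → E} {G g : ℝ → E'} (h : IsPrim F f) (h' : IsPrim G g) :
    IsPrim (fun u => B (F u) (G u)) (fun u => B (f u) (G u) + B (F u) (g u)) := by
  have : CompleteSpace E := FiniteDimensional.complete ℝ E
  have : CompleteSpace E' := FiniteDimensional.complete ℝ E'
  refine ((h.prodMk h').comp (φ := fun x : E × E' => B x.1 x.2)
    B.isBoundedBilinearMap.contDiff).congr_ae (Eventually.of_forall fun u => ?_)
  have := (B.isBoundedBilinearMap.hasFDerivAt (F u, G u)).fderiv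
  rw [this]
  simp [IsBoundedBilinearMap.deriv, add_comm]

theorem IsPrim.add {F f G g : ℝ → E} (h : IsPrim F f) (h' : IsPrim G g) :
    IsPrim (fun u => F u + G u) (fun u => f u + g u) :=
  ⟨fun a b => (h.integrable a b).add (h'.integrable a b), fun a b => by
    rw [intervalIntegral.integral_add (h.integrable a b) (h'.integrable a b), ← h.sub_eq,
      ← h'.sub_eq]; abel⟩

theorem IsPrim.const_smul {F f : ℝ → E} (h : IsPrim F f) (c : ℝ) :
    IsPrim (fun u => c • F u) (fun u => c • f u) :=
  ⟨fun a b => (h.integrable a b).smul c, fun a b => by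
    rw [intervalIntegral.integral_smul, ← h.sub_eq, smul_sub]⟩

theorem IsPrim.sub {F f G g : ℝ → E} (h : IsPrim F f) (h' : IsPrim G g) :
    IsPrim (fun u => F u - G u) (fun u => f u - g u) :=
  ⟨fun a b => (h.integrable a b).sub (h'.integrable a b), fun a b => by
    rw [intervalIntegral.integral_sub (h.integrable a b) (h'.integrable a b), ← h.sub_eq,
      ← h'.sub_eq]; abel⟩

theorem IsPrim.add_const {F f : ℝ → E} (h : IsPrim F f) (c : E) :
    IsPrim (fun u => F u + c) f :=
  ⟨h.integrable, fun a b => by rw [← h.sub_eq]; abel⟩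

theorem IsPrim.shift {F f : ℝ → E} (h : IsPrim F f) (c : ℝ) :
    IsPrim (fun u => F (u + c)) (fun u => f (u + c)) :=
  ⟨fun a b => by simpa using (h.integrable (a + c) (b + c)).comp_add_right c, fun a b => by
    rw [h.sub_eq, intervalIntegral.integral_comp_add_right]⟩

/-- Integration over a period of a function with a periodic primitive. -/
theorem IsPrim.integral_eq_zero {F f : ℝ → E} (h : IsPrim F f) (hp : F 1 = F 0) :
    ∫ x in (0 : ℝ)..1, f x = 0 := by
  rw [← h.sub_eq, hp, sub_self]

theorem isPrim_of_hasDerivAt [CompleteSpace E] {F f : ℝ → E} (h : ∀ u, HasDerivAt F (f u) u)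
    (hf : Continuous f) : IsPrim F f :=
  ⟨fun a b => hf.intervalIntegrable a b, fun a b =>
    (intervalIntegral.integral_eq_sub_of_hasDerivAt (fun x _ => h x)
      (hf.intervalIntegrable a b)).symm⟩

theorem contDiff_one_of_hasDerivAt {F f : ℝ → E} (h : ∀ u, HasDerivAt F (f u) u)
    (hf : Continuous f) : ContDiff ℝ 1 F := by
  rw [contDiff_one_iff_deriv]
  refine ⟨fun u => (h u).differentiableAt, ?_⟩
  rwa [show deriv F = f from funext fun u => (h u).deriv]

theorem IsPrim.scomp [CompleteSpace E] {S w : ℝ → ℝ} (h : IsPrim S w) {φ φ' : ℝ → E}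
    (hφ : ∀ u, HasDerivAt φ (φ' u) u) (hφ' : Continuous φ') :
    IsPrim (fun u => φ (S u)) (fun u => w u • φ' (S u)) :=
  h.comp' (contDiff_one_of_hasDerivAt hφ hφ') fun u d hd hw => by
    rw [hw]; exact (hφ (S u)).scomp u hd

/-- Change of variables along a primitive. -/
theorem IsPrim.integral_smul_comp [CompleteSpace E] {S w : ℝ → ℝ} (h : IsPrim S w) {φ : ℝ → E}
    (hφ : Continuous φ) (a b : ℝ) :
    ∫ u in a..b, w u • φ (S u) = ∫ σ in (S a)..(S b), φ σ := by
  have h1 := h.scomp (φ := fun x => ∫ σ in (0 : ℝ)..x, φ σ) (φ' := φ)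
    (fun u => intervalIntegral.integral_hasDerivAt_right (hφ.intervalIntegrable _ _)
      (hφ.stronglyMeasurableAtFilter _ _) hφ.continuousAt) hφ
  rw [← h1.sub_eq a b, intervalIntegral.integral_interval_sub_left
    (hφ.intervalIntegrable _ _) (hφ.intervalIntegrable _ _)]

theorem intervalIntegrable_const_smul {f : ℝ → E} {a b : ℝ} (h : IntervalIntegrable f volume a b)
    (c : ℝ) : IntervalIntegrable (fun x => c • f x) volume a b := h.smul c

theorem periodic_integral_one {f : ℝ → E} (hf : Function.Periodic f 1) (u : ℝ) :
    ∫ x in u..(u + 1), f x = ∫ x in (0 : ℝ)..1, f x := by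
  simpa using hf.intervalIntegral_add_eq u 0

theorem IsPrim.periodic {F f : ℝ → E} (h : IsPrim F f) (hf : Function.Periodic f 1)
    (h0 : ∫ x in (0 : ℝ)..1, f x = 0) : Function.Periodic F 1 := fun u => by
  rw [h.eq_add u (u + 1), periodic_integral_one hf, h0, add_zero]

end Primitives

/-! ### The periodic Green function of `1 - ∂²` -/

section Kernel

/-- The kernel `(C cosh d - sinh d) / 2`; for `C = coth (ℓ / 2)` it is the periodic Green function
of `1 - ∂²` on a circle of length `ℓ`. -/
def ker (C d : ℝ) : ℝ := (C * Real.cosh d - Real.sinh d) / 2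

/-- The derivative of the kernel. -/
def kerD (C d : ℝ) : ℝ := (C * Real.sinh d - Real.cosh d) / 2

/-- `coth (ℓ / 2)`. -/
def cothHalf (l : ℝ) : ℝ := Real.cosh (l / 2) / Real.sinh (l / 2)

theorem hasDerivAt_ker (C d : ℝ) : HasDerivAt (ker C) (kerD C d) d :=
  (((Real.hasDerivAt_cosh d).const_mul C).sub (Real.hasDerivAt_sinh d)).div_const 2

theorem hasDerivAt_kerD (C d : ℝ) : HasDerivAt (kerD C) (ker C d) d :=
  (((Real.hasDerivAt_sinh d).const_mul C).sub (Real.hasDerivAt_cosh d)).div_const 2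

theorem continuous_ker (C : ℝ) : Continuous (ker C) :=
  continuous_iff_continuousAt.2 fun d => (hasDerivAt_ker C d).continuousAt

theorem continuous_kerD (C : ℝ) : Continuous (kerD C) :=
  continuous_iff_continuousAt.2 fun d => (hasDerivAt_kerD C d).continuousAt

variable {l : ℝ}

theorem sinh_half_pos (hl : 0 < l) : 0 < Real.sinh (l / 2) := Real.sinh_pos_iff.2 (by linarith)

/-- Centring the hyperbolic cosine at the antipodal point makes positivity, symmetry and the minimum
of the kernel visible. -/
theorem ker_eq (hl : 0 < l) (d : ℝ) :
    ker (cothHalf l) d = Real.cosh (d - l / 2) / (2 * Real.sinh (l / 2)) := by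
  have := (sinh_half_pos hl).ne'
  rw [ker, cothHalf, Real.cosh_sub]
  field_simp

theorem kerD_eq (hl : 0 < l) (d : ℝ) :
    kerD (cothHalf l) d = Real.sinh (d - l / 2) / (2 * Real.sinh (l / 2)) := by
  have := (sinh_half_pos hl).ne'
  rw [kerD, cothHalf, Real.sinh_sub]
  field_simp

theorem ker_pos (hl : 0 < l) (d : ℝ) : 0 < ker (cothHalf l) d := by
  rw [ker_eq hl]
  have := sinh_half_pos hl
  have := Real.cosh_pos (d - l / 2)
  positivity

theorem le_ker (hl : 0 < l) (d : ℝ) : 1 / (2 * Real.sinh (l / 2)) ≤ ker (cothHalf l) d := by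
  rw [ker_eq hl]
  have := sinh_half_pos hl
  gcongr
  exact Real.one_le_cosh _

theorem ker_symm (hl : 0 < l) (d : ℝ) : ker (cothHalf l) (l - d) = ker (cothHalf l) d := by
  rw [ker_eq hl, ker_eq hl, ← Real.cosh_neg (d - l / 2)]
  congr 2; ring

/-- This is `|sinh| ≤ cosh`. It lets terms with the derivative of the kernel be absorbed by terms
with the kernel itself in the weighted length estimate. -/
theorem abs_kerD_le (hl : 0 < l) (d : ℝ) : |kerD (cothHalf l) d| ≤ ker (cothHalf l) d := by
  rw [ker_eq hl, kerD_eq hl, abs_div, abs_of_pos (by have := sinh_half_pos hl; positivity :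
    0 < 2 * Real.sinh (l / 2))]
  have := sinh_half_pos hl
  gcongr
  rw [Real.abs_sinh, ← Real.cosh_abs (d - l / 2)]
  exact (Real.sinh_lt_cosh _).le

theorem ker_self (hl : 0 < l) : ker (cothHalf l) l = ker (cothHalf l) 0 := by
  simpa using ker_symm hl 0

theorem kerD_zero (C : ℝ) : kerD C 0 = -1 / 2 := by simp [kerD]

theorem kerD_self (hl : 0 < l) : kerD (cothHalf l) l = 1 / 2 := by
  have := (sinh_half_pos hl).ne'
  rw [kerD_eq hl, sub_half]
  field_simp

theorem kerD_mono (hl : 0 < l) : Monotone (kerD (cothHalf l)) := by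
  intro x y hxy
  rw [kerD_eq hl, kerD_eq hl]
  have := sinh_half_pos hl
  gcongr
  exact Real.sinh_le_sinh.2 (by linarith)

theorem cothHalf_nonneg (hl : 0 < l) : 0 ≤ cothHalf l :=
  div_nonneg (Real.cosh_pos _).le (sinh_half_pos hl).le

/-- The coefficient of the kernel blows up as the length tends to zero, so all uniform estimates
need a lower bound `a` for the length. -/
theorem cothHalf_le {a : ℝ} (ha : 0 < a) (hal : a ≤ l) :
    cothHalf l ≤ 1 + 1 / Real.sinh (a / 2) := by
  have h1 := sinh_half_pos ha
  have h2 : Real.sinh (a / 2) ≤ Real.sinh (l / 2) := Real.sinh_le_sinh.2 (by linarith)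
  have h3 : Real.cosh (l / 2) ≤ Real.sinh (l / 2) + 1 := by
    have := Real.cosh_sub_sinh (l / 2)
    have : Real.exp (-(l / 2)) ≤ 1 := Real.exp_le_one_iff.2 (by linarith)
    linarith
  calc cothHalf l ≤ (Real.sinh (l / 2) + 1) / Real.sinh (l / 2) := by
        unfold cothHalf; gcongr; linarith
    _ = 1 + 1 / Real.sinh (l / 2) := by rw [add_div, div_self (h1.trans_le h2).ne']
    _ ≤ _ := by gcongr

theorem abs_cothHalf_sub_le {a x y : ℝ} (ha : 0 < a) (hx : a ≤ x) (hy : a ≤ y) :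
    |cothHalf x - cothHalf y| ≤ 1 / Real.sinh (a / 2) ^ 2 * |x - y| := by
  have h := (convex_Ici a).norm_image_sub_le_of_norm_hasDerivWithin_le (f := cothHalf)
    (f' := fun z => -(1 / 2) / Real.sinh (z / 2) ^ 2) (C := 1 / Real.sinh (a / 2) ^ 2)
    (fun z hz => ?_) (fun z hz => ?_) (Set.mem_Ici.2 hy) (Set.mem_Ici.2 hx)
  · simpa using h
  · have hz0 : 0 < z := lt_of_lt_of_le ha hz
    have hs := sinh_half_pos hz0
    have h1 : HasDerivAt (fun z : ℝ => z / 2) (1 / 2) z := (hasDerivAt_id z).div_const 2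
    have h2 := (h1.cosh).div (h1.sinh) hs.ne'
    refine (h2.congr_deriv ?_).hasDerivWithinAt
    have := Real.cosh_sq (z / 2)
    congr 1
    nlinarith
  · have h1 := sinh_half_pos ha
    have h2 : Real.sinh (a / 2) ≤ Real.sinh (z / 2) :=
      Real.sinh_le_sinh.2 (by have : a ≤ z := hz; linarith)
    rw [norm_div, norm_neg, Real.norm_of_nonneg (by norm_num : (0 : ℝ) ≤ 1 / 2),
      Real.norm_of_nonneg (by positivity)]
    gcongr
    norm_num

theorem sinh_le_mul_cosh {x : ℝ} (hx : 0 ≤ x) : Real.sinh x ≤ x * Real.cosh x := by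
  have hd : ∀ y, HasDerivAt (fun y : ℝ => y * Real.cosh y - Real.sinh y) (y * Real.sinh y) y := by
    intro y
    refine (((hasDerivAt_id y).mul (Real.hasDerivAt_cosh y)).sub
      (Real.hasDerivAt_sinh y)).congr_deriv ?_
    simp
  have hm : MonotoneOn (fun y : ℝ => y * Real.cosh y - Real.sinh y) (Set.Ici 0) := by
    refine monotoneOn_of_deriv_nonneg (convex_Ici 0)
      (fun y _ => (hd y).continuousAt.continuousWithinAt)
      (fun y _ => (hd y).differentiableAt.differentiableWithinAt) fun y hy => ?_
    rw [interior_Ici] at hy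
    rw [(hd y).deriv]
    exact mul_nonneg (le_of_lt hy) (Real.sinh_nonneg_iff.2 (le_of_lt hy))
  have := hm (Set.mem_Ici.2 le_rfl) (Set.mem_Ici.2 hx) hx
  simp at this
  linarith

/-- With `x = l / 2`, the chain is `x / sinh x ≥ 1 / cosh x ≥ exp (-x² / 2) ≥ 1 - x² / 2`. The left
side is the total mass `1` of the kernel minus the mass of its minimum. -/
theorem one_sub_div_sinh_le (hl : 0 < l) : 1 - 1 / (2 * Real.sinh (l / 2)) * l ≤ l ^ 2 / 8 := by
  have hs := sinh_half_pos hl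
  have h1 : Real.sinh (l / 2) ≤ l / 2 * Real.cosh (l / 2) := sinh_le_mul_cosh (by linarith)
  have h2 : Real.cosh (l / 2) ≤ Real.exp ((l / 2) ^ 2 / 2) := Real.cosh_le_exp_half_sq _
  have h3 : 1 - (l / 2) ^ 2 / 2 ≤ Real.exp (-((l / 2) ^ 2 / 2)) := by
    have := Real.add_one_le_exp (-((l / 2) ^ 2 / 2)); linarith
  have hc := Real.cosh_pos (l / 2)
  have h4 : Real.exp (-((l / 2) ^ 2 / 2)) ≤ 1 / Real.cosh (l / 2) := by
    rw [Real.exp_neg, ← one_div]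
    exact one_div_le_one_div_of_le hc h2
  have h5 : 1 / Real.cosh (l / 2) ≤ 1 / (2 * Real.sinh (l / 2)) * l := by
    rw [div_mul_eq_mul_div, div_le_div_iff₀ hc (by positivity)]
    nlinarith
  nlinarith

theorem abs_cosh_sub_cosh_le {b x y : ℝ} (hx : x ∈ Set.Icc 0 b) (hy : y ∈ Set.Icc 0 b) :
    |Real.cosh x - Real.cosh y| ≤ Real.cosh b * |x - y| := by
  have h := (convex_Icc 0 b).norm_image_sub_le_of_norm_hasDerivWithin_le (f := Real.cosh)
    (f' := Real.sinh) (C := Real.cosh b)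
    (fun z _ => (Real.hasDerivAt_cosh z).hasDerivWithinAt) (fun z hz => ?_) hy hx
  · simpa using h
  · rw [Real.norm_of_nonneg (Real.sinh_nonneg_iff.2 hz.1)]
    exact (Real.sinh_lt_cosh z).le.trans
      (Real.cosh_le_cosh.2 (by rw [abs_of_nonneg hz.1, abs_of_nonneg (hz.1.trans hz.2)]; exact hz.2))

theorem abs_sinh_sub_sinh_le {b x y : ℝ} (hx : x ∈ Set.Icc 0 b) (hy : y ∈ Set.Icc 0 b) :
    |Real.sinh x - Real.sinh y| ≤ Real.cosh b * |x - y| := by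
  have h := (convex_Icc 0 b).norm_image_sub_le_of_norm_hasDerivWithin_le (f := Real.sinh)
    (f' := Real.cosh) (C := Real.cosh b)
    (fun z _ => (Real.hasDerivAt_sinh z).hasDerivWithinAt) (fun z hz => ?_) hy hx
  · simpa using h
  · rw [Real.norm_of_nonneg (Real.cosh_pos z).le]
    exact Real.cosh_le_cosh.2 (by
      rw [abs_of_nonneg hz.1, abs_of_nonneg (hz.1.trans hz.2)]; exact hz.2)

theorem abs_ker_le {b c C d : ℝ} (hC : |C| ≤ c) (hd : d ∈ Set.Icc 0 b) :
    |ker C d| ≤ (c + 1) * Real.cosh b := by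
  have h1 : Real.cosh d ≤ Real.cosh b := Real.cosh_le_cosh.2 (by
      rw [abs_of_nonneg hd.1, abs_of_nonneg (hd.1.trans hd.2)]; exact hd.2)
  have h2 := Real.sinh_lt_cosh d
  have h3 := Real.sinh_nonneg_iff.2 hd.1
  have h4 := Real.cosh_pos d
  have h5 := abs_nonneg C
  have hc := h5.trans hC
  rw [ker, abs_div, abs_two]
  have h6 : |C * Real.cosh d - Real.sinh d| ≤ |C| * Real.cosh d + Real.sinh d := by
    refine (abs_sub _ _).trans ?_
    rw [abs_mul, abs_of_pos h4, abs_of_nonneg h3]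
  have h7 : |C| * Real.cosh d ≤ c * Real.cosh b := by gcongr
  have h8 : 0 ≤ c * Real.cosh b := mul_nonneg hc (Real.cosh_pos b).le
  have h9 := Real.cosh_pos b
  linarith

theorem abs_ker_sub_le {b c C C' d d' : ℝ} (hC : |C| ≤ c) (hd : d ∈ Set.Icc 0 b)
    (hd' : d' ∈ Set.Icc 0 b) :
    |ker C d - ker C' d'| ≤ (c + 1) * Real.cosh b * |d - d'| + Real.cosh b * |C - C'| := by
  have h1 : Real.cosh d' ≤ Real.cosh b := Real.cosh_le_cosh.2 (by
      rw [abs_of_nonneg hd'.1, abs_of_nonneg (hd'.1.trans hd'.2)]; exact hd'.2)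
  have e : ker C d - ker C' d' = (C * (Real.cosh d - Real.cosh d') -
    (Real.sinh d - Real.sinh d') + (C - C') * Real.cosh d') / 2 := by simp only [ker]; ring
  have h2 := abs_cosh_sub_cosh_le hd hd'
  have h3 := abs_sinh_sub_sinh_le hd hd'
  have h4 := Real.cosh_pos d'
  have h5 := abs_nonneg C
  have hc := h5.trans hC
  rw [e, abs_div, abs_two]
  have h6 : |C * (Real.cosh d - Real.cosh d') - (Real.sinh d - Real.sinh d') +
      (C - C') * Real.cosh d'| ≤ |C| * |Real.cosh d - Real.cosh d'| +
      |Real.sinh d - Real.sinh d'| + |C - C'| * Real.cosh d' := by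
    refine (abs_add_le _ _).trans ?_
    rw [abs_mul (C - C'), abs_of_pos h4]
    gcongr
    refine (abs_sub _ _).trans ?_
    rw [abs_mul]
  have h7 : |C| * |Real.cosh d - Real.cosh d'| ≤ c * (Real.cosh b * |d - d'|) := by gcongr
  have h8 : |C - C'| * Real.cosh d' ≤ |C - C'| * Real.cosh b := by gcongr
  have h9 : 0 ≤ c * (Real.cosh b * |d - d'|) := by
    have := Real.cosh_pos b
    positivity
  have h10 : 0 ≤ |C - C'| * Real.cosh b := by
    have := Real.cosh_pos b
    positivity
  have h11 : 0 ≤ Real.cosh b * |d - d'| := by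
    have := Real.cosh_pos b
    positivity
  nlinarith

end Kernel

/-! ### Arclength and convolution with the kernel -/

section Arc

/-- `1`-periodic integrable functions. -/
structure PerInt (f : ℝ → Plane) : Prop where
  periodic : Function.Periodic f 1
  integrable : IntervalIntegrable f volume 0 1

theorem PerInt.intervalIntegrable {f : ℝ → Plane} (hf : PerInt f) (a b : ℝ) :
    IntervalIntegrable f volume a b :=
  hf.periodic.intervalIntegrable₀ one_ne_zero hf.integrable a b

/-- The primitive of `‖f‖`. -/
def arc (f : ℝ → Plane) (u : ℝ) : ℝ := ∫ x in (0 : ℝ)..u, ‖f x‖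

/-- The integral of `‖f‖` over a period. -/
def len (f : ℝ → Plane) : ℝ := ∫ x in (0 : ℝ)..1, ‖f x‖

variable {f g : ℝ → Plane}

theorem PerInt.norm_periodic (hf : PerInt f) : Function.Periodic (fun u => ‖f u‖) 1 := fun u => by
  simp only [hf.periodic u]

theorem PerInt.isPrim_arc (hf : PerInt f) : IsPrim (arc f) (fun u => ‖f u‖) :=
  isPrim_integral (fun a b => (hf.intervalIntegrable a b).norm) 0

theorem PerInt.continuous_arc (hf : PerInt f) : Continuous (arc f) := hf.isPrim_arc.continuous

theorem PerInt.arc_sub (hf : PerInt f) (u v : ℝ) : arc f v - arc f u = ∫ x in u..v, ‖f x‖ :=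
  hf.isPrim_arc.sub_eq u v

theorem PerInt.monotone_arc (hf : PerInt f) : Monotone (arc f) := fun u v huv => by
  rw [← sub_nonneg, hf.arc_sub]
  exact intervalIntegral.integral_nonneg huv fun _ _ => norm_nonneg _

theorem PerInt.arc_add_one (hf : PerInt f) (u : ℝ) : arc f (u + 1) = arc f u + len f := by
  rw [hf.isPrim_arc.eq_add u, periodic_integral_one hf.norm_periodic, len]

theorem arc_zero (f : ℝ → Plane) : arc f 0 = 0 := by simp [arc]

theorem arc_one (f : ℝ → Plane) : arc f 1 = len f := rfl

theorem len_nonneg (f : ℝ → Plane) : 0 ≤ len f :=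
  intervalIntegral.integral_nonneg zero_le_one fun _ _ => norm_nonneg _

theorem PerInt.arc_sub_mem (hf : PerInt f) {u v : ℝ} (hv : v ∈ Set.Icc u (u + 1)) :
    arc f v - arc f u ∈ Set.Icc 0 (len f) := by
  have h1 := hf.monotone_arc hv.1
  have h2 := hf.monotone_arc hv.2
  rw [hf.arc_add_one] at h2
  exact ⟨by linarith, by linarith⟩

theorem PerInt.sub (hf : PerInt f) (hg : PerInt g) : PerInt (fun u => f u - g u) :=
  ⟨fun u => by simp only [hf.periodic u, hg.periodic u], hf.integrable.sub hg.integrable⟩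

theorem PerInt.abs_arc_sub_sub_le (hf : PerInt f) (hg : PerInt g) {u v : ℝ}
    (hv : v ∈ Set.Icc u (u + 1)) :
    |(arc f v - arc f u) - (arc g v - arc g u)| ≤ len (fun x => f x - g x) := by
  rw [hf.arc_sub, hg.arc_sub, ← intervalIntegral.integral_sub (hf.intervalIntegrable _ _).norm
    (hg.intervalIntegrable _ _).norm]
  have hfg := hf.sub hg
  calc |∫ x in u..v, (‖f x‖ - ‖g x‖)| ≤ ∫ x in u..v, ‖f x - g x‖ := by
        have h1 : ∀ᵐ x, x ∈ Set.Ioc u v → ‖‖f x‖ - ‖g x‖‖ ≤ ‖f x - g x‖ :=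
          Eventually.of_forall fun x _ => abs_norm_sub_norm_le _ _
        exact intervalIntegral.norm_integral_le_of_norm_le hv.1 h1 (hfg.intervalIntegrable u v).norm
    _ = arc (fun x => f x - g x) v - arc (fun x => f x - g x) u := (hfg.arc_sub u v).symm
    _ ≤ _ := (hfg.arc_sub_mem hv).2

theorem PerInt.abs_len_sub_le (hf : PerInt f) (hg : PerInt g) :
    |len f - len g| ≤ len (fun x => f x - g x) := by
  have := hf.abs_arc_sub_sub_le hg (u := 0) (v := 1) (by simp)
  simpa [arc_zero, arc_one] using this

/-- The convolution of `f` with the kernel, in the arclength variable of `f`. -/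
def qf (C : ℝ) (f : ℝ → Plane) (u : ℝ) : Plane :=
  ∫ v in u..(u + 1), ker C (arc f v - arc f u) • f v

theorem PerInt.qf_integrable (hf : PerInt f) (C u a b : ℝ) :
    IntervalIntegrable (fun v => ker C (arc f v - arc f u) • f v) volume a b :=
  (hf.intervalIntegrable a b).continuousOn_smul
    ((continuous_ker C).comp (hf.continuous_arc.sub continuous_const)).continuousOn

theorem PerInt.qf_periodic (hf : PerInt f) (C : ℝ) : Function.Periodic (qf C f) 1 := fun u => by
  rw [qf, qf, ← intervalIntegral.integral_comp_add_right]
  simp only [hf.arc_add_one, hf.periodic _, add_sub_add_right_eq_sub]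

/-- The addition formulas separate `u` from `v`, so that `u` enters only through continuous factors
and the limits of integration; continuity in `u` follows. -/
theorem PerInt.qf_eq (hf : PerInt f) (C u : ℝ) :
    qf C f u = (1 / 2 : ℝ) • ((C * Real.cosh (arc f u) + Real.sinh (arc f u)) •
        (∫ v in u..(u + 1), Real.cosh (arc f v) • f v) -
      (C * Real.sinh (arc f u) + Real.cosh (arc f u)) •
        ∫ v in u..(u + 1), Real.sinh (arc f v) • f v) := by
  have h1 : IntervalIntegrable (fun v => Real.cosh (arc f v) • f v) volume u (u + 1) :=
    (hf.intervalIntegrable _ _).continuousOn_smul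
      (Real.continuous_cosh.comp hf.continuous_arc).continuousOn
  have h2 : IntervalIntegrable (fun v => Real.sinh (arc f v) • f v) volume u (u + 1) :=
    (hf.intervalIntegrable _ _).continuousOn_smul
      (Real.continuous_sinh.comp hf.continuous_arc).continuousOn
  rw [qf, ← intervalIntegral.integral_smul, ← intervalIntegral.integral_smul,
    ← intervalIntegral.integral_sub (intervalIntegrable_const_smul h1 _)
      (intervalIntegrable_const_smul h2 _), ← intervalIntegral.integral_smul]
  refine intervalIntegral.integral_congr fun v _ => ?_
  simp only [smul_smul, ← sub_smul]
  congr 1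
  rw [ker, Real.cosh_sub, Real.sinh_sub]
  ring

theorem continuous_integral_period {h : ℝ → Plane}
    (hh : ∀ a b, IntervalIntegrable h volume a b) :
    Continuous fun u => ∫ v in u..(u + 1), h v := by
  have h1 := intervalIntegral.continuous_primitive hh 0
  have : (fun u => ∫ v in u..(u + 1), h v) =
      fun u => (∫ v in (0 : ℝ)..(u + 1), h v) - ∫ v in (0 : ℝ)..u, h v := funext fun u =>
    (intervalIntegral.integral_interval_sub_left (hh _ _) (hh _ _)).symm
  rw [this]
  exact (h1.comp (continuous_id.add continuous_const)).sub h1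

theorem PerInt.qf_continuous (hf : PerInt f) (C : ℝ) : Continuous (qf C f) := by
  have hS := hf.continuous_arc
  have h1 := continuous_integral_period (h := fun v => Real.cosh (arc f v) • f v) fun a b =>
    (hf.intervalIntegrable a b).continuousOn_smul (Real.continuous_cosh.comp hS).continuousOn
  have h2 := continuous_integral_period (h := fun v => Real.sinh (arc f v) • f v) fun a b =>
    (hf.intervalIntegrable a b).continuousOn_smul (Real.continuous_sinh.comp hS).continuousOn
  rw [funext (hf.qf_eq C)]
  fun_prop

/-- The arclength substitution turns the integral into that of `ker C`, which has the primitive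
`kerD C`. -/
theorem PerInt.integral_ker (hf : PerInt f) (C u v : ℝ) :
    ∫ x in u..v, ker C (arc f x - arc f u) * ‖f x‖ = kerD C (arc f v - arc f u) - kerD C 0 := by
  have h := (hf.isPrim_arc.add_const (-arc f u)).integral_smul_comp (continuous_ker C) u v
  simp only [smul_eq_mul, ← sub_eq_add_neg, sub_self] at h
  simp only [mul_comm (ker C _)]
  rw [h]
  exact intervalIntegral.integral_eq_sub_of_hasDerivAt (fun x _ => hasDerivAt_kerD C x)
    ((continuous_ker C).intervalIntegrable _ _)

/-- The kernel is positive and its mass over a full circle of length `l` is `1/2 - (-1/2) = 1`.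
Allowing `len f < l` covers the truncated length. -/
theorem PerInt.norm_qf_le_one (hf : PerInt f) {l : ℝ} (hl : 0 < l) (h : len f ≤ l) (u : ℝ) :
    ‖qf (cothHalf l) f u‖ ≤ 1 := by
  have h1 : ‖qf (cothHalf l) f u‖ ≤
      ∫ x in u..(u + 1), ker (cothHalf l) (arc f x - arc f u) * ‖f x‖ := by
    refine (intervalIntegral.norm_integral_le_integral_norm (by linarith)).trans_eq ?_
    refine intervalIntegral.integral_congr fun x _ => ?_
    simp only [norm_smul, Real.norm_of_nonneg (ker_pos hl _).le]
  refine h1.trans ?_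
  rw [hf.integral_ker, hf.arc_add_one, add_sub_cancel_left, kerD_zero]
  have := kerD_mono hl h
  rw [kerD_self hl] at this
  linarith

/-- Since `f` has mean zero, the minimum `m` of the kernel may be subtracted. What remains is
nonnegative and has mass `1 - m L ≤ L² / 8`. This quadratic gain makes the rescaled flow converge.
-/
theorem PerInt.norm_qf_le_sq (hf : PerInt f) (hl : 0 < len f) (h0 : ∫ x in (0 : ℝ)..1, f x = 0)
    (u : ℝ) : ‖qf (cothHalf (len f)) f u‖ ≤ len f ^ 2 / 8 := by
  set C := cothHalf (len f)
  set m := 1 / (2 * Real.sinh (len f / 2))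
  have h2 : qf C f u = ∫ x in u..(u + 1), (ker C (arc f x - arc f u) - m) • f x := by
    have h3 : ∫ x in u..(u + 1), m • f x = 0 := by
      rw [intervalIntegral.integral_smul, periodic_integral_one hf.periodic, h0, smul_zero]
    simp only [sub_smul]
    rw [intervalIntegral.integral_sub (hf.qf_integrable C u _ _)
      (intervalIntegrable_const_smul (hf.intervalIntegrable _ _) m), h3, sub_zero, qf]
  have hk : IntervalIntegrable (fun x => ker C (arc f x - arc f u) * ‖f x‖) volume u (u + 1) :=
    (hf.intervalIntegrable _ _).norm.continuousOn_mul
      ((continuous_ker C).comp (hf.continuous_arc.sub continuous_const)).continuousOn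
  have h1 : ‖qf C f u‖ ≤ ∫ x in u..(u + 1), (ker C (arc f x - arc f u) * ‖f x‖ - m * ‖f x‖) := by
    rw [h2]
    refine (intervalIntegral.norm_integral_le_integral_norm (by linarith)).trans_eq ?_
    refine intervalIntegral.integral_congr fun x _ => ?_
    simp only [norm_smul]
    rw [Real.norm_of_nonneg (sub_nonneg.2 (le_ker hl _)), sub_mul]
  refine h1.trans ?_
  rw [intervalIntegral.integral_sub hk ((hf.intervalIntegrable _ _).norm.const_mul m),
    hf.integral_ker, hf.arc_add_one, add_sub_cancel_left, kerD_zero, kerD_self hl,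
    intervalIntegral.integral_const_mul, periodic_integral_one hf.norm_periodic]
  have := one_sub_div_sinh_le hl
  change _ - m * len f ≤ _
  linarith

/-- The convolution is Lipschitz in the derivative of the curve for the `L¹` norm, uniformly in `u`:
arclengths are `L¹`-Lipschitz in `f`, and the kernel is Lipschitz in arclength and in its
coefficient. -/
theorem PerInt.norm_qf_sub_le (hf : PerInt f) (hg : PerInt g) {b c C C' : ℝ} (hC : |C| ≤ c)
    (hfb : len f ≤ b) (hgb : len g ≤ b) (u : ℝ) :
    ‖qf C f u - qf C' g u‖ ≤
      (1 + b) * ((c + 1) * Real.cosh b) * (len (fun x => f x - g x) + |C - C'|) := by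
  set δ := len (fun x => f x - g x)
  set K := (c + 1) * Real.cosh b
  have hc : 0 ≤ c := (abs_nonneg C).trans hC
  have hδ : 0 ≤ δ := len_nonneg _
  have hb : 0 ≤ b := (len_nonneg f).trans hfb
  have hK : Real.cosh b ≤ K := by
    have := Real.cosh_pos b
    simp only [K]; nlinarith
  have hK0 : 0 ≤ K := (Real.cosh_pos b).le.trans hK
  have hfg := hf.sub hg
  rw [qf, qf, ← intervalIntegral.integral_sub (hf.qf_integrable C u _ _)
    (hg.qf_integrable C' u _ _)]
  have key : ∀ v ∈ Set.Ioc u (u + 1),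
      ‖ker C (arc f v - arc f u) • f v - ker C' (arc g v - arc g u) • g v‖ ≤
      K * ‖f v - g v‖ + K * (δ + |C - C'|) * ‖g v‖ := by
    intro v hv
    have hv' : v ∈ Set.Icc u (u + 1) := ⟨hv.1.le, hv.2⟩
    have hd := hf.arc_sub_mem hv'
    have hd' := hg.arc_sub_mem hv'
    have hdb : arc f v - arc f u ∈ Set.Icc 0 b := ⟨hd.1, hd.2.trans hfb⟩
    have hdb' : arc g v - arc g u ∈ Set.Icc 0 b := ⟨hd'.1, hd'.2.trans hgb⟩
    have e : ker C (arc f v - arc f u) • f v - ker C' (arc g v - arc g u) • g v =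
        ker C (arc f v - arc f u) • (f v - g v) +
        (ker C (arc f v - arc f u) - ker C' (arc g v - arc g u)) • g v := by
      rw [smul_sub, sub_smul]; abel
    rw [e]
    refine (norm_add_le _ _).trans ?_
    rw [norm_smul, norm_smul]
    gcongr
    · exact abs_ker_le hC hdb
    · refine (abs_ker_sub_le hC hdb hdb').trans ?_
      have h1 := hf.abs_arc_sub_sub_le hg hv'
      have h2 : K * |(arc f v - arc f u) - (arc g v - arc g u)| ≤ K * δ := by gcongr
      have h3 : Real.cosh b * |C - C'| ≤ K * |C - C'| := by gcongr
      linarith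
  have hi1 := ((hfg.intervalIntegrable u (u + 1)).norm.const_mul K)
  have hi2 := ((hg.intervalIntegrable u (u + 1)).norm.const_mul (K * (δ + |C - C'|)))
  refine (intervalIntegral.norm_integral_le_of_norm_le (by linarith)
    (Eventually.of_forall key) (hi1.add hi2)).trans ?_
  rw [intervalIntegral.integral_add hi1 hi2, intervalIntegral.integral_const_mul,
    intervalIntegral.integral_const_mul, periodic_integral_one hfg.norm_periodic,
    periodic_integral_one hg.norm_periodic]
  change K * δ + K * (δ + |C - C'|) * len g ≤ _
  have h4 : K * (δ + |C - C'|) * len g ≤ K * (δ + |C - C'|) * b := by gcongr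
  have h5 : 0 ≤ K * |C - C'| := by positivity
  nlinarith

end Arc

/-! ### Global solutions of ordinary differential equations of linear growth -/

section GlobalODE

open Set Metric
open scoped NNReal

variable {F : Type*} [NormedAddCommGroup F] [NormedSpace ℝ F]

/-- The radial retraction onto the ball of radius `R`. -/
def radialRetraction (R : ℝ) (x : F) : F := (R / max R ‖x‖) • x

theorem radialRetraction_of_norm_le {R : ℝ} (hR : 0 < R) {x : F} (hx : ‖x‖ ≤ R) :
    radialRetraction R x = x := by
  rw [radialRetraction, max_eq_left hx, div_self hR.ne', one_smul]

theorem norm_radialRetraction_le_norm {R : ℝ} (hR : 0 < R) (x : F) :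
    ‖radialRetraction R x‖ ≤ ‖x‖ := by
  have h : 0 < max R ‖x‖ := lt_max_of_lt_left hR
  rw [radialRetraction, norm_smul, Real.norm_of_nonneg (by positivity)]
  exact mul_le_of_le_one_left (norm_nonneg x) ((div_le_one h).2 (le_max_left _ _))

theorem norm_radialRetraction_le {R : ℝ} (hR : 0 < R) (x : F) : ‖radialRetraction R x‖ ≤ R := by
  have h : 0 < max R ‖x‖ := lt_max_of_lt_left hR
  rw [radialRetraction, norm_smul, Real.norm_of_nonneg (by positivity), div_mul_eq_mul_div,
    div_le_iff₀ h]
  exact mul_le_mul_of_nonneg_left (le_max_right _ _) hR.le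

/-- The change of the vector and the change of the scaling factor each contribute at most `‖x - y‖`,
whence the constant `2`. -/
theorem lipschitzWith_radialRetraction {R : ℝ} (hR : 0 < R) :
    LipschitzWith 2 (radialRetraction (F := F) R) := by
  refine LipschitzWith.of_dist_le_mul fun x y => ?_
  rw [dist_eq_norm, dist_eq_norm]
  set a := max R ‖x‖
  set b := max R ‖y‖
  have ha : 0 < a := lt_max_of_lt_left hR
  have hb : 0 < b := lt_max_of_lt_left hR
  have e : radialRetraction R x - radialRetraction R y =
      (R / a) • (x - y) + (R / a - R / b) • y := by
    simp only [radialRetraction, smul_sub, sub_smul, a, b]; abel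
  have hab : |b - a| ≤ ‖x - y‖ := by
    have h1 := abs_max_sub_max_le_abs ‖y‖ ‖x‖ R
    rw [max_comm ‖y‖, max_comm ‖x‖] at h1
    refine h1.trans ((abs_norm_sub_norm_le y x).trans_eq (norm_sub_rev _ _))
  have h2 : ‖(R / a) • (x - y)‖ ≤ ‖x - y‖ := by
    rw [norm_smul, Real.norm_of_nonneg (by positivity)]
    exact mul_le_of_le_one_left (norm_nonneg _) ((div_le_one ha).2 (le_max_left _ _))
  have h3 : ‖(R / a - R / b) • y‖ ≤ |b - a| := by
    have e2 : R / a - R / b = (R / a) * ((b - a) / b) := by field_simp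
    rw [norm_smul, e2, norm_mul, Real.norm_of_nonneg (by positivity), norm_div,
      Real.norm_of_nonneg hb.le, Real.norm_eq_abs, mul_assoc]
    have h4 : |b - a| / b * ‖y‖ ≤ |b - a| := by
      rw [div_mul_eq_mul_div, div_le_iff₀ hb]
      exact mul_le_mul_of_nonneg_left (le_max_right _ _) (abs_nonneg _)
    calc R / a * (|b - a| / b * ‖y‖) ≤ 1 * |b - a| := by
          gcongr
          exact (div_le_one ha).2 (le_max_left _ _)
      _ = _ := one_mul _
  rw [e]
  refine (norm_add_le _ _).trans ?_
  push_cast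
  linarith

/-- Gronwall's inequality forward in time; negative times follow by reversing time. -/
theorem norm_le_exp_of_hasDerivWithinAt {x x' : ℝ → F} {T : ℝ} (hT : 0 < T)
    (hd : ∀ t ∈ Icc (-T) T, HasDerivWithinAt x (x' t) (Icc (-T) T) t)
    (hb : ∀ t ∈ Icc (-T) T, ‖x' t‖ ≤ ‖x t‖) :
    ∀ t ∈ Icc (-T) T, ‖x t‖ ≤ ‖x 0‖ * Real.exp T := by
  have main : ∀ y y' : ℝ → F, (∀ t ∈ Icc 0 T, HasDerivWithinAt y (y' t) (Icc 0 T) t) →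
      (∀ t ∈ Icc 0 T, ‖y' t‖ ≤ ‖y t‖) → ∀ t ∈ Icc 0 T, ‖y t‖ ≤ ‖y 0‖ * Real.exp T := by
    intro y y' hy hyb t ht
    have h1 := norm_le_gronwallBound_of_norm_deriv_right_le (f := y) (f' := y') (δ := ‖y 0‖)
      (K := 1) (ε := 0) (a := 0) (b := T) (fun s hs => (hy s hs).continuousWithinAt)
      (fun s hs => (hy s ⟨hs.1, hs.2.le⟩).mono_of_mem_nhdsWithin
        (mem_of_superset (Icc_mem_nhdsGE hs.2) (Icc_subset_Icc_left hs.1))) le_rfl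
      (fun s hs => by simpa using hyb s ⟨hs.1, hs.2.le⟩) t ht
    rw [gronwallBound_ε0] at h1
    refine h1.trans ?_
    gcongr
    linarith [ht.2]
  intro t ht
  rcases le_total 0 t with h0 | h0
  · refine main x x' (fun s hs => (hd s ⟨by linarith [hs.1], hs.2⟩).mono
      (Icc_subset_Icc_left (by linarith))) (fun s hs => hb s ⟨by linarith [hs.1], hs.2⟩) t
      ⟨h0, ht.2⟩
  · have h := main (fun s => x (-s)) (fun s => -x' (-s)) (fun s hs => ?_) (fun s hs => ?_) (-t)
      ⟨by linarith, by linarith [ht.1]⟩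
    · simpa using h
    · have h1 := hd (-s) ⟨by linarith [hs.2], by linarith [hs.1]⟩
      have h2 : HasDerivWithinAt (fun s : ℝ => -s) (-1) (Icc 0 T) s :=
        (hasDerivAt_neg s).hasDerivWithinAt
      have h3 := h1.scomp s h2 (t' := Icc (-T) T) (fun r hr => ⟨by linarith [hr.2], by linarith [hr.1]⟩)
      simp only [neg_smul, one_smul] at h3
      exact h3
    · rw [norm_neg]
      exact hb (-s) ⟨by linarith [hs.2], by linarith [hs.1]⟩

variable [CompleteSpace F]

/-- Composing the field with the retraction onto a ball makes it globally Lipschitz and bounded, so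
Picard-Lindelöf applies on all of `[-T, T]`. The growth bound keeps the solution inside the ball,
where the retraction does nothing. -/
theorem exists_solution_Ioo {V : ℝ → F → F}
    (hlip : ∀ T R : ℝ, ∃ K : ℝ≥0, ∀ t ∈ Icc (-T) T, LipschitzOnWith K (V t) (closedBall 0 R))
    (hcont : ∀ x, Continuous fun t => V t x) (hbd : ∀ t x, ‖V t x‖ ≤ ‖x‖) (x₀ : F) {T : ℝ}
    (hT : 0 < T) :
    ∃ x : ℝ → F, x 0 = x₀ ∧ ∀ t ∈ Ioo (-T) T,
      HasDerivAt x (V t (x t)) t ∧ x t ∈ closedBall (0 : F) (‖x₀‖ * Real.exp T + 1) := by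
  set R : ℝ := ‖x₀‖ * Real.exp T + 1 with hRdef
  have hR : 0 < R := by positivity
  obtain ⟨K, hK⟩ := hlip T R
  have hmaps : ∀ x : F, radialRetraction R x ∈ closedBall (0 : F) R := fun x => by
    simpa using norm_radialRetraction_le hR x
  -- The retracted field is bounded by `R`, so over time `T` the solution moves by at most `R * T`;
  -- this is the radius allowed around `x₀`.
  have hPL : IsPicardLindelof (fun t x => V t (radialRetraction R x))
      (tmin := -T) (tmax := T) ⟨0, by constructor <;> linarith⟩ x₀ ⟨R * T, by positivity⟩ 0
      ⟨R, hR.le⟩ (K * 2) := by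
    refine ⟨fun t ht => ?_, fun x _ => ((hcont _).continuousOn), fun t _ x _ => ?_, ?_⟩
    · exact (hK t ht).comp ((lipschitzWith_radialRetraction hR).lipschitzOnWith)
        (fun x _ => hmaps x)
    · exact (hbd t _).trans (norm_radialRetraction_le hR x)
    · change R * max (T - 0) (0 - -T) ≤ R * T - 0
      simp
  obtain ⟨x, hx0, hx⟩ := hPL.exists_eq_forall_mem_Icc_hasDerivWithinAt₀
  have hx0' : x 0 = x₀ := hx0
  have hbound := norm_le_exp_of_hasDerivWithinAt hT hx (fun t _ =>
    (hbd t _).trans (norm_radialRetraction_le_norm hR _))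
  refine ⟨x, hx0', fun t ht => ?_⟩
  have ht' : t ∈ Icc (-T) T := ⟨ht.1.le, ht.2.le⟩
  have hle : ‖x t‖ ≤ R := by
    have := hbound t ht'
    rw [hx0'] at this
    linarith
  have h1 := (hx t ht').hasDerivAt (Icc_mem_nhds ht.1 ht.2)
  rw [radialRetraction_of_norm_le hR hle] at h1
  exact ⟨h1, by simpa using hle⟩

/-- Global solvability for a vector field that is Lipschitz on balls and of linear growth. -/
theorem exists_global_solution {V : ℝ → F → F}
    (hlip : ∀ T R : ℝ, ∃ K : ℝ≥0, ∀ t ∈ Icc (-T) T, LipschitzOnWith K (V t) (closedBall 0 R))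
    (hcont : ∀ x, Continuous fun t => V t x) (hbd : ∀ t x, ‖V t x‖ ≤ ‖x‖) (x₀ : F) :
    ∃ x : ℝ → F, x 0 = x₀ ∧ ∀ t, HasDerivAt x (V t (x t)) t := by
  choose x hx0 hx using fun n : ℕ => exists_solution_Ioo hlip hcont hbd x₀
    (T := (n : ℝ) + 1) (by positivity)
  -- Uniqueness makes the solutions on growing intervals compatible. The global solution uses at
  -- time `t` the one with index `⌈|t|⌉₊`, whose interval contains `t` because it extends to `⌈|t|⌉₊
  -- + 1`.
  have agree : ∀ m n : ℕ, m ≤ n → EqOn (x m) (x n) (Ioo (-((m : ℝ) + 1)) ((m : ℝ) + 1)) := by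
    intro m n hmn
    have hmn' : (m : ℝ) ≤ n := by exact_mod_cast hmn
    set R : ℝ := ‖x₀‖ * Real.exp ((n : ℝ) + 1) + 1
    obtain ⟨K, hK⟩ := hlip ((m : ℝ) + 1) R
    refine ODE_solution_unique_of_mem_Ioo (v := V) (s := fun _ => closedBall 0 R) (K := K)
      (t₀ := 0) (fun t ht => hK t ⟨ht.1.le, ht.2.le⟩)
      ⟨by have : (0 : ℝ) ≤ m := by positivity
          linarith, by positivity⟩ (fun t ht => ?_) (fun t ht => ?_) ?_
    · refine ⟨(hx m t ht).1, closedBall_subset_closedBall ?_ (hx m t ht).2⟩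
      simp only [R]
      gcongr
    · exact hx n t ⟨by linarith [ht.1], by linarith [ht.2]⟩
    · rw [hx0, hx0]
  refine ⟨fun t => x ⌈|t|⌉₊ t, by simp [hx0], fun t => ?_⟩
  set N := ⌈|t|⌉₊ with hN
  have hNt : |t| ≤ N := Nat.le_ceil _
  have hev : (fun s => x ⌈|s|⌉₊ s) =ᶠ[𝓝 t] x (N + 1) := by
    have hopen : {s : ℝ | |s| < N + 1} ∈ 𝓝 t :=
      (isOpen_lt continuous_abs continuous_const).mem_nhds (by
        change |t| < N + 1
        linarith)
    filter_upwards [hopen] with s hs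
    have hs' : |s| < (N : ℝ) + 1 := hs
    have hle : ⌈|s|⌉₊ ≤ N + 1 := Nat.ceil_le.2 (by push_cast; exact hs'.le)
    refine agree _ _ hle ?_
    have := Nat.le_ceil |s|
    exact abs_lt.1 (by linarith)
  have hmem : t ∈ Ioo (-(((N + 1 : ℕ) : ℝ) + 1)) (((N + 1 : ℕ) : ℝ) + 1) :=
    abs_lt.1 (by push_cast; linarith)
  have h1 := (hx (N + 1) t hmem).1
  have h2 : x ⌈|t|⌉₊ t = x (N + 1) t := hev.self_of_nhds
  change HasDerivAt _ (V t (x ⌈|t|⌉₊ t)) t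
  rw [h2]
  exact h1.congr_of_eventuallyEq hev

end GlobalODE

/-! ### Families of boosts of Minkowski space over the circle -/

section Boost

/-- Minkowski space `ℝ × ℝ²`. -/
abbrev Mink : Type := ℝ × Plane

/-- Continuous families of endomorphisms of Minkowski space over the circle. -/
def Fam : Type := BoundedContinuousFunction UnitAddCircle (Mink →L[ℝ] Mink)

instance : NormedRing Fam :=
  inferInstanceAs (NormedRing (BoundedContinuousFunction UnitAddCircle (Mink →L[ℝ] Mink)))

instance : NormedAlgebra ℝ Fam :=
  inferInstanceAs (NormedAlgebra ℝ (BoundedContinuousFunction UnitAddCircle (Mink →L[ℝ] Mink)))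

instance : CompleteSpace Fam :=
  inferInstanceAs (CompleteSpace (BoundedContinuousFunction UnitAddCircle (Mink →L[ℝ] Mink)))

/-- The value of a family at a parameter. -/
def Fam.at (x : Fam) (u : ℝ) : Mink →L[ℝ] Mink :=
  (show BoundedContinuousFunction UnitAddCircle (Mink →L[ℝ] Mink) from x) (u : UnitAddCircle)

/-- The infinitesimal boost `(e, z) ↦ (⟨q, z⟩, e q)`. -/
def boost (q : Plane) : Mink →L[ℝ] Mink :=
  ((innerSL ℝ q).comp (ContinuousLinearMap.snd ℝ ℝ Plane)).prod
    ((ContinuousLinearMap.fst ℝ ℝ Plane).smulRight q)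

theorem boost_apply (q : Plane) (y : Mink) : boost q y = (inner ℝ q y.2, y.1 • q) := rfl

theorem boost_sub (q q' : Plane) : boost (q - q') = boost q - boost q' := by
  ext y <;> simp [boost_apply, inner_sub_left, smul_sub]

theorem boost_smul (c : ℝ) (q : Plane) : boost (c • q) = c • boost q := by
  refine ContinuousLinearMap.ext fun y => ?_
  simp only [boost_apply, _root_.smul_apply, Prod.smul_mk, inner_smul_left,
    smul_eq_mul, smul_comm y.1 c q]
  rfl

/-- The product carries the maximum norm, so the two components are estimated separately and no
constant is lost. -/
theorem norm_boost_le (q : Plane) : ‖boost q‖ ≤ ‖q‖ := by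
  refine ContinuousLinearMap.opNorm_le_bound _ (norm_nonneg q) fun y => ?_
  rw [boost_apply, Prod.norm_mk]
  refine max_le ?_ ?_
  · exact (norm_inner_le_norm q y.2).trans
      (mul_le_mul_of_nonneg_left (norm_snd_le y) (norm_nonneg q))
  · rw [norm_smul, mul_comm]
    exact mul_le_mul_of_nonneg_left (norm_fst_le y) (norm_nonneg q)

theorem norm_boost_sub_le (q q' : Plane) : ‖boost q - boost q'‖ ≤ ‖q - q'‖ := by
  rw [← boost_sub]; exact norm_boost_le _

theorem continuous_boost : Continuous boost :=
  (LipschitzWith.of_dist_le_mul (K := 1) fun q q' => by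
    simpa [dist_eq_norm] using norm_boost_sub_le q q').continuous

/-- The continuous function on the circle given by a periodic function. -/
def circleMap {E : Type*} [PseudoMetricSpace E] (h : ℝ → E) (hp : Function.Periodic h 1)
    (hc : Continuous h) : BoundedContinuousFunction UnitAddCircle E :=
  BoundedContinuousFunction.mkOfCompact ⟨hp.lift, continuous_coinduced_dom.2 hc⟩

/-- The family given by a periodic continuous function. -/
def famOf (h : ℝ → Mink →L[ℝ] Mink) (hp : Function.Periodic h 1) (hc : Continuous h) : Fam :=
  circleMap h hp hc

namespace Fam

theorem mul_at (x y : Fam) (u : ℝ) : (x * y).at u = (x.at u).comp (y.at u) := rfl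

theorem norm_le {x : Fam} {r : ℝ} (hr : 0 ≤ r) (h : ∀ u : ℝ, ‖x.at u‖ ≤ r) : ‖x‖ ≤ r :=
  (BoundedContinuousFunction.norm_le
    (f := (show BoundedContinuousFunction UnitAddCircle (Mink →L[ℝ] Mink) from x)) hr).2 fun θ => by
    obtain ⟨u, rfl⟩ := QuotientAddGroup.mk_surjective θ
    exact h u

theorem norm_at_le (x : Fam) (u : ℝ) : ‖x.at u‖ ≤ ‖x‖ :=
  BoundedContinuousFunction.norm_coe_le_norm
    (show BoundedContinuousFunction UnitAddCircle (Mink →L[ℝ] Mink) from x) _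

theorem norm_apply_le (x : Fam) (u : ℝ) (y : Mink) : ‖x.at u y‖ ≤ ‖x‖ * ‖y‖ :=
  (x.at u).le_of_opNorm_le (x.norm_at_le u) y

theorem continuous_at (x : Fam) : Continuous x.at :=
  (show BoundedContinuousFunction UnitAddCircle (Mink →L[ℝ] Mink) from x).continuous.comp
    (AddCircle.continuous_mk' 1)

theorem periodic_at (x : Fam) : Function.Periodic x.at 1 := fun u => by
  have h1 : ((u + 1 : ℝ) : UnitAddCircle) = (u : UnitAddCircle) := AddCircle.coe_add_period 1 u
  simp only [Fam.at, h1]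

/-- Evaluation at a parameter. -/
def evalCLM (u : ℝ) : Fam →L[ℝ] Mink →L[ℝ] Mink :=
  LinearMap.mkContinuous ⟨⟨fun x => x.at u, fun _ _ => rfl⟩, fun _ _ => rfl⟩ 1 fun x => by
    rw [one_mul]; exact x.norm_at_le u

end Fam

end Boost

/-! ### The truncated generator and its Lipschitz estimate -/

section Evolution

variable (z₀ : ℝ → Plane)

/-- The lightlike lift of a velocity vector. -/
def light (u : ℝ) : Mink := (‖z₀ u‖, z₀ u)

theorem norm_light (u : ℝ) : ‖light z₀ u‖ = ‖z₀ u‖ := by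
  rw [light, Prod.norm_mk, norm_norm, max_self]

/-- The vector part of the family `x` applied to the lightlike lift of `z₀`. -/
def vec (x : Fam) (u : ℝ) : Plane := (x.at u (light z₀ u)).2

/-- The time part of the family `x` applied to the lightlike lift of `z₀`. -/
def tim (x : Fam) (u : ℝ) : ℝ := (x.at u (light z₀ u)).1

variable {z₀}

theorem vec_sub (x y : Fam) (u : ℝ) : vec z₀ (x - y) u = vec z₀ x u - vec z₀ y u := rfl

theorem norm_vec_le (x : Fam) (u : ℝ) : ‖vec z₀ x u‖ ≤ ‖x‖ * ‖z₀ u‖ :=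
  (norm_snd_le _).trans ((x.norm_apply_le u _).trans_eq (by rw [norm_light]))

theorem abs_tim_le (x : Fam) (u : ℝ) : |tim z₀ x u| ≤ ‖x‖ * ‖z₀ u‖ :=
  (norm_fst_le (x.at u (light z₀ u))).trans
    ((x.norm_apply_le u _).trans_eq (by rw [norm_light]))

theorem intervalIntegrable_apply_light (hz : PerInt z₀) (x : Fam) (a b : ℝ) :
    IntervalIntegrable (fun u : ℝ => x.at u (light z₀ u)) volume a b := by
  refine intervalIntegrable_clm_apply x.continuous_at ?_
  have h := hz.intervalIntegrable a b
  have h' := h.norm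
  rw [intervalIntegrable_iff] at h h' ⊢
  exact h'.prodMk h

theorem intervalIntegrable_tim (hz : PerInt z₀) (x : Fam) (a b : ℝ) :
    IntervalIntegrable (tim z₀ x) volume a b := by
  have h := intervalIntegrable_apply_light hz x a b
  rw [intervalIntegrable_iff] at h ⊢
  exact h.fst

theorem perInt_vec (hz : PerInt z₀) (x : Fam) : PerInt (vec z₀ x) := by
  refine ⟨fun u => ?_, ?_⟩
  · simp only [vec, light, hz.periodic u, x.periodic_at u]
  · have h := intervalIntegrable_apply_light hz x 0 1
    rw [intervalIntegrable_iff] at h ⊢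
    exact h.snd

theorem PerInt.smul {f : ℝ → Plane} (hf : PerInt f) (c : ℝ) : PerInt (fun u => c • f u) :=
  ⟨fun u => by simp only [hf.periodic u], hf.integrable.smul c⟩

theorem len_le_of_norm_le {f g : ℝ → Plane} (hf : PerInt f) (hg : PerInt g) {c : ℝ}
    (h : ∀ u, ‖f u‖ ≤ c * ‖g u‖) : len f ≤ c * len g := by
  rw [len, len, ← intervalIntegral.integral_const_mul]
  exact intervalIntegral.integral_mono zero_le_one hf.integrable.norm
    (hg.integrable.norm.const_mul c) h

variable (z₀) in
/-- The derivative of the curve at time `t`. -/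
def fld (t : ℝ) (x : Fam) (u : ℝ) : Plane := Real.exp (-t) • vec z₀ x u

variable (z₀) in
/-- The length at time `t`, truncated from below. -/
def lenTrunc (t : ℝ) (x : Fam) : ℝ := max (len (fld z₀ t x)) (Real.exp (-2 * |t|) * len z₀)

theorem perInt_fld (hz : PerInt z₀) (t : ℝ) (x : Fam) : PerInt (fld z₀ t x) :=
  (perInt_vec hz x).smul _

theorem len_fld_sub_le (hz : PerInt z₀) (t t' : ℝ) (x x' : Fam) :
    len (fun u => fld z₀ t x u - fld z₀ t' x' u) ≤
      (Real.exp (-t) * ‖x - x'‖ + |Real.exp (-t) - Real.exp (-t')| * ‖x'‖) * len z₀ := by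
  refine len_le_of_norm_le ((perInt_fld hz t x).sub (perInt_fld hz t' x')) hz fun u => ?_
  have e : fld z₀ t x u - fld z₀ t' x' u = Real.exp (-t) • vec z₀ (x - x') u +
      (Real.exp (-t) - Real.exp (-t')) • vec z₀ x' u := by
    simp only [fld, vec_sub, smul_sub, sub_smul]; abel
  rw [e, add_mul, mul_assoc, mul_assoc]
  refine (norm_add_le _ _).trans ?_
  rw [norm_smul, norm_smul, Real.norm_of_nonneg (Real.exp_pos _).le, Real.norm_eq_abs]
  gcongr
  · exact norm_vec_le _ _
  · exact norm_vec_le _ _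

theorem len_fld_le (hz : PerInt z₀) (t : ℝ) (x : Fam) :
    len (fld z₀ t x) ≤ Real.exp (-t) * ‖x‖ * len z₀ := by
  refine len_le_of_norm_le (perInt_fld hz t x) hz fun u => ?_
  rw [fld, norm_smul, Real.norm_of_nonneg (Real.exp_pos _).le, mul_assoc]
  gcongr
  exact norm_vec_le _ _

/-- The truncated generator at time `t`. -/
def gen (hz : PerInt z₀) (t : ℝ) (x : Fam) : Fam :=
  famOf (fun u => boost (qf (cothHalf (lenTrunc z₀ t x)) (fld z₀ t x) u))
    (fun u => by simp only [(perInt_fld hz t x).qf_periodic _ u])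
    (continuous_boost.comp ((perInt_fld hz t x).qf_continuous _))

theorem gen_at (hz : PerInt z₀) (t : ℝ) (x : Fam) (u : ℝ) : (gen hz t x).at u =
    boost (qf (cothHalf (lenTrunc z₀ t x)) (fld z₀ t x) u) := rfl

theorem lenTrunc_pos (hl : 0 < len z₀) (t : ℝ) (x : Fam) : 0 < lenTrunc z₀ t x :=
  lt_max_of_lt_right (by positivity)

/-- The truncation only enlarges the length in the kernel, so the mass of the kernel along the curve
is still at most one. -/
theorem norm_gen_le (hz : PerInt z₀) (hl : 0 < len z₀) (t : ℝ) (x : Fam) : ‖gen hz t x‖ ≤ 1 :=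
  Fam.norm_le zero_le_one fun u => by
    rw [gen_at]
    exact (norm_boost_le _).trans ((perInt_fld hz t x).norm_qf_le_one (lenTrunc_pos hl t x)
      (le_max_left _ _) u)

/-- A single estimate gives both the local Lipschitz property in `x` and continuity in time. The two
exponential differences come from the factor `e^{-t}` of the derivative and from the truncation
level of the length; that level bounds the length below by `a`, which controls the hyperbolic
cotangent. -/
theorem exists_norm_gen_sub_le (hz : PerInt z₀) (hl : 0 < len z₀) (T R : ℝ) (hR : 0 ≤ R) :
    ∃ K : ℝ, 0 ≤ K ∧ ∀ t t' x x', |t| ≤ T → |t'| ≤ T → ‖x‖ ≤ R → ‖x'‖ ≤ R →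
      ‖gen hz t x - gen hz t' x'‖ ≤ K * (‖x - x'‖ + |Real.exp (-t) - Real.exp (-t')| +
        |Real.exp (-2 * |t|) - Real.exp (-2 * |t'|)|) := by
  set a := Real.exp (-2 * T) * len z₀
  set b := Real.exp T * R * len z₀
  have ha : 0 < a := by positivity
  set c := 1 + 1 / Real.sinh (a / 2)
  have hs := sinh_half_pos ha
  have hc : 0 < c := by positivity
  set k := 1 / Real.sinh (a / 2) ^ 2
  have hk : 0 < k := by positivity
  have hb : 0 ≤ b := by positivity
  set N := (1 + b) * ((c + 1) * Real.cosh b)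
  have hN : 0 ≤ N := by have := Real.cosh_pos b; positivity
  set P := (Real.exp T + R + 1) * len z₀
  have hP : 0 ≤ P := by positivity
  refine ⟨N * ((1 + k) * P), by positivity, fun t t' x x' ht ht' hx hx' => ?_⟩
  set D := ‖x - x'‖ + |Real.exp (-t) - Real.exp (-t')| +
        |Real.exp (-2 * |t|) - Real.exp (-2 * |t'|)| with hD
  have hexp : ∀ {s : ℝ}, |s| ≤ T → Real.exp (-s) ≤ Real.exp T := fun {s} hs =>
    Real.exp_le_exp.2 (by linarith [neg_abs_le s])
  have hlen : ∀ {s : ℝ} {y : Fam}, |s| ≤ T → ‖y‖ ≤ R → len (fld z₀ s y) ≤ b := fun {s y} hs hy =>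
    (len_fld_le hz s y).trans (by
      have := hexp hs
      simp only [b]
      gcongr)
  have hla : ∀ {s : ℝ} {y : Fam}, |s| ≤ T → a ≤ lenTrunc z₀ s y := fun {s y} hs =>
    le_max_of_le_right (by simp only [a]; gcongr ?_ * _; exact Real.exp_le_exp.2 (by linarith))
  have hd : len (fun u => fld z₀ t x u - fld z₀ t' x' u) +
      |Real.exp (-2 * |t|) - Real.exp (-2 * |t'|)| * len z₀ ≤ P * D := by
    have h1 := len_fld_sub_le hz t t' x x'
    have h2 : Real.exp (-t) * ‖x - x'‖ ≤ Real.exp T * ‖x - x'‖ := by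
      have := hexp ht; gcongr
    have h3 : |Real.exp (-t) - Real.exp (-t')| * ‖x'‖ ≤ |Real.exp (-t) - Real.exp (-t')| * R := by
      gcongr
    have h4 : Real.exp (-t) * ‖x - x'‖ + |Real.exp (-t) - Real.exp (-t')| * ‖x'‖ +
        |Real.exp (-2 * |t|) - Real.exp (-2 * |t'|)| ≤ (Real.exp T + R + 1) * D := by
      have e1 := norm_nonneg (x - x')
      have e2 := abs_nonneg (Real.exp (-t) - Real.exp (-t'))
      have e3 := abs_nonneg (Real.exp (-2 * |t|) - Real.exp (-2 * |t'|))
      have e4 := Real.exp_pos T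
      rw [hD]
      nlinarith [mul_nonneg hR e1, mul_nonneg hR e3, mul_nonneg e4.le e2, mul_nonneg e4.le e3]
    calc _ ≤ (Real.exp (-t) * ‖x - x'‖ + |Real.exp (-t) - Real.exp (-t')| * ‖x'‖ +
        |Real.exp (-2 * |t|) - Real.exp (-2 * |t'|)|) * len z₀ := by rw [add_mul]; linarith
      _ ≤ ((Real.exp T + R + 1) * D) * len z₀ := by gcongr
      _ = P * D := by simp only [P]; ring
  have hl1 : |lenTrunc z₀ t x - lenTrunc z₀ t' x'| ≤ P * D := by
    refine (abs_max_sub_max_le_max _ _ _ _).trans (max_le ?_ ?_)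
    · refine ((perInt_fld hz t x).abs_len_sub_le (perInt_fld hz t' x')).trans (le_trans ?_ hd)
      have : 0 ≤ |Real.exp (-2 * |t|) - Real.exp (-2 * |t'|)| * len z₀ := by positivity
      linarith
    · rw [← sub_mul, abs_mul, abs_of_pos hl]
      have := len_nonneg (fun u => fld z₀ t x u - fld z₀ t' x' u)
      linarith
  have hC : |cothHalf (lenTrunc z₀ t x) - cothHalf (lenTrunc z₀ t' x')| ≤ k * (P * D) :=
    (abs_cothHalf_sub_le ha (hla ht) (hla ht')).trans (by gcongr)
  have hCc : |cothHalf (lenTrunc z₀ t x)| ≤ c := by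
    rw [abs_of_nonneg (cothHalf_nonneg (lenTrunc_pos hl t x))]
    exact cothHalf_le ha (hla ht)
  have hD0 : 0 ≤ D := by positivity
  refine Fam.norm_le (by positivity) fun u => ?_
  change ‖boost _ - boost _‖ ≤ _
  refine (norm_boost_sub_le _ _).trans (((perInt_fld hz t x).norm_qf_sub_le (perInt_fld hz t' x')
    hCc (hlen ht hx) (hlen ht' hx') u).trans ?_)
  have h5 : len (fun u => fld z₀ t x u - fld z₀ t' x' u) ≤ P * D := by
    have : 0 ≤ |Real.exp (-2 * |t|) - Real.exp (-2 * |t'|)| * len z₀ := by positivity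
    linarith
  calc _ ≤ N * (P * D + k * (P * D)) := by
        change N * _ ≤ _
        gcongr
    _ = _ := by ring

end Evolution

/-! ### Joint evolution of a family and its inverse -/

section Pair

open Set Metric
open scoped NNReal

variable {𝒜 : Type*} [NormedRing 𝒜]

/-- The vector field of a linear evolution and of its inverse. -/
def pairField (G : ℝ → 𝒜 → 𝒜) (t : ℝ) (p : 𝒜 × 𝒜) : 𝒜 × 𝒜 :=
  (G t p.1 * p.1, -(p.2 * G t p.1))

theorem lipschitzOnWith_pairField {G : ℝ → 𝒜 → 𝒜} (hG : ∀ t x, ‖G t x‖ ≤ 1) {t R K : ℝ}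
    (hR : 0 ≤ R) (hK0 : 0 ≤ K)
    (hK : ∀ x x', ‖x‖ ≤ R → ‖x'‖ ≤ R → ‖G t x - G t x'‖ ≤ K * ‖x - x'‖) :
    LipschitzOnWith ⟨K * R + 1, by positivity⟩ (pairField G t) (closedBall 0 R) := by
  refine LipschitzOnWith.of_dist_le_mul fun p hp p' hp' => ?_
  have hp1 : ‖p‖ ≤ R := by simpa using hp
  have hp1' : ‖p'‖ ≤ R := by simpa using hp'
  have hg := hK p.1 p'.1 ((norm_fst_le p).trans hp1) ((norm_fst_le p').trans hp1')
  rw [dist_eq_norm, dist_eq_norm]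
  have h1 : ‖p.1 - p'.1‖ ≤ ‖p - p'‖ := norm_fst_le (p - p')
  have h2 : ‖p.2 - p'.2‖ ≤ ‖p - p'‖ := norm_snd_le (p - p')
  have hg' : ‖G t p.1 - G t p'.1‖ ≤ K * ‖p - p'‖ := hg.trans (by gcongr)
  change max ‖G t p.1 * p.1 - G t p'.1 * p'.1‖
    ‖-(p.2 * G t p.1) - -(p'.2 * G t p'.1)‖ ≤ (K * R + 1) * ‖p - p'‖
  refine max_le ?_ ?_
  · have e : G t p.1 * p.1 - G t p'.1 * p'.1 =
        (G t p.1 - G t p'.1) * p.1 + G t p'.1 * (p.1 - p'.1) := by noncomm_ring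
    rw [e]
    calc _ ≤ ‖G t p.1 - G t p'.1‖ * ‖p.1‖ + ‖G t p'.1‖ * ‖p.1 - p'.1‖ :=
          (norm_add_le _ _).trans (add_le_add (norm_mul_le _ _) (norm_mul_le _ _))
      _ ≤ (K * ‖p - p'‖) * R + 1 * ‖p - p'‖ := by
          gcongr
          · exact (norm_fst_le p).trans hp1
          · exact hG _ _
      _ = _ := by ring
  · have e : -(p.2 * G t p.1) - -(p'.2 * G t p'.1) =
        -(p.2 * (G t p.1 - G t p'.1) + (p.2 - p'.2) * G t p'.1) := by noncomm_ring
    rw [e, norm_neg]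
    calc _ ≤ ‖p.2‖ * ‖G t p.1 - G t p'.1‖ + ‖p.2 - p'.2‖ * ‖G t p'.1‖ :=
          (norm_add_le _ _).trans (add_le_add (norm_mul_le _ _) (norm_mul_le _ _))
      _ ≤ R * (K * ‖p - p'‖) + ‖p - p'‖ * 1 := by
          gcongr
          · exact (norm_snd_le p).trans hp1
          · exact hG _ _
      _ = _ := by ring

/-- Solving for `Λ` and the prospective inverse `M` as one system provides `M` for all time, with
the same estimates as `Λ`. The bound `‖G‖ ≤ 1` makes the growth linear although `G` depends on `Λ`
nonlinearly. -/
theorem exists_pair_solution [NormedAlgebra ℝ 𝒜] [CompleteSpace 𝒜] {G : ℝ → 𝒜 → 𝒜} (hG : ∀ t x, ‖G t x‖ ≤ 1)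
    (hcont : ∀ x, Continuous fun t => G t x)
    (hlip : ∀ T R : ℝ, 0 ≤ R → ∃ K, 0 ≤ K ∧ ∀ t x x', |t| ≤ T → ‖x‖ ≤ R → ‖x'‖ ≤ R →
      ‖G t x - G t x'‖ ≤ K * ‖x - x'‖) :
    ∃ Λ M : ℝ → 𝒜, Λ 0 = 1 ∧ M 0 = 1 ∧ (∀ t, HasDerivAt Λ (G t (Λ t) * Λ t) t) ∧
      ∀ t, HasDerivAt M (-(M t * G t (Λ t))) t := by
  obtain ⟨x, hx0, hx⟩ := exists_global_solution (V := pairField G) (fun T R => by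
      rcases lt_or_ge R 0 with hR | hR
      · refine ⟨0, fun t _ => ?_⟩
        rw [closedBall_eq_empty.2 hR]
        exact lipschitzOnWith_empty _ _
      obtain ⟨K, hK0, hK⟩ := hlip T R hR
      exact ⟨_, fun t ht => lipschitzOnWith_pairField hG hR hK0
        fun x x' => hK t x x' (abs_le.2 ht)⟩)
    (fun p => ((hcont p.1).mul continuous_const).prodMk (continuous_const.mul (hcont p.1)).neg)
    (fun t p => by
      change max ‖G t p.1 * p.1‖ ‖-(p.2 * G t p.1)‖ ≤ ‖p‖
      rw [norm_neg]
      refine max_le ((norm_mul_le _ _).trans ?_) ((norm_mul_le _ _).trans ?_)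
      · exact (mul_le_of_le_one_left (norm_nonneg _) (hG _ _)).trans (norm_fst_le p)
      · exact (mul_le_of_le_one_right (norm_nonneg _) (hG _ _)).trans (norm_snd_le p))
    ((1 : 𝒜), (1 : 𝒜))
  refine ⟨fun t => (x t).1, fun t => (x t).2, by simp [hx0], by simp [hx0], fun t => ?_,
    fun t => ?_⟩
  · exact (hasFDerivAt_fst (𝕜 := ℝ) (p := x t)).comp_hasDerivAt t (hx t)
  · exact (hasFDerivAt_snd (𝕜 := ℝ) (p := x t)).comp_hasDerivAt t (hx t)

end Pair

/-! ### Existence of the evolution -/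

section Existence

variable {z₀ : ℝ → Plane}

theorem continuous_gen (hz : PerInt z₀) (hl : 0 < len z₀) (x : Fam) :
    Continuous fun t => gen hz t x := by
  rw [continuous_iff_continuousAt]
  intro t
  obtain ⟨K, hK0, hK⟩ := exists_norm_gen_sub_le hz hl (|t| + 1) ‖x‖ (norm_nonneg x)
  rw [ContinuousAt, tendsto_iff_norm_sub_tendsto_zero]
  have hlim : Tendsto (fun s : ℝ => K * (‖x - x‖ + |Real.exp (-s) - Real.exp (-t)| +
      |Real.exp (-2 * |s|) - Real.exp (-2 * |t|)|)) (𝓝 t) (𝓝 0) := by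
    have hc : Continuous fun s : ℝ => K * (‖x - x‖ + |Real.exp (-s) - Real.exp (-t)| +
      |Real.exp (-2 * |s|) - Real.exp (-2 * |t|)|) := by fun_prop
    have := hc.tendsto t
    simpa using this
  refine squeeze_zero' (Eventually.of_forall fun _ => norm_nonneg _) ?_ hlim
  filter_upwards [Metric.ball_mem_nhds t one_pos] with s hs
  refine hK s t x x ?_ (by linarith) le_rfl le_rfl
  rw [Metric.mem_ball, Real.dist_eq] at hs
  have := abs_sub_abs_le_abs_sub s t
  linarith

theorem exists_evolution (hz : PerInt z₀) (hl : 0 < len z₀) :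
    ∃ Λ M : ℝ → Fam, Λ 0 = 1 ∧ M 0 = 1 ∧ (∀ t, HasDerivAt Λ (gen hz t (Λ t) * Λ t) t) ∧
      ∀ t, HasDerivAt M (-(M t * gen hz t (Λ t))) t := by
  refine exists_pair_solution (norm_gen_le hz hl) (continuous_gen hz hl) fun T R hR => ?_
  obtain ⟨K, hK0, hK⟩ := exists_norm_gen_sub_le hz hl T R hR
  refine ⟨K, hK0, fun t x x' ht hx hx' => ?_⟩
  simpa using hK t t x x' ht ht hx hx'

end Existence

/-! ### Derivatives of the convolutions and integration by parts -/

section Convolution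

variable {f : ℝ → Plane}

theorem IsPrim.smul {E : Type*} [NormedAddCommGroup E] [NormedSpace ℝ E] [FiniteDimensional ℝ E]
    {φ φ' : ℝ → ℝ} {F f : ℝ → E} (hφ : IsPrim φ φ') (h : IsPrim F f) :
    IsPrim (fun u => φ u • F u) (fun u => φ' u • F u + φ u • f u) := by
  have : CompleteSpace E := FiniteDimensional.complete ℝ E
  exact IsPrim.bilin (ContinuousLinearMap.lsmul ℝ ℝ) hφ h

theorem isPrim_integral_period {h : ℝ → Plane} (hh : ∀ a b, IntervalIntegrable h volume a b) :
    IsPrim (fun u => ∫ v in u..(u + 1), h v) (fun u => h (u + 1) - h u) := by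
  have h1 := isPrim_integral hh 0
  have h2 := (h1.shift 1).sub h1
  have : (fun u => ∫ v in u..(u + 1), h v) =
      fun u => (∫ v in (0 : ℝ)..(u + 1), h v) - ∫ v in (0 : ℝ)..u, h v := funext fun u =>
    (intervalIntegral.integral_interval_sub_left (hh _ _) (hh _ _)).symm
  rw [this]
  exact h2

/-- Convolution of `f` with `α cosh + β sinh` in the arclength variable of `f`. -/
def conv (α β : ℝ) (f : ℝ → Plane) (u : ℝ) : Plane :=
  ∫ v in u..(u + 1),
    (α * Real.cosh (arc f v - arc f u) + β * Real.sinh (arc f v - arc f u)) • f v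

/-- Differentiating the kernel in `u` exchanges `α` and `β` and produces `-‖f u‖`. Moving the window
`[u, u + 1]` contributes the kernel at `len f` minus the kernel at `0`, times `f u`. -/
theorem PerInt.isPrim_conv (hf : PerInt f) (α β : ℝ) :
    IsPrim (conv α β f) (fun u => ‖f u‖ • -conv β α f u +
      (α * (Real.cosh (len f) - 1) + β * Real.sinh (len f)) • f u) := by
  have hc : ∀ a b, IntervalIntegrable (fun v => Real.cosh (arc f v) • f v) volume a b :=
    fun a b => (hf.intervalIntegrable _ _).continuousOn_smul
      (Real.continuous_cosh.comp hf.continuous_arc).continuousOn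
  have hs : ∀ a b, IntervalIntegrable (fun v => Real.sinh (arc f v) • f v) volume a b :=
    fun a b => (hf.intervalIntegrable _ _).continuousOn_smul
      (Real.continuous_sinh.comp hf.continuous_arc).continuousOn
  have key : ∀ α β u, conv α β f u =
      Real.cosh (arc f u) • (α • (∫ v in u..(u + 1), Real.cosh (arc f v) • f v) +
        β • ∫ v in u..(u + 1), Real.sinh (arc f v) • f v) -
      Real.sinh (arc f u) • (β • (∫ v in u..(u + 1), Real.cosh (arc f v) • f v) +
        α • ∫ v in u..(u + 1), Real.sinh (arc f v) • f v) := fun α β u => by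
    have e : ∀ v, (α * Real.cosh (arc f v - arc f u) + β * Real.sinh (arc f v - arc f u)) • f v =
        (α * Real.cosh (arc f u) - β * Real.sinh (arc f u)) • (Real.cosh (arc f v) • f v) +
        (β * Real.cosh (arc f u) - α * Real.sinh (arc f u)) • (Real.sinh (arc f v) • f v) :=
      fun v => by
        rw [smul_smul, smul_smul, ← add_smul, Real.cosh_sub, Real.sinh_sub]
        congr 1; ring
    simp only [conv, e]
    rw [intervalIntegral.integral_add (intervalIntegrable_const_smul (hc _ _) _)
      (intervalIntegrable_const_smul (hs _ _) _), intervalIntegral.integral_smul,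
      intervalIntegral.integral_smul]
    module
  have hA := isPrim_integral_period hc
  have hB := isPrim_integral_period hs
  have hC := hf.isPrim_arc.scomp (φ := Real.cosh) (φ' := Real.sinh)
    (fun u => Real.hasDerivAt_cosh u) Real.continuous_sinh
  have hS := hf.isPrim_arc.scomp (φ := Real.sinh) (φ' := Real.cosh)
    (fun u => Real.hasDerivAt_sinh u) Real.continuous_cosh
  have h := (hC.smul ((hA.const_smul α).add (hB.const_smul β))).sub
    (hS.smul ((hA.const_smul β).add (hB.const_smul α)))
  rw [funext (key α β)]
  refine h.congr_ae (Eventually.of_forall fun u => ?_)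
  rw [key β α, hf.arc_add_one, hf.periodic, Real.cosh_add, Real.sinh_add]
  have e := Real.cosh_sq (arc f u)
  simp only [smul_eq_mul]
  -- The coefficient of `f u` reduces by `cosh² - sinh² = 1`.
  match_scalars
  · ring
  · ring
  · linear_combination (α * (Real.cosh (len f) - 1) + β * Real.sinh (len f)) * e

theorem qf_eq_conv (C : ℝ) (f : ℝ → Plane) : qf C f = conv (C / 2) (-1 / 2) f := by
  funext u
  refine intervalIntegral.integral_congr fun v _ => ?_
  simp only [ker]
  congr 1; ring

/-- The negative of the velocity of a curve with derivative `f`. -/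
def nf (f : ℝ → Plane) : ℝ → Plane := conv (-1 / 2) (cothHalf (len f) / 2) f

theorem nf_eq (f : ℝ → Plane) (u : ℝ) :
    nf f u = ∫ v in u..(u + 1), kerD (cothHalf (len f)) (arc f v - arc f u) • f v := by
  refine intervalIntegral.integral_congr fun v _ => ?_
  simp only [kerD]
  congr 1; ring

/-- The derivative of the velocity of a curve with derivative `f` is
`-f u + ‖f u‖ • qn f u`. -/
def qn (f : ℝ → Plane) : ℝ → Plane := qf (cothHalf (len f)) f

/-- The kernel takes the same value at `0` and at `len f`, so the boundary term vanishes. -/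
theorem PerInt.isPrim_qn (hf : PerInt f) (hl : 0 < len f) :
    IsPrim (qn f) (fun u => ‖f u‖ • -nf f u) := by
  have h := hf.isPrim_conv (cothHalf (len f) / 2) (-1 / 2)
  rw [← qf_eq_conv] at h
  refine h.congr_ae (Eventually.of_forall fun u => ?_)
  have e : cothHalf (len f) / 2 * (Real.cosh (len f) - 1) + -1 / 2 * Real.sinh (len f) = 0 := by
    have := ker_self hl
    simp only [ker, Real.cosh_zero, Real.sinh_zero] at this
    linarith
  simp only [e, zero_smul, add_zero]
  rfl

/-- The derivative of the kernel jumps from `-1/2` to `1/2` across the period, so the boundary term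
is exactly `f u`. -/
theorem PerInt.isPrim_nf (hf : PerInt f) (hl : 0 < len f) :
    IsPrim (nf f) (fun u => f u - ‖f u‖ • qn f u) := by
  have h := hf.isPrim_conv (-1 / 2) (cothHalf (len f) / 2)
  refine h.congr_ae (Eventually.of_forall fun u => ?_)
  have e : -1 / 2 * (Real.cosh (len f) - 1) + cothHalf (len f) / 2 * Real.sinh (len f) = 1 := by
    have := kerD_self hl
    simp only [kerD] at this
    linarith
  simp only [e, one_smul, qn, qf_eq_conv]
  rw [smul_neg, sub_eq_neg_add]

theorem PerInt.conv_periodic (hf : PerInt f) (α β : ℝ) : Function.Periodic (conv α β f) 1 :=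
  fun u => by
  rw [conv, conv, ← intervalIntegral.integral_comp_add_right]
  simp only [hf.arc_add_one, hf.periodic _, add_sub_add_right_eq_sub]

theorem PerInt.nf_periodic (hf : PerInt f) : Function.Periodic (nf f) 1 := hf.conv_periodic _ _

theorem PerInt.qn_periodic (hf : PerInt f) : Function.Periodic (qn f) 1 := hf.qf_periodic _

theorem PerInt.qn_continuous (hf : PerInt f) : Continuous (qn f) := hf.qf_continuous _

theorem PerInt.nf_continuous (hf : PerInt f) : Continuous (nf f) :=
  (hf.isPrim_conv _ _).continuous

/-- The difference of the integrands is the derivative of the periodic function `nf f`. This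
identity keeps the evolving curve closed. -/
theorem PerInt.integral_norm_smul_qn (hf : PerInt f) (hl : 0 < len f) :
    ∫ u in (0 : ℝ)..1, ‖f u‖ • qn f u = ∫ u in (0 : ℝ)..1, f u := by
  have h := (hf.isPrim_nf hl).integral_eq_zero (by simpa using hf.nf_periodic 0)
  rw [intervalIntegral.integral_sub (hf.intervalIntegrable _ _)
    ((hf.intervalIntegrable _ _).norm.smul_continuousOn hf.qn_continuous.continuousOn)] at h
  exact (sub_eq_zero.1 h).symm

theorem PerInt.norm_nf_le (hf : PerInt f) (hl : 0 < len f) (u : ℝ) : ‖nf f u‖ ≤ len f / 2 := by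
  rw [nf_eq]
  have h1 : ∀ᵐ v, v ∈ Set.Ioc u (u + 1) →
      ‖kerD (cothHalf (len f)) (arc f v - arc f u) • f v‖ ≤ 1 / 2 * ‖f v‖ :=
    Eventually.of_forall fun v hv => by
      have hm := hf.arc_sub_mem (Set.Ioc_subset_Icc_self hv)
      rw [norm_smul]
      gcongr
      refine abs_le.2 ⟨?_, ?_⟩
      · have := kerD_mono hl hm.1
        rw [kerD_zero] at this
        linarith
      · have := kerD_mono hl hm.2
        rwa [kerD_self hl] at this
  refine (intervalIntegral.norm_integral_le_of_norm_le (by linarith) h1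
    ((hf.intervalIntegrable _ _).norm.const_mul _)).trans_eq ?_
  rw [intervalIntegral.integral_const_mul, ← hf.arc_sub, hf.arc_add_one]
  ring

theorem periodic_fract {E : Type*} {h : ℝ → E} (hp : Function.Periodic h 1) (u : ℝ) :
    h (Int.fract u) = h u := by
  have := hp.sub_int_mul_eq (x := u) ⌊u⌋
  rwa [mul_one] at this

/-- Integration by parts with `kerD` as primitive of the kernel; its end values `±1/2` on the period
produce `γ u`. -/
theorem PerInt.integral_ker_smul (hf : PerInt f) (hl : 0 < len f) {γ : ℝ → Plane}
    (h : IsPrim γ f) (hp : Function.Periodic γ 1) (u : ℝ) :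
    ∫ v in u..(u + 1), (ker (cothHalf (len f)) (arc f v - arc f u) * ‖f v‖) • γ v =
      γ u - nf f u := by
  have hprod := ((hf.isPrim_arc.add_const (-arc f u)).scomp
    (fun d => hasDerivAt_kerD (cothHalf (len f)) d) (continuous_ker (cothHalf (len f)))).smul h
  have hS : ∀ v, ‖f v‖ • ker (cothHalf (len f)) (arc f v - arc f u) =
      ker (cothHalf (len f)) (arc f v - arc f u) * ‖f v‖ :=
    fun v => by rw [smul_eq_mul, mul_comm]
  have h1 := hprod.sub_eq u (u + 1)
  have i1 : IntervalIntegrable (fun v => (ker (cothHalf (len f)) (arc f v - arc f u) * ‖f v‖) • γ v)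
      volume u (u + 1) := by
    have h1 : IntervalIntegrable (fun v => ker (cothHalf (len f)) (arc f v - arc f u) * ‖f v‖)
        volume u (u + 1) :=
      (hf.intervalIntegrable _ _).norm.continuousOn_mul
        ((continuous_ker _).comp (hf.continuous_arc.sub continuous_const)).continuousOn
    exact h1.smul_continuousOn h.continuous.continuousOn
  have i2 : IntervalIntegrable (fun v => kerD (cothHalf (len f)) (arc f v - arc f u) • f v)
      volume u (u + 1) :=
    (hf.intervalIntegrable _ _).continuousOn_smul
      ((continuous_kerD _).comp (hf.continuous_arc.sub continuous_const)).continuousOn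
  simp only [← sub_eq_add_neg, hS] at h1
  rw [intervalIntegral.integral_add i1 i2, hf.arc_add_one, add_sub_cancel_left, sub_self,
    kerD_self hl, kerD_zero, hp, ← nf_eq] at h1
  rw [← sub_eq_iff_eq_add.2 h1]
  module

end Convolution

/-! ### Closed `H¹` curves and their velocity -/

section ClosedCurves

variable {γ : ℝ → Plane}

theorem periodic_deriv (h : Function.Periodic γ 1) : Function.Periodic (deriv γ) 1 := fun u => by
  rw [← deriv_comp_add_const, funext h]

theorem MemH1.perInt (h : MemH1 γ) : PerInt (deriv γ) := by
  refine ⟨periodic_deriv h.1, ?_⟩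
  rw [intervalIntegrable_iff_integrableOn_Ioc_of_le zero_le_one]
  exact h.2.1.integrable one_le_two

theorem MemH1.integral_deriv (h : MemH1 γ) : ∫ x in (0 : ℝ)..1, deriv γ x = 0 := by
  have h1 := h.2.2 1 (by simp)
  have h2 := h.1 0
  rw [zero_add] at h2
  rw [h2] at h1
  simpa using h1

theorem MemH1.isPrim (h : MemH1 γ) : IsPrim γ (deriv γ) := by
  have h1 := (isPrim_integral h.perInt.intervalIntegrable 0).add_const (γ 0)
  have hp := h1.periodic h.perInt.periodic h.integral_deriv
  have h2 : γ = fun u => (∫ x in (0 : ℝ)..u, deriv γ x) + γ 0 := by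
    refine funext fun u => ?_
    have e1 : γ (Int.fract u) = γ u := periodic_fract h.1 u
    have e2 := periodic_fract hp u
    rw [← e1, h.2.2 _ ⟨Int.fract_nonneg u, (Int.fract_lt_one u).le⟩, ← e2, add_comm]
  exact ⟨h1.integrable, fun a b => by rw [← h1.sub_eq a b, ← congrFun h2 a, ← congrFun h2 b]⟩

theorem IsPrim.memH1 {f : ℝ → Plane} (h : IsPrim γ f) (hp : Function.Periodic γ 1)
    (hf : MemLp f 2 (volume.restrict (Set.Ioc (0 : ℝ) 1))) : MemH1 γ := by
  have hd : ∀ᵐ u, deriv γ u = f u := h.ae_deriv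
  refine ⟨hp, hf.ae_eq ?_, fun u _ => ?_⟩
  · exact (ae_restrict_of_ae hd).mono fun x hx => hx.symm
  · exact (h.congr_ae (hd.mono fun x hx => hx.symm)).eq_add 0 u

theorem MemH1.len_pos (h : MemH1 γ) (hn : ¬ IsConstantMap γ) : 0 < len (deriv γ) := by
  refine (len_nonneg _).lt_of_ne fun h0 => hn ⟨γ 0, fun u => ?_⟩
  have h1 : γ (Int.fract u) = γ u := periodic_fract h.1 u
  rw [← h1, ← sub_eq_zero, ← norm_le_zero_iff]
  refine (h.isPrim.norm_sub_le 0 0 _).trans ?_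
  change |arc _ _ - arc _ _| ≤ 0
  have h2 := h.perInt.arc_sub_mem (u := 0) (v := Int.fract u)
    ⟨Int.fract_nonneg u, by simpa using (Int.fract_lt_one u).le⟩
  rw [← h0] at h2
  rw [abs_of_nonneg h2.1]
  exact h2.2

theorem not_isConstantMap_of_len_pos (h : 0 < len (deriv γ)) : ¬ IsConstantMap γ := by
  rintro ⟨p, hp⟩
  have : deriv γ = fun _ => 0 := by rw [funext hp]; simp
  simp [this, len] at h

theorem arcParam_eq (γ : ℝ → Plane) (u : ℝ) : arcParam γ u = arc (deriv γ) (Int.fract u) := rfl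

theorem length_eq (γ : ℝ → Plane) : length γ = len (deriv γ) := rfl

/-- The arclength in the definition of the velocity lives on `[0, 1)` and uses absolute differences.
Shifting the part of `[0, 1]` below the fractional part `u₀` by one period, and using the symmetry
of the kernel under `d ↦ L - d`, gives an integral over `[u₀, u₀ + 1]`, to which integration by
parts applies. -/
theorem MemH1.velocity_eq (h : MemH1 γ) (hl : 0 < len (deriv γ)) (u : ℝ) :
    velocity γ u = -nf (deriv γ) u := by
  set f := deriv γ
  set C := cothHalf (len f)
  have hf : PerInt f := h.perInt
  have hF : IsPrim γ f := h.isPrim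
  set u₀ := Int.fract u
  have hu0 : 0 ≤ u₀ := Int.fract_nonneg u
  have hu1 : u₀ < 1 := Int.fract_lt_one u
  have e1 : γ u₀ = γ u := periodic_fract h.1 u
  have e2 : nf f u₀ = nf f u := periodic_fract hf.nf_periodic u
  set k : ℝ → Plane := fun v => (ker C (arc f v - arc f u₀) * ‖f v‖) • γ v
  have hk : ∀ a b, IntervalIntegrable k volume a b := fun a b => by
    have h1 : IntervalIntegrable (fun v => ker C (arc f v - arc f u₀) * ‖f v‖) volume a b :=
      (hf.intervalIntegrable a b).norm.continuousOn_mul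
        ((continuous_ker C).comp (hf.continuous_arc.sub continuous_const)).continuousOn
    exact h1.smul_continuousOn hF.continuous.continuousOn
  have hG : ∀ v, 0 ≤ v → v < 1 → kernelG γ u v = -ker C |arc f u₀ - arc f v| := fun v h0 h1 => by
    rw [kernelG, arcParam_eq, arcParam_eq, Int.fract_eq_self.2 ⟨h0, h1⟩, ker_eq hl, Real.sinh_neg,
      mul_neg, div_neg]
    rfl
  have i1 : ∫ v in u₀..1, (kernelG γ u v * ‖f v‖) • γ v = -∫ v in u₀..1, k v := by
    rw [← intervalIntegral.integral_neg]
    refine intervalIntegral.integral_congr_ae ?_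
    -- At `v = 1` the fractional part drops to `0`, so the kernel formula must exclude this point.
    have : ∀ᵐ v : ℝ, v ≠ 1 := by simp [ae_iff]
    filter_upwards [this] with v hv1 hv
    rw [Set.uIoc_of_le hu1.le] at hv
    rw [hG v (hu0.trans hv.1.le) (lt_of_le_of_ne hv.2 hv1), abs_sub_comm,
      abs_of_nonneg (sub_nonneg.2 (hf.monotone_arc hv.1.le)), neg_mul, neg_smul]
  have i2 : ∫ v in (0 : ℝ)..u₀, (kernelG γ u v * ‖f v‖) • γ v = -∫ v in (1 : ℝ)..(u₀ + 1), k v := by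
    have e : ∫ v in (1 : ℝ)..(u₀ + 1), k v = ∫ v in (0 : ℝ)..u₀, k (v + 1) := by
      rw [intervalIntegral.integral_comp_add_right, zero_add]
    rw [e, ← intervalIntegral.integral_neg]
    refine intervalIntegral.integral_congr_ae (Eventually.of_forall fun v hv => ?_)
    rw [Set.uIoc_of_le hu0] at hv
    simp only [k]
    rw [hG v hv.1.le (hv.2.trans_lt hu1),
      abs_of_nonneg (sub_nonneg.2 (hf.monotone_arc hv.2)), neg_mul, neg_smul, hf.arc_add_one,
      hf.periodic, h.1, ← ker_symm hl]
    congr 4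
    ring
  have i0 : ∀ a b, 0 ≤ a → b ≤ 1 → a ≤ b →
      IntervalIntegrable (fun v => (kernelG γ u v * ‖f v‖) • γ v) volume a b := fun a b ha hb hab => by
    have h1 : IntervalIntegrable (fun v => (-ker C |arc f u₀ - arc f v| * ‖f v‖) • γ v)
        volume a b := by
      have h2 : IntervalIntegrable (fun v => -ker C |arc f u₀ - arc f v| * ‖f v‖) volume a b :=
        (hf.intervalIntegrable a b).norm.continuousOn_mul
          ((continuous_ker C).comp (continuous_const.sub hf.continuous_arc).abs).neg.continuousOn
      exact h2.smul_continuousOn hF.continuous.continuousOn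
    refine h1.congr_ae ?_
    have : ∀ᵐ v : ℝ, v ≠ 1 := by simp [ae_iff]
    refine (ae_restrict_iff' measurableSet_uIoc).2 ?_
    filter_upwards [this] with v hv1 hv
    rw [Set.uIoc_of_le hab] at hv
    rw [hG v (ha.trans hv.1.le) (lt_of_le_of_ne (hv.2.trans hb) hv1)]
  have hparts : (∫ v in u₀..(u₀ + 1), k v) = γ u₀ - nf f u₀ := hf.integral_ker_smul hl hF h.1 u₀
  rw [velocity, ← intervalIntegral.integral_add_adjacent_intervals (i0 0 u₀ le_rfl hu1.le hu0)
    (i0 u₀ 1 hu0 le_rfl hu1.le), i1, i2, ← neg_add, add_comm,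
    intervalIntegral.integral_add_adjacent_intervals (hk _ _) (hk _ _), hparts, e1, e2]
  abel

theorem MemLp.qn_smul {f : ℝ → Plane} (hf : PerInt f)
    (h2 : MemLp f 2 (volume.restrict (Set.Ioc (0 : ℝ) 1))) :
    MemLp (fun u => ‖f u‖ • qn f u) 2 (volume.restrict (Set.Ioc (0 : ℝ) 1)) := by
  obtain ⟨K, hK⟩ := (isCompact_Icc (a := (0 : ℝ)) (b := 1)).exists_bound_of_continuousOn
    hf.qn_continuous.continuousOn
  refine MemLp.of_le_mul (c := K) h2
    (h2.aestronglyMeasurable.norm.smul hf.qn_continuous.aestronglyMeasurable) ?_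
  refine (ae_restrict_iff' measurableSet_Ioc).2 (Eventually.of_forall fun x hx => ?_)
  rw [norm_smul, norm_norm, mul_comm]
  gcongr
  exact hK x (Set.Ioc_subset_Icc_self hx)

theorem MemH1.velocity_memH1 (h : MemH1 γ) (hl : 0 < len (deriv γ)) : MemH1 (velocity γ) := by
  have hf := h.perInt
  rw [funext (h.velocity_eq hl)]
  have h1 := (hf.isPrim_nf hl).const_smul (-1)
  simp only [neg_smul, one_smul] at h1
  refine h1.memH1 (fun u => by simp only [hf.nf_periodic u]) ?_
  exact (h.2.1.sub (MemLp.qn_smul hf h.2.1)).neg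

end ClosedCurves

section AeCongr

variable {f g : ℝ → Plane}

theorem arc_congr_ae (h : ∀ᵐ u, f u = g u) : arc f = arc g := funext fun u =>
  intervalIntegral.integral_congr_ae (h.mono fun x hx _ => by rw [hx])

theorem len_congr_ae (h : ∀ᵐ u, f u = g u) : len f = len g := by
  rw [← arc_one, ← arc_one, arc_congr_ae h]

theorem nf_congr_ae (h : ∀ᵐ u, f u = g u) : nf f = nf g := funext fun u => by
  rw [nf_eq, nf_eq, arc_congr_ae h, len_congr_ae h]
  exact intervalIntegral.integral_congr_ae (h.mono fun x hx _ => by rw [hx])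

end AeCongr

/-! ### Monotonicity with an integrating factor -/

section Comparison

variable {E E' B b : ℝ → ℝ}

theorem monotone_exp_mul (hE : ∀ t, HasDerivAt E (E' t) t) (hB : ∀ t, HasDerivAt B (b t) t)
    (h : ∀ t, -(b t * E t) ≤ E' t) : Monotone fun t => Real.exp (B t) * E t := by
  have hd : ∀ t, HasDerivAt (fun t => Real.exp (B t) * E t)
      (Real.exp (B t) * b t * E t + Real.exp (B t) * E' t) t := fun t => (hB t).exp.mul (hE t)
  refine monotone_of_deriv_nonneg (fun t => (hd t).differentiableAt) fun t => ?_
  rw [(hd t).deriv, mul_assoc, ← mul_add]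
  exact mul_nonneg (Real.exp_pos _).le (by linarith [h t])

theorem antitone_exp_neg_mul (hE : ∀ t, HasDerivAt E (E' t) t) (hB : ∀ t, HasDerivAt B (b t) t)
    (h : ∀ t, E' t ≤ b t * E t) : Antitone fun t => Real.exp (-B t) * E t := by
  have hd : ∀ t, HasDerivAt (fun t => Real.exp (-B t) * E t)
      (Real.exp (-B t) * -b t * E t + Real.exp (-B t) * E' t) t := fun t =>
    (hB t).neg.exp.mul (hE t)
  refine antitone_of_deriv_nonpos (fun t => (hd t).differentiableAt) fun t => ?_
  rw [(hd t).deriv, mul_assoc, ← mul_add]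
  exact mul_nonpos_of_nonneg_of_nonpos (Real.exp_pos _).le (by linarith [h t])

end Comparison

/-! ### The light cone and the removal of the truncation -/

/-- A solution of the linear evolution of the derivative, together with the inverse evolution. -/
structure Evolution (z₀ : ℝ → Plane) where
  perInt : PerInt z₀
  len_pos : 0 < len z₀
  closed : ∫ u in (0 : ℝ)..1, z₀ u = 0
  fam : ℝ → Fam
  inv : ℝ → Fam
  fam_zero : fam 0 = 1
  inv_zero : inv 0 = 1
  hasDerivAt_fam : ∀ t, HasDerivAt fam (gen perInt t (fam t) * fam t) t
  hasDerivAt_inv : ∀ t, HasDerivAt inv (-(inv t * gen perInt t (fam t))) t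

namespace Evolution

variable {z₀ : ℝ → Plane} (ev : Evolution z₀)

/-- The derivative of the curve, rescaled by `exp t`. -/
def Z (t u : ℝ) : Plane := vec z₀ (ev.fam t) u

/-- The norm of the derivative of the curve, rescaled by `exp t`. -/
def E (t u : ℝ) : ℝ := tim z₀ (ev.fam t) u

/-- The derivative of the curve. -/
def f (t : ℝ) : ℝ → Plane := fld z₀ t (ev.fam t)

theorem f_eq (t u : ℝ) : ev.f t u = Real.exp (-t) • ev.Z t u := rfl

theorem perInt_f (t : ℝ) : PerInt (ev.f t) := perInt_fld ev.perInt t _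

theorem perInt_Z (t : ℝ) : PerInt (ev.Z t) := perInt_vec ev.perInt _

theorem Z_zero (u : ℝ) : ev.Z 0 u = z₀ u := by
  rw [Z, ev.fam_zero]; rfl

theorem E_zero (u : ℝ) : ev.E 0 u = ‖z₀ u‖ := by
  rw [E, ev.fam_zero]; rfl

theorem inv_mul_fam (t : ℝ) : ev.inv t * ev.fam t = 1 := by
  have h : ∀ t, HasDerivAt (fun t => ev.inv t * ev.fam t) 0 t := fun t => by
    have := (ev.hasDerivAt_inv t).mul (ev.hasDerivAt_fam t)
    refine this.congr_deriv ?_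
    noncomm_ring
  have h1 := is_const_of_deriv_eq_zero (fun t => (h t).differentiableAt)
    (fun t => (h t).deriv) t 0
  simpa [ev.inv_zero, ev.fam_zero] using h1

theorem hasDerivAt_apply (t u : ℝ) : HasDerivAt (fun t => (ev.fam t).at u (light z₀ u))
    ((gen ev.perInt t (ev.fam t)).at u ((ev.fam t).at u (light z₀ u))) t := by
  have h := ((ContinuousLinearMap.apply ℝ Mink (light z₀ u)).comp
    (Fam.evalCLM u)).hasFDerivAt.comp_hasDerivAt t (ev.hasDerivAt_fam t)
  exact h

/-- The convolution driving the truncated evolution. -/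
def qt (t u : ℝ) : Plane := qf (cothHalf (lenTrunc z₀ t (ev.fam t))) (ev.f t) u

theorem norm_qt_le (t u : ℝ) : ‖ev.qt t u‖ ≤ 1 :=
  (ev.perInt_f t).norm_qf_le_one (lenTrunc_pos ev.len_pos t _) (le_max_left _ _) u

theorem hasDerivAt_E' (t u : ℝ) :
    HasDerivAt (fun t => ev.E t u) (inner ℝ (ev.qt t u) (ev.Z t u)) t := by
  have h := (ContinuousLinearMap.fst ℝ ℝ Plane).hasFDerivAt.comp_hasDerivAt t
    (ev.hasDerivAt_apply t u)
  exact h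

theorem hasDerivAt_Z' (t u : ℝ) :
    HasDerivAt (fun t => ev.Z t u) (ev.E t u • ev.qt t u) t := by
  have h := (ContinuousLinearMap.snd ℝ ℝ Plane).hasFDerivAt.comp_hasDerivAt t
    (ev.hasDerivAt_apply t u)
  exact h

/-- Boosts preserve the Minkowski form, and the initial vector is lightlike. -/
theorem E_sq (t u : ℝ) : ev.E t u ^ 2 = ‖ev.Z t u‖ ^ 2 := by
  have h : ∀ t, HasDerivAt (fun t => ev.E t u ^ 2 - ‖ev.Z t u‖ ^ 2) 0 t := fun t => by
    refine (((ev.hasDerivAt_E' t u).pow 2).sub (ev.hasDerivAt_Z' t u).norm_sq).congr_deriv ?_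
    rw [inner_smul_right, real_inner_comm]
    push_cast
    ring
  have h1 := is_const_of_deriv_eq_zero (fun t => (h t).differentiableAt)
    (fun t => (h t).deriv) t 0
  rw [ev.E_zero, ev.Z_zero, sub_self] at h1
  linarith

theorem continuous_E (u : ℝ) : Continuous fun t => ev.E t u :=
  continuous_iff_continuousAt.2 fun t => (ev.hasDerivAt_E' t u).continuousAt

theorem continuous_Z (u : ℝ) : Continuous fun t => ev.Z t u :=
  continuous_iff_continuousAt.2 fun t => (ev.hasDerivAt_Z' t u).continuousAt

theorem inv_apply (t u : ℝ) : (ev.inv t).at u (ev.E t u, ev.Z t u) = light z₀ u := by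
  have h := congrArg (fun x : Fam => x.at u (light z₀ u)) (ev.inv_mul_fam t)
  exact h

theorem E_ne_zero {t u : ℝ} (hu : z₀ u ≠ 0) : ev.E t u ≠ 0 := fun h0 => by
  have h1 : ev.Z t u = 0 := by
    have := ev.E_sq t u
    rw [h0, zero_pow two_ne_zero] at this
    exact norm_eq_zero.1 (pow_eq_zero_iff two_ne_zero |>.1 this.symm)
  have h2 := ev.inv_apply t u
  rw [h0, h1, ← Prod.zero_eq_mk, map_zero] at h2
  exact hu (congrArg Prod.snd h2).symm

/-- Where `z₀` does not vanish, invertibility of the evolution keeps the lightlike vector, hence its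
time component, from vanishing. By continuity in `t` the initial positive sign persists. -/
theorem E_nonneg (t u : ℝ) : 0 ≤ ev.E t u := by
  by_cases hu : z₀ u = 0
  · have h : light z₀ u = 0 := by rw [light, hu, norm_zero]; rfl
    rw [E, tim, h, map_zero]
    rfl
  · by_contra! hneg
    have h0 : 0 < ev.E 0 u := by rw [ev.E_zero]; exact norm_pos_iff.2 hu
    obtain ⟨s, hs⟩ := mem_range_of_exists_le_of_exists_ge (ev.continuous_E u) ⟨t, hneg.le⟩
      ⟨0, h0.le⟩
    exact ev.E_ne_zero hu hs

theorem norm_Z (t u : ℝ) : ‖ev.Z t u‖ = ev.E t u :=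
  ((sq_eq_sq₀ (ev.E_nonneg t u) (norm_nonneg _)).1 (ev.E_sq t u)).symm

theorem norm_f (t u : ℝ) : ‖ev.f t u‖ = Real.exp (-t) * ev.E t u := by
  rw [f_eq, norm_smul, Real.norm_of_nonneg (Real.exp_pos _).le, norm_Z]

/-- Since `|q| ≤ 1`, also for the truncated kernel, `|E'| ≤ E` in both time directions. -/
theorem exp_neg_abs_mul_le_E (t u : ℝ) : Real.exp (-|t|) * ‖z₀ u‖ ≤ ev.E t u := by
  have hb : ∀ t, |inner ℝ (ev.qt t u) (ev.Z t u)| ≤ 1 * ev.E t u := fun t =>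
    (abs_real_inner_le_norm _ _).trans (by
      rw [norm_Z]; exact mul_le_mul_of_nonneg_right (ev.norm_qt_le t u) (ev.E_nonneg t u))
  rcases le_total 0 t with ht | ht
  · have h := monotone_exp_mul (fun t => ev.hasDerivAt_E' t u) (B := id) (b := fun _ => 1)
      (fun t => hasDerivAt_id t) (fun t => (abs_le.1 (hb t)).1) ht
    simp only [id, Real.exp_zero, one_mul, E_zero] at h
    rw [abs_of_nonneg ht, Real.exp_neg, inv_mul_le_iff₀ (Real.exp_pos t)]
    exact h
  · have h := antitone_exp_neg_mul (fun t => ev.hasDerivAt_E' t u) (B := id) (b := fun _ => 1)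
      (fun t => hasDerivAt_id t) (fun t => (abs_le.1 (hb t)).2) ht
    simp only [id, neg_zero, Real.exp_zero, one_mul, E_zero] at h
    rw [abs_of_nonpos ht, neg_neg]
    calc _ ≤ Real.exp t * (Real.exp (-t) * ev.E t u) := by gcongr
      _ = _ := by rw [← mul_assoc, ← Real.exp_add]; simp

/-- One factor `e^{-|t|}` comes from `E`, the other from `f = e^{-t} Z`. The truncation level was
chosen as exactly this bound, so the solution solves the untruncated equation. -/
theorem le_len_f (t : ℝ) : Real.exp (-2 * |t|) * len z₀ ≤ len (ev.f t) := by
  rw [len, len, ← intervalIntegral.integral_const_mul]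
  refine intervalIntegral.integral_mono zero_le_one (ev.perInt.integrable.norm.const_mul _)
    (ev.perInt_f t).integrable.norm fun u => ?_
  change _ * ‖z₀ u‖ ≤ ‖ev.f t u‖
  rw [norm_f]
  calc _ = Real.exp (-|t|) * (Real.exp (-|t|) * ‖z₀ u‖) := by
        rw [← mul_assoc, ← Real.exp_add]; ring_nf
    _ ≤ _ := by
        have := ev.exp_neg_abs_mul_le_E t u
        gcongr
        exact le_abs_self t

theorem lenTrunc_eq (t : ℝ) : lenTrunc z₀ t (ev.fam t) = len (ev.f t) := max_eq_left (ev.le_len_f t)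

theorem len_f_pos (t : ℝ) : 0 < len (ev.f t) :=
  lt_of_lt_of_le (by have := ev.len_pos; positivity) (ev.le_len_f t)

theorem qt_eq (t : ℝ) : ev.qt t = qn (ev.f t) := funext fun u => by
  rw [qt, lenTrunc_eq, qn]

theorem hasDerivAt_E (t u : ℝ) :
    HasDerivAt (fun t => ev.E t u) (inner ℝ (qn (ev.f t) u) (ev.Z t u)) t := by
  rw [← qt_eq]; exact ev.hasDerivAt_E' t u

theorem hasDerivAt_Z (t u : ℝ) :
    HasDerivAt (fun t => ev.Z t u) (ev.E t u • qn (ev.f t) u) t := by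
  rw [← qt_eq]; exact ev.hasDerivAt_Z' t u

theorem gen_at (t u : ℝ) : (gen ev.perInt t (ev.fam t)).at u = boost (qn (ev.f t) u) := by
  rw [H1CSF.gen_at, lenTrunc_eq]; rfl

end Evolution

/-! ### Integrals as continuous linear functionals of the family -/

section Functionals

variable {z₀ : ℝ → Plane}

/-- The primitive of the vector part as a continuous linear functional of the family. -/
def primVec (hz : PerInt z₀) (a b : ℝ) : Fam →L[ℝ] Plane :=
  LinearMap.mkContinuous ⟨⟨fun x => ∫ u in a..b, vec z₀ x u, fun x y => by
      rw [← intervalIntegral.integral_add ((perInt_vec hz x).intervalIntegrable _ _)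
        ((perInt_vec hz y).intervalIntegrable _ _)]; rfl⟩,
    fun c x => by
      rw [RingHom.id_apply, ← intervalIntegral.integral_smul]; rfl⟩
    |∫ u in a..b, ‖z₀ u‖| fun x => by
      change ‖∫ u in a..b, vec z₀ x u‖ ≤ _
      refine (intervalIntegral.norm_integral_le_abs_of_norm_le (g := fun u => ‖x‖ * ‖z₀ u‖)
        (Eventually.of_forall fun u => norm_vec_le x u)
        ((hz.intervalIntegrable _ _).norm.const_mul _)).trans ?_
      rw [intervalIntegral.integral_const_mul, abs_mul, abs_norm, mul_comm]

theorem primVec_apply (hz : PerInt z₀) (a b : ℝ) (x : Fam) :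
    primVec hz a b x = ∫ u in a..b, vec z₀ x u := rfl

/-- The primitive of the time part as a continuous linear functional of the family. -/
def primTim (hz : PerInt z₀) (a b : ℝ) : Fam →L[ℝ] ℝ :=
  LinearMap.mkContinuous ⟨⟨fun x => ∫ u in a..b, tim z₀ x u, fun x y => by
      rw [← intervalIntegral.integral_add (intervalIntegrable_tim hz x _ _)
        (intervalIntegrable_tim hz y _ _)]; rfl⟩,
    fun c x => by
      rw [RingHom.id_apply, ← intervalIntegral.integral_smul]; rfl⟩
    |∫ u in a..b, ‖z₀ u‖| fun x => by
      change ‖∫ u in a..b, tim z₀ x u‖ ≤ _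
      refine (intervalIntegral.norm_integral_le_abs_of_norm_le (g := fun u => ‖x‖ * ‖z₀ u‖)
        (Eventually.of_forall fun u => abs_tim_le x u)
        ((hz.intervalIntegrable _ _).norm.const_mul _)).trans ?_
      rw [intervalIntegral.integral_const_mul, abs_mul, abs_norm, mul_comm]

theorem primTim_apply (hz : PerInt z₀) (a b : ℝ) (x : Fam) :
    primTim hz a b x = ∫ u in a..b, tim z₀ x u := rfl

end Functionals

/-! ### Closedness and continuity in time -/

namespace Evolution

variable {z₀ : ℝ → Plane} (ev : Evolution z₀)

theorem vec_gen_mul (t u : ℝ) : vec z₀ (gen ev.perInt t (ev.fam t) * ev.fam t) u =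
    ev.E t u • qn (ev.f t) u := by
  rw [vec, Fam.mul_at, ev.gen_at]; rfl

theorem tim_gen_mul (t u : ℝ) : tim z₀ (gen ev.perInt t (ev.fam t) * ev.fam t) u =
    inner ℝ (qn (ev.f t) u) (ev.Z t u) := by
  rw [tim, Fam.mul_at, ev.gen_at]; rfl

theorem hasDerivAt_integral_Z (t a b : ℝ) : HasDerivAt (fun t => ∫ u in a..b, ev.Z t u)
    (∫ u in a..b, ev.E t u • qn (ev.f t) u) t := by
  have h := (primVec ev.perInt a b).hasFDerivAt.comp_hasDerivAt t (ev.hasDerivAt_fam t)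
  rw [primVec_apply] at h
  simp only [ev.vec_gen_mul] at h
  exact h

theorem hasDerivAt_integral_E (t a b : ℝ) : HasDerivAt (fun t => ∫ u in a..b, ev.E t u)
    (∫ u in a..b, inner ℝ (qn (ev.f t) u) (ev.Z t u)) t := by
  have h := (primTim ev.perInt a b).hasFDerivAt.comp_hasDerivAt t (ev.hasDerivAt_fam t)
  rw [primTim_apply] at h
  simp only [ev.tim_gen_mul] at h
  exact h

theorem E_eq (t u : ℝ) : ev.E t u = Real.exp t * ‖ev.f t u‖ := by
  rw [norm_f, ← mul_assoc, ← Real.exp_add]; simp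

theorem Z_eq (t u : ℝ) : ev.Z t u = Real.exp t • ev.f t u := by
  rw [f_eq, smul_smul, ← Real.exp_add]; simp

/-- The integral of `E q` over a period equals that of `Z`, so the total `W` satisfies `W' = W`; it
starts at zero because the initial curve is closed. -/
theorem integral_Z (t : ℝ) : ∫ u in (0 : ℝ)..1, ev.Z t u = 0 := by
  have h : ∀ t, HasDerivAt (fun t => ∫ u in (0 : ℝ)..1, ev.Z t u)
      (∫ u in (0 : ℝ)..1, ev.Z t u) t := fun t => by
    refine (ev.hasDerivAt_integral_Z t 0 1).congr_deriv ?_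
    simp only [ev.E_eq, ev.Z_eq, mul_smul, intervalIntegral.integral_smul]
    rw [(ev.perInt_f t).integral_norm_smul_qn (ev.len_f_pos t)]
  have h2 : ∀ t, HasDerivAt (fun t => Real.exp (-t) • ∫ u in (0 : ℝ)..1, ev.Z t u) 0 t :=
    fun t => by
    have := (hasDerivAt_neg t).exp.smul (h t)
    refine this.congr_deriv ?_
    module
  have h1 := is_const_of_deriv_eq_zero (fun t => (h2 t).differentiableAt)
    (fun t => (h2 t).deriv) t 0
  simp only [ev.Z_zero, ev.closed, smul_zero] at h1
  exact (smul_eq_zero.1 h1).resolve_left (Real.exp_pos _).ne'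

theorem integral_f (t : ℝ) : ∫ u in (0 : ℝ)..1, ev.f t u = 0 := by
  simp only [f_eq, intervalIntegral.integral_smul, ev.integral_Z, smul_zero]

theorem len_f (t : ℝ) : len (ev.f t) = Real.exp (-t) * ∫ u in (0 : ℝ)..1, ev.E t u := by
  simp only [len, norm_f, intervalIntegral.integral_const_mul]

theorem continuous_fam : Continuous ev.fam :=
  continuous_iff_continuousAt.2 fun t => (ev.hasDerivAt_fam t).continuousAt

theorem continuous_gen : Continuous fun t => gen ev.perInt t (ev.fam t) := by
  rw [continuous_iff_continuousAt]
  intro t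
  obtain ⟨K, hK0, hK⟩ := exists_norm_gen_sub_le ev.perInt ev.len_pos (|t| + 1) (‖ev.fam t‖ + 1)
    (by positivity)
  rw [ContinuousAt, tendsto_iff_norm_sub_tendsto_zero]
  have hlim : Tendsto (fun s : ℝ => K * (‖ev.fam s - ev.fam t‖ +
      |Real.exp (-s) - Real.exp (-t)| + |Real.exp (-2 * |s|) - Real.exp (-2 * |t|)|))
      (𝓝 t) (𝓝 0) := by
    have hc : Continuous fun s : ℝ => K * (‖ev.fam s - ev.fam t‖ +
        |Real.exp (-s) - Real.exp (-t)| + |Real.exp (-2 * |s|) - Real.exp (-2 * |t|)|) := by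
      have := ev.continuous_fam
      fun_prop
    have := hc.tendsto t
    simpa using this
  refine squeeze_zero' (Eventually.of_forall fun _ => norm_nonneg _) ?_ hlim
  have hn : ∀ᶠ s in 𝓝 t, ‖ev.fam s‖ < ‖ev.fam t‖ + 1 :=
    (ev.continuous_fam.norm.tendsto t).eventually_lt_const (by linarith)
  filter_upwards [Metric.ball_mem_nhds t one_pos, hn] with s hs hn
  refine hK s t _ _ ?_ (by linarith) hn.le (by linarith)
  rw [Metric.mem_ball, Real.dist_eq] at hs
  have := abs_sub_abs_le_abs_sub s t
  linarith

theorem continuous_len_f : Continuous fun t => len (ev.f t) := by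
  simp only [len_f]
  have h : Continuous fun t => ∫ u in (0 : ℝ)..1, ev.E t u :=
    continuous_iff_continuousAt.2 fun t => (ev.hasDerivAt_integral_E t 0 1).continuousAt
  fun_prop

theorem continuous_arc_f (u : ℝ) : Continuous fun t => arc (ev.f t) u := by
  simp only [arc, norm_f, intervalIntegral.integral_const_mul]
  have h : Continuous fun t => ∫ x in (0 : ℝ)..u, ev.E t x :=
    continuous_iff_continuousAt.2 fun t => (ev.hasDerivAt_integral_E t 0 u).continuousAt
  fun_prop

theorem continuous_f (u : ℝ) : Continuous fun t => ev.f t u := by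
  have := ev.continuous_Z u
  simp only [f_eq]
  fun_prop

theorem E_le (t u : ℝ) : ev.E t u ≤ ‖ev.fam t‖ * ‖z₀ u‖ := (le_abs_self _).trans (abs_tim_le _ _)

theorem abs_kerD_le_half {l d : ℝ} (hl : 0 < l) (hd : d ∈ Set.Icc 0 l) :
    |kerD (cothHalf l) d| ≤ 1 / 2 := by
  refine abs_le.2 ⟨?_, ?_⟩
  · have := kerD_mono hl hd.1
    rw [kerD_zero] at this
    linarith
  · have := kerD_mono hl hd.2
    rwa [kerD_self hl] at this

/-- Dominated convergence in `v`: the derivative of the kernel is at most `1/2` on the period, and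
`‖f‖` is locally uniformly in `t` at most a constant times `‖z₀‖`. -/
theorem continuous_nf (u : ℝ) : Continuous fun t => nf (ev.f t) u := by
  rw [continuous_iff_continuousAt]
  intro t
  have hc : Continuous fun s => Real.exp (-s) * ‖ev.fam s‖ := by
    have := ev.continuous_fam
    fun_prop
  have hn : ∀ᶠ s in 𝓝 t, Real.exp (-s) * ‖ev.fam s‖ < Real.exp (-t) * ‖ev.fam t‖ + 1 :=
    (hc.tendsto t).eventually_lt_const (by linarith)
  simp only [nf_eq]
  refine intervalIntegral.continuousAt_of_dominated_interval
    (bound := fun v => 1 / 2 * ((Real.exp (-t) * ‖ev.fam t‖ + 1) * ‖z₀ v‖)) ?_ ?_ ?_ ?_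
  · refine Eventually.of_forall fun s => ?_
    have h := ((ev.perInt_f s).intervalIntegrable u (u + 1)).continuousOn_smul
      ((continuous_kerD (cothHalf (len (ev.f s)))).comp
        ((ev.perInt_f s).continuous_arc.sub (continuous_const (y := arc (ev.f s) u)))).continuousOn
    exact (intervalIntegrable_iff.1 h).aestronglyMeasurable
  · filter_upwards [hn] with s hs
    refine Eventually.of_forall fun v hv => ?_
    rw [Set.uIoc_of_le (by linarith)] at hv
    rw [norm_smul]
    gcongr
    · exact abs_kerD_le_half (ev.len_f_pos s)
        ((ev.perInt_f s).arc_sub_mem (Set.Ioc_subset_Icc_self hv))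
    · rw [norm_f]
      calc _ ≤ Real.exp (-s) * (‖ev.fam s‖ * ‖z₀ v‖) := by gcongr; exact ev.E_le s v
        _ = Real.exp (-s) * ‖ev.fam s‖ * ‖z₀ v‖ := by ring
        _ ≤ _ := by gcongr
  · exact (((ev.perInt.intervalIntegrable _ _).norm.const_mul _).const_mul _)
  · refine Eventually.of_forall fun v _ => Continuous.continuousAt ?_
    have hv := ev.continuous_f v
    simp only [kerD, cothHalf]
    have h1 := ev.continuous_len_f
    have h2 := ev.continuous_arc_f v
    have h3 := ev.continuous_arc_f u
    have h4 : ∀ s, Real.sinh (len (ev.f s) / 2) ≠ 0 := fun s => (sinh_half_pos (ev.len_f_pos s)).ne'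
    fun_prop (disch := exact h4)

end Evolution

theorem nonempty_evolution {z₀ : ℝ → Plane} (hz : PerInt z₀) (hl : 0 < len z₀)
    (h0 : ∫ u in (0 : ℝ)..1, z₀ u = 0) : Nonempty (Evolution z₀) := by
  obtain ⟨Λ, M, h1, h2, h3, h4⟩ := exists_evolution hz hl
  exact ⟨⟨hz, hl, h0, Λ, M, h1, h2, h3, h4⟩⟩

/-! ### Initial data -/

section InitialData

theorem memLp_of_continuous {f : ℝ → Plane} (hf : Continuous f) :
    MemLp f 2 (volume.restrict (Set.Ioc (0 : ℝ) 1)) := by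
  obtain ⟨K, hK⟩ := (isCompact_Icc (a := (0 : ℝ)) (b := 1)).exists_bound_of_continuousOn
    hf.continuousOn
  exact MemLp.of_bound hf.aestronglyMeasurable K ((ae_restrict_iff' measurableSet_Ioc).2
    (Eventually.of_forall fun x hx => hK x (Set.Ioc_subset_Icc_self hx)))

theorem MemCk.memH1 {k : ℕ} (hk : k ≠ 0) {γ : ℝ → Plane} (h : MemCk k γ) : MemH1 γ := by
  have h1 : ContDiff ℝ 1 γ := h.2.of_le (by exact_mod_cast Nat.one_le_iff_ne_zero.2 hk)
  have hc : Continuous (deriv γ) := h1.continuous_deriv_one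
  exact (isPrim_of_hasDerivAt (fun u => (h1.differentiable one_ne_zero u).hasDerivAt) hc).memH1
    h.1 (memLp_of_continuous hc)

theorem InitialData.memH1 {k : ℕ} {γ : ℝ → Plane} (h : InitialData k γ) : MemH1 γ := by
  have h1 := h.1
  split_ifs at h1 with hk
  · exact h1
  · exact h1.memH1 hk

theorem MemH1.nonempty_evolution {γ : ℝ → Plane} (h : MemH1 γ) (hn : ¬ IsConstantMap γ) :
    Nonempty (Evolution (deriv γ)) :=
  H1CSF.nonempty_evolution h.perInt (h.len_pos hn) h.integral_deriv

end InitialData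

/-! ### From families to the `H¹` norm -/

section Norm

variable {z₀ : ℝ → Plane}

theorem memLp_vec (hz : PerInt z₀) (h2 : MemLp z₀ 2 (volume.restrict (Set.Ioc (0 : ℝ) 1))) (x : Fam) :
    MemLp (vec z₀ x) 2 (volume.restrict (Set.Ioc (0 : ℝ) 1)) := by
  refine MemLp.of_le_mul (c := ‖x‖) h2 ?_ (Eventually.of_forall fun u => norm_vec_le x u)
  have h := (perInt_vec hz x).integrable
  rw [intervalIntegrable_iff_integrableOn_Ioc_of_le zero_le_one] at h
  exact h.aestronglyMeasurable

/-- A curve whose derivative is obtained by applying a family to the fixed `L²` function `z₀` is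
controlled by its base point and the norm of the family. Differentiability in `Fam` thereby becomes
differentiability in `H¹`. -/
theorem h1Norm_le (hz : PerInt z₀) (h2 : MemLp z₀ 2 (volume.restrict (Set.Ioc (0 : ℝ) 1)))
    {r : ℝ → Plane} {x : Fam} (hr : IsPrim r (vec z₀ x)) :
    h1Norm r ≤ Real.sqrt ((‖r 0‖ + ‖x‖ * len z₀) ^ 2 +
      ‖x‖ ^ 2 * ∫ u in (0 : ℝ)..1, ‖z₀ u‖ ^ 2) := by
  refine Real.sqrt_le_sqrt (add_le_add ?_ ?_)
  · have h1 : ∀ u ∈ Set.Icc (0 : ℝ) 1, ‖r u‖ ≤ ‖r 0‖ + ‖x‖ * len z₀ := fun u hu => by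
      have e : r u = r 0 + (r u - r 0) := by abel
      rw [e]
      refine (norm_add_le _ _).trans (add_le_add le_rfl ?_)
      rw [hr.sub_eq]
      refine (intervalIntegral.norm_integral_le_of_norm_le hu.1 (g := fun u => ‖x‖ * ‖z₀ u‖)
        (Eventually.of_forall fun u _ => norm_vec_le x u)
        ((hz.intervalIntegrable _ _).norm.const_mul _)).trans ?_
      rw [intervalIntegral.integral_const_mul]
      gcongr
      exact hz.monotone_arc hu.2
    calc _ ≤ ∫ u in (0 : ℝ)..1, (‖r 0‖ + ‖x‖ * len z₀) ^ 2 := by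
          refine intervalIntegral.integral_mono_on zero_le_one
            ((hr.continuous.norm.pow 2).intervalIntegrable _ _)
            (continuous_const.intervalIntegrable _ _) fun u hu => ?_
          have := h1 u hu
          gcongr
      _ = _ := by simp
  · rw [← intervalIntegral.integral_const_mul, intervalIntegral.integral_of_le zero_le_one,
      intervalIntegral.integral_of_le zero_le_one]
    refine integral_mono_of_nonneg (Eventually.of_forall fun u => by positivity)
      ((h2.integrable_norm_pow two_ne_zero).const_mul _) ?_
    filter_upwards [ae_restrict_of_ae hr.ae_deriv] with u hu
    have hu' : deriv r u = vec z₀ x u := hu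
    rw [hu', ← mul_pow]
    gcongr
    exact norm_vec_le x u

theorem tendsto_h1Norm_zero {α : Type*} {l : Filter α} (hz : PerInt z₀)
    (h2 : MemLp z₀ 2 (volume.restrict (Set.Ioc (0 : ℝ) 1))) {r : α → ℝ → Plane} {x : α → Fam}
    (hr : ∀ a, IsPrim (r a) (vec z₀ (x a))) (h0 : Tendsto (fun a => r a 0) l (𝓝 0))
    (hx : Tendsto x l (𝓝 0)) : Tendsto (fun a => h1Norm (r a)) l (𝓝 0) := by
  refine squeeze_zero (fun a => Real.sqrt_nonneg _) (fun a => h1Norm_le hz h2 (hr a)) ?_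
  have h1 : Tendsto (fun a => (‖r a 0‖ + ‖x a‖ * len z₀) ^ 2 +
      ‖x a‖ ^ 2 * ∫ u in (0 : ℝ)..1, ‖z₀ u‖ ^ 2) l (𝓝 ((‖(0 : Plane)‖ + ‖(0 : Fam)‖ * len z₀) ^ 2 +
      ‖(0 : Fam)‖ ^ 2 * ∫ u in (0 : ℝ)..1, ‖z₀ u‖ ^ 2)) :=
    ((h0.norm.add (hx.norm.mul_const _)).pow 2).add ((hx.norm.pow 2).mul_const _)
  have h3 := (Real.continuous_sqrt.tendsto _).comp h1
  simp only [norm_zero, zero_mul, add_zero, ne_eq, OfNat.ofNat_ne_zero, not_false_eq_true, zero_pow,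
    Real.sqrt_zero] at h3
  exact h3

end Norm

/-! ### The solution of the flow -/

namespace Evolution

variable {z₀ : ℝ → Plane} (ev : Evolution z₀)

/-- The family giving the derivative of the curve. -/
def A (t : ℝ) : Fam := Real.exp (-t) • ev.fam t

/-- The time derivative of `A`. -/
def A' (t : ℝ) : Fam := Real.exp (-t) • (gen ev.perInt t (ev.fam t) * ev.fam t - ev.fam t)

theorem hasDerivAt_A (t : ℝ) : HasDerivAt ev.A (ev.A' t) t := by
  refine ((hasDerivAt_neg t).exp.smul (ev.hasDerivAt_fam t)).congr_deriv ?_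
  rw [A']
  module

theorem continuous_A' : Continuous ev.A' := by
  have h1 := ev.continuous_fam
  have h2 := ev.continuous_gen
  unfold A'
  fun_prop

theorem vec_A' (t u : ℝ) : vec z₀ (ev.A' t) u = ‖ev.f t u‖ • qn (ev.f t) u - ev.f t u := by
  have h : vec z₀ (ev.A' t) u =
      Real.exp (-t) • (vec z₀ (gen ev.perInt t (ev.fam t) * ev.fam t) u - ev.Z t u) := rfl
  rw [h, ev.vec_gen_mul, norm_f, f_eq, mul_smul, smul_sub]

/-- The solution of the flow with given derivative and initial base point. -/
def curve (x₀ : Plane) (t u : ℝ) : Plane :=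
  (x₀ - ∫ τ in (0 : ℝ)..t, nf (ev.f τ) 0) + ∫ x in (0 : ℝ)..u, ev.f t x

variable (x₀ : Plane)

theorem isPrim_curve (t : ℝ) : IsPrim (ev.curve x₀ t) (ev.f t) := by
  have h := (isPrim_integral (ev.perInt_f t).intervalIntegrable 0).add_const
    (x₀ - ∫ τ in (0 : ℝ)..t, nf (ev.f τ) 0)
  simp only [add_comm _ (x₀ - _)] at h
  exact h

theorem curve_periodic (t : ℝ) : Function.Periodic (ev.curve x₀ t) 1 :=
  (ev.isPrim_curve x₀ t).periodic (ev.perInt_f t).periodic (ev.integral_f t)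

theorem curve_memH1 (h2 : MemLp z₀ 2 (volume.restrict (Set.Ioc (0 : ℝ) 1))) (t : ℝ) :
    MemH1 (ev.curve x₀ t) :=
  (ev.isPrim_curve x₀ t).memH1 (ev.curve_periodic x₀ t) (memLp_vec ev.perInt h2 (ev.A t))

theorem ae_deriv_curve (t : ℝ) : ∀ᵐ u, deriv (ev.curve x₀ t) u = ev.f t u :=
  (ev.isPrim_curve x₀ t).ae_deriv

theorem velocity_curve (h2 : MemLp z₀ 2 (volume.restrict (Set.Ioc (0 : ℝ) 1))) (t : ℝ) :
    velocity (ev.curve x₀ t) = fun u => -nf (ev.f t) u := funext fun u => by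
  have hd := ev.ae_deriv_curve x₀ t
  rw [(ev.curve_memH1 x₀ h2 t).velocity_eq (by rw [len_congr_ae hd]; exact ev.len_f_pos t),
    nf_congr_ae hd]

theorem isPrim_velocity (t : ℝ) : IsPrim (fun u => -nf (ev.f t) u) (vec z₀ (ev.A' t)) := by
  have h := ((ev.perInt_f t).isPrim_nf (ev.len_f_pos t)).const_smul (-1)
  simp only [neg_smul, one_smul, neg_sub] at h
  rw [funext (ev.vec_A' t)]
  exact h

theorem hasDerivAt_curve_zero (t : ℝ) :
    HasDerivAt (fun t => ev.curve x₀ t 0) (-nf (ev.f t) 0) t := by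
  have hc := ev.continuous_nf 0
  have h := (intervalIntegral.integral_hasDerivAt_right (hc.intervalIntegrable 0 t)
    (hc.stronglyMeasurableAtFilter _ _) hc.continuousAt).const_sub x₀
  simp only [curve, intervalIntegral.integral_same, add_zero]
  exact h

/-- The error of the difference quotient has as derivative the corresponding error for `A` in `Fam`,
applied to the lift of `z₀`. So the differentiability of `A` and of the base point suffices, and
continuity of the velocity follows in the same way from that of `A'`. -/
theorem isFlow_curve (h2 : MemLp z₀ 2 (volume.restrict (Set.Ioc (0 : ℝ) 1))) :
    IsFlow (ev.curve x₀) where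
  mem := ev.curve_memH1 x₀ h2
  nonconstant t := not_isConstantMap_of_len_pos (by
    rw [len_congr_ae (ev.ae_deriv_curve x₀ t)]; exact ev.len_f_pos t)
  velocity_mem t := (ev.curve_memH1 x₀ h2 t).velocity_memH1 (by
    rw [len_congr_ae (ev.ae_deriv_curve x₀ t)]; exact ev.len_f_pos t)
  hasDeriv t := by
    rw [ev.velocity_curve x₀ h2 t]
    refine tendsto_h1Norm_zero (x := fun h => h⁻¹ • (ev.A (t + h) - ev.A t) - ev.A' t)
      ev.perInt h2 (fun h => ?_) ?_ ?_
    · exact (((ev.isPrim_curve x₀ (t + h)).sub (ev.isPrim_curve x₀ t)).const_smul h⁻¹).sub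
        (ev.isPrim_velocity t)
    · have h := (hasDerivAt_iff_tendsto_slope_zero.1 (ev.hasDerivAt_curve_zero x₀ t)).sub_const
        (-nf (ev.f t) 0)
      rwa [sub_self] at h
    · have h := (hasDerivAt_iff_tendsto_slope_zero.1 (ev.hasDerivAt_A t)).sub_const (ev.A' t)
      rwa [sub_self] at h
  continuous_deriv t := by
    rw [ev.velocity_curve x₀ h2 t]
    simp only [ev.velocity_curve x₀ h2]
    refine tendsto_h1Norm_zero (x := fun τ => ev.A' τ - ev.A' t) ev.perInt h2 (fun τ => ?_) ?_ ?_
    · exact (ev.isPrim_velocity τ).sub (ev.isPrim_velocity t)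
    · have h := ((ev.continuous_nf 0).tendsto t).neg.sub_const (-nf (ev.f t) 0)
      rwa [sub_self] at h
    · have h := (ev.continuous_A'.tendsto t).sub_const (ev.A' t)
      rwa [sub_self] at h

theorem curve_zero {X₀ : ℝ → Plane} (h : MemH1 X₀) (ev : Evolution (deriv X₀)) :
    ev.curve (X₀ 0) 0 = X₀ := funext fun u => by
  have e : ev.f 0 = deriv X₀ := funext fun u => by rw [ev.f_eq, ev.Z_zero]; simp
  rw [curve, e, intervalIntegral.integral_same, sub_zero, ← h.isPrim.eq_add]

end Evolution

/-! ### Lipschitz dependence of the velocity in `L¹` -/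

section LipschitzVelocity

variable {f g : ℝ → Plane}

theorem PerInt.norm_qn_le_one (hf : PerInt f) (hl : 0 < len f) (u : ℝ) : ‖qn f u‖ ≤ 1 :=
  hf.norm_qf_le_one hl le_rfl u

/-- The derivative of the velocity of a curve with derivative `f`. -/
def velDeriv (f : ℝ → Plane) (u : ℝ) : Plane := ‖f u‖ • qn f u - f u

theorem PerInt.velDeriv (hf : PerInt f) : PerInt (velDeriv f) :=
  ⟨fun u => by simp only [H1CSF.velDeriv, hf.periodic u, hf.qn_periodic u],
    (hf.integrable.norm.smul_continuousOn hf.qn_continuous.continuousOn).sub hf.integrable⟩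

/-- The difference splits into a change of `‖f‖`, a change of `q`, and a change of `f`. The first
and last are bounded pointwise by `‖f - g‖` because `|q| ≤ 1`; the middle one uses the uniform `L¹`
estimate of the convolution. -/
theorem exists_len_velDeriv_sub_le {a b : ℝ} (ha : 0 < a) :
    ∃ K : ℝ, 0 ≤ K ∧ ∀ f g : ℝ → Plane, PerInt f → PerInt g → a ≤ len f → a ≤ len g → len f ≤ b →
      len g ≤ b → len (fun u => velDeriv f u - velDeriv g u) ≤ K * len (fun u => f u - g u) := by
  set c := 1 + 1 / Real.sinh (a / 2)
  have hs := sinh_half_pos ha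
  have hc : 0 < c := by positivity
  set k := 1 / Real.sinh (a / 2) ^ 2
  have hk : 0 < k := by positivity
  set N := (1 + |b|) * ((c + 1) * Real.cosh |b|)
  have hN : 0 ≤ N := by have := Real.cosh_pos |b|; positivity
  refine ⟨2 + N * (1 + k) * |b|, by positivity, fun f g hf hg hfa hga hfb hgb => ?_⟩
  set δ := len fun u => f u - g u
  have hlf : 0 < len f := ha.trans_le hfa
  have hlg : 0 < len g := ha.trans_le hga
  have hq : ∀ u, ‖qn f u - qn g u‖ ≤ N * ((1 + k) * δ) := fun u => by
    have hCc : |cothHalf (len f)| ≤ c := by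
      rw [abs_of_nonneg (cothHalf_nonneg hlf)]
      exact cothHalf_le ha hfa
    refine (hf.norm_qf_sub_le hg hCc (hfb.trans (le_abs_self b)) (hgb.trans (le_abs_self b))
      u).trans ?_
    have h1 : |cothHalf (len f) - cothHalf (len g)| ≤ k * δ :=
      (abs_cothHalf_sub_le ha hfa hga).trans (by gcongr; exact hf.abs_len_sub_le hg)
    change N * _ ≤ _
    gcongr
    linarith
  have hpt : ∀ u, ‖velDeriv f u - velDeriv g u‖ ≤
      2 * ‖f u - g u‖ + (N * ((1 + k) * δ)) * ‖g u‖ := fun u => by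
    have e : velDeriv f u - velDeriv g u = (‖f u‖ - ‖g u‖) • qn f u +
        ‖g u‖ • (qn f u - qn g u) - (f u - g u) := by
      simp only [velDeriv]; module
    rw [e]
    refine (norm_sub_le _ _).trans ?_
    have h1 : ‖(‖f u‖ - ‖g u‖) • qn f u‖ ≤ ‖f u - g u‖ * 1 := by
      rw [norm_smul]
      gcongr
      · exact abs_norm_sub_norm_le _ _
      · exact hf.norm_qn_le_one hlf u
    have h2 : ‖‖g u‖ • (qn f u - qn g u)‖ ≤ ‖g u‖ * (N * ((1 + k) * δ)) := by
      rw [norm_smul, norm_norm]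
      gcongr
      exact hq u
    have := norm_add_le ((‖f u‖ - ‖g u‖) • qn f u) (‖g u‖ • (qn f u - qn g u))
    linarith
  have i1 := (hf.sub hg).integrable.norm.const_mul 2
  have i2 := hg.integrable.norm.const_mul (N * ((1 + k) * δ))
  have hδ : 0 ≤ δ := len_nonneg _
  calc _ ≤ ∫ u in (0 : ℝ)..1, (2 * ‖f u - g u‖ + (N * ((1 + k) * δ)) * ‖g u‖) :=
        intervalIntegral.integral_mono zero_le_one (hf.velDeriv.sub hg.velDeriv).integrable.norm
          (i1.add i2) hpt
    _ = 2 * δ + N * ((1 + k) * δ) * len g := by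
        rw [intervalIntegral.integral_add i1 i2, intervalIntegral.integral_const_mul,
          intervalIntegral.integral_const_mul]
        rfl
    _ ≤ 2 * δ + N * ((1 + k) * δ) * |b| := by
        gcongr
        exact hgb.trans (le_abs_self b)
    _ = _ := by ring

end LipschitzVelocity

/-! ### The space `H¹` and its comparison with `L¹` -/

section H1Space

variable {γ η : ℝ → Plane}

theorem MemH1.sub (h : MemH1 γ) (h' : MemH1 η) : MemH1 (fun u => γ u - η u) :=
  (h.isPrim.sub h'.isPrim).memH1 (fun u => by simp only [h.1 u, h'.1 u]) (h.2.1.sub h'.2.1)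

theorem MemH1.const_smul (h : MemH1 γ) (c : ℝ) : MemH1 (fun u => c • γ u) :=
  (h.isPrim.const_smul c).memH1 (fun u => by simp only [h.1 u]) (h.2.1.const_smul c)

theorem MemH1.ae_deriv_sub (h : MemH1 γ) (h' : MemH1 η) :
    ∀ᵐ u, deriv (fun u => γ u - η u) u = deriv γ u - deriv η u :=
  (h.isPrim.sub h'.isPrim).ae_deriv

theorem MemH1.ae_deriv_const_smul (h : MemH1 γ) (c : ℝ) :
    ∀ᵐ u, deriv (fun u => c • γ u) u = c • deriv γ u :=
  (h.isPrim.const_smul c).ae_deriv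

theorem sq_integral_le {φ : ℝ → ℝ} (h1 : IntervalIntegrable φ volume 0 1)
    (h2 : IntervalIntegrable (fun u => φ u ^ 2) volume 0 1) :
    (∫ u in (0 : ℝ)..1, φ u) ^ 2 ≤ ∫ u in (0 : ℝ)..1, φ u ^ 2 := by
  set m := ∫ u in (0 : ℝ)..1, φ u
  have h := intervalIntegral.integral_nonneg (μ := volume) zero_le_one
    (fun u _ => sq_nonneg (φ u - m))
  have e : ∀ u, (φ u - m) ^ 2 = φ u ^ 2 - 2 * m * φ u + m ^ 2 := fun u => by ring
  simp only [e] at h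
  rw [intervalIntegral.integral_add (h2.sub (h1.const_mul _)) (by simp),
    intervalIntegral.integral_sub h2 (h1.const_mul _), intervalIntegral.integral_const_mul,
    intervalIntegral.integral_const] at h
  simp only [sub_zero, one_smul] at h
  nlinarith

theorem MemH1.integrable_norm_deriv_sq (h : MemH1 γ) :
    IntervalIntegrable (fun u => ‖deriv γ u‖ ^ 2) volume 0 1 := by
  rw [intervalIntegrable_iff_integrableOn_Ioc_of_le zero_le_one]
  exact h.2.1.integrable_norm_pow two_ne_zero

theorem MemH1.len_le_h1Norm (h : MemH1 γ) : len (deriv γ) ≤ h1Norm γ := by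
  refine Real.le_sqrt_of_sq_le ?_
  have h1 := sq_integral_le h.perInt.integrable.norm h.integrable_norm_deriv_sq
  have h2 : 0 ≤ ∫ u in (0 : ℝ)..1, ‖γ u‖ ^ 2 :=
    intervalIntegral.integral_nonneg zero_le_one fun u _ => by positivity
  rw [len]
  linarith

/-- The value at `0` is at most the mean of `‖γ‖` plus the length, and each of these is at most the
`H¹` norm by Cauchy-Schwarz. -/
theorem MemH1.norm_zero_le_h1Norm (h : MemH1 γ) : ‖γ 0‖ ≤ 2 * h1Norm γ := by
  have hc := h.isPrim.continuous
  have h1 : ∫ u in (0 : ℝ)..1, ‖γ u‖ ≤ h1Norm γ := by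
    refine Real.le_sqrt_of_sq_le ?_
    have h1 := sq_integral_le (hc.norm.intervalIntegrable _ _)
      ((hc.norm.pow 2).intervalIntegrable _ _)
    have h2 : 0 ≤ ∫ u in (0 : ℝ)..1, ‖deriv γ u‖ ^ 2 :=
      intervalIntegral.integral_nonneg zero_le_one fun u _ => by positivity
    linarith
  have h2 : ∀ u ∈ Set.Icc (0 : ℝ) 1, ‖γ 0‖ ≤ ‖γ u‖ + len (deriv γ) := fun u hu => by
    have e : γ 0 = γ u - (γ u - γ 0) := by abel
    rw [e]
    refine (norm_sub_le _ _).trans (add_le_add le_rfl ?_)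
    refine (h.isPrim.norm_sub_le 0 0 u).trans ?_
    change |arc _ _ - arc _ _| ≤ _
    have := h.perInt.arc_sub_mem (u := 0) (v := u) ⟨hu.1, by simpa using hu.2⟩
    rw [abs_of_nonneg this.1]
    exact this.2
  have h3 := intervalIntegral.integral_mono_on (μ := volume) zero_le_one
    (continuous_const.intervalIntegrable _ _)
    ((hc.norm.intervalIntegrable _ _).add (continuous_const.intervalIntegrable _ _)) h2
  rw [intervalIntegral.integral_add (hc.norm.intervalIntegrable _ _)
    (continuous_const.intervalIntegrable _ _)] at h3
  simp only [intervalIntegral.integral_const, sub_zero, one_smul] at h3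
  have := h.len_le_h1Norm
  linarith

theorem PerInt.integrable_Ioc {f : ℝ → Plane} (hf : PerInt f) :
    Integrable f (volume.restrict (Set.Ioc (0 : ℝ) 1)) := by
  have h := hf.integrable
  rwa [intervalIntegrable_iff_integrableOn_Ioc_of_le zero_le_one] at h

/-- The class of a periodic function in `L¹`. -/
def PerInt.toL1 {f : ℝ → Plane} (hf : PerInt f) :
    Lp Plane 1 (volume.restrict (Set.Ioc (0 : ℝ) 1)) := hf.integrable_Ioc.toL1 f

theorem PerInt.norm_toL1 {f : ℝ → Plane} (hf : PerInt f) : ‖hf.toL1‖ = len f := by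
  rw [PerInt.toL1, L1.norm_of_fun_eq_integral_norm, len, intervalIntegral.integral_of_le zero_le_one]

theorem PerInt.toL1_sub {f g : ℝ → Plane} (hf : PerInt f) (hg : PerInt g) :
    (hf.sub hg).toL1 = hf.toL1 - hg.toL1 := Integrable.toL1_sub _ _ _ _

theorem PerInt.toL1_smul {f : ℝ → Plane} (hf : PerInt f) (c : ℝ) :
    (hf.smul c).toL1 = c • hf.toL1 := Integrable.toL1_smul' f hf.integrable_Ioc c

end H1Space

/-! ### Uniqueness of the flow -/

namespace IsFlow

variable {X : ℝ → ℝ → Plane}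

theorem perInt (h : IsFlow X) (t : ℝ) : PerInt (deriv (X t)) := (h.mem t).perInt

theorem len_pos (h : IsFlow X) (t : ℝ) : 0 < len (deriv (X t)) := (h.mem t).len_pos (h.nonconstant t)

theorem velocity_eq (h : IsFlow X) (t : ℝ) : velocity (X t) = fun u => -nf (deriv (X t)) u :=
  funext fun u => (h.mem t).velocity_eq (h.len_pos t) u

theorem ae_deriv_velocity (h : IsFlow X) (t : ℝ) :
    ∀ᵐ u, deriv (velocity (X t)) u = velDeriv (deriv (X t)) u := by
  have h1 := ((h.perInt t).isPrim_nf (h.len_pos t)).const_smul (-1)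
  simp only [neg_smul, one_smul, neg_sub] at h1
  rw [h.velocity_eq t]
  exact h1.ae_deriv

theorem quotient_mem (h : IsFlow X) (t s : ℝ) :
    MemH1 (fun u => s⁻¹ • (X (t + s) u - X t u) - velocity (X t) u) :=
  (((h.mem (t + s)).sub (h.mem t)).const_smul s⁻¹).sub (h.velocity_mem t)

theorem hasDerivAt_zero (h : IsFlow X) (t : ℝ) : HasDerivAt (fun t => X t 0) (velocity (X t) 0) t := by
  rw [hasDerivAt_iff_tendsto_slope_zero, tendsto_iff_norm_sub_tendsto_zero]
  refine squeeze_zero (fun s => norm_nonneg _) (fun s => (h.quotient_mem t s).norm_zero_le_h1Norm) ?_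
  simpa using (h.hasDeriv t).const_mul 2

theorem hasDerivAt_toL1 (h : IsFlow X) (t : ℝ) :
    HasDerivAt (fun t => (h.perInt t).toL1) (h.perInt t).velDeriv.toL1 t := by
  rw [hasDerivAt_iff_tendsto_slope_zero, tendsto_iff_norm_sub_tendsto_zero]
  refine squeeze_zero (fun s => norm_nonneg _) (fun s => ?_) (h.hasDeriv t)
  rw [← PerInt.toL1_sub, ← PerInt.toL1_smul, ← PerInt.toL1_sub, PerInt.norm_toL1]
  refine le_trans (le_of_eq (len_congr_ae ?_)) (h.quotient_mem t s).len_le_h1Norm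
  filter_upwards [h.ae_deriv_velocity t, (h.mem (t + s)).ae_deriv_sub (h.mem t),
    ((h.mem (t + s)).sub (h.mem t)).ae_deriv_const_smul s⁻¹,
    (((h.mem (t + s)).sub (h.mem t)).const_smul s⁻¹).ae_deriv_sub (h.velocity_mem t)]
    with u h1 h2 h3 h4
  rw [h4, h3, h2, h1]

theorem continuous_len (h : IsFlow X) : Continuous fun t => len (deriv (X t)) := by
  have : Continuous fun t => (h.perInt t).toL1 :=
    continuous_iff_continuousAt.2 fun t => (h.hasDerivAt_toL1 t).continuousAt
  simpa only [PerInt.norm_toL1] using this.norm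

theorem exists_len_bounds (h : IsFlow X) (T : ℝ) : ∃ a b : ℝ, 0 < a ∧ ∀ t ∈ Set.Icc (-T) T,
    a ≤ len (deriv (X t)) ∧ len (deriv (X t)) ≤ b := by
  rcases (Set.Icc (-T) T).eq_empty_or_nonempty with he | hne
  · exact ⟨1, 1, one_pos, by simp [he]⟩
  obtain ⟨s, -, hs⟩ := isCompact_Icc.exists_isMinOn hne h.continuous_len.continuousOn
  obtain ⟨r, -, hr⟩ := isCompact_Icc.exists_isMaxOn hne h.continuous_len.continuousOn
  exact ⟨_, _, h.len_pos s, fun t ht => ⟨hs ht, hr ht⟩⟩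

/-- Gronwall for the difference of the derivatives as a curve in `L¹`. On a compact time interval
both lengths lie between positive bounds, so the velocity is Lipschitz there; negative times are
handled by reversing time. -/
theorem len_deriv_sub (h : IsFlow X) {X' : ℝ → ℝ → Plane} (h' : IsFlow X') (h0 : X' 0 = X 0) (t : ℝ) :
    len (fun u => deriv (X t) u - deriv (X' t) u) = 0 := by
  set δ : ℝ → Lp Plane 1 (volume.restrict (Set.Ioc (0 : ℝ) 1)) := fun t =>
    (h.perInt t).toL1 - (h'.perInt t).toL1 with hδ
  set δ' : ℝ → Lp Plane 1 (volume.restrict (Set.Ioc (0 : ℝ) 1)) := fun t =>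
    (h.perInt t).velDeriv.toL1 - (h'.perInt t).velDeriv.toL1 with hδ'
  have hd : ∀ t, HasDerivAt δ (δ' t) t := fun t => (h.hasDerivAt_toL1 t).sub (h'.hasDerivAt_toL1 t)
  have hδn : ∀ t, ‖δ t‖ = len (fun u => deriv (X t) u - deriv (X' t) u) := fun t => by
    change ‖_ - _‖ = _
    rw [← PerInt.toL1_sub, PerInt.norm_toL1]
  have hz : δ 0 = 0 := by
    rw [← norm_eq_zero, hδn, h0]
    simp [len]
  obtain ⟨a, b, ha, hab⟩ := h.exists_len_bounds |t|
  obtain ⟨a', b', ha', hab'⟩ := h'.exists_len_bounds |t|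
  obtain ⟨K, hK0, hK⟩ := exists_len_velDeriv_sub_le (a := min a a') (b := max b b') (lt_min ha ha')
  have hb : ∀ s ∈ Set.Icc (-|t|) |t|, ‖δ' s‖ ≤ K * ‖δ s‖ := fun s hs => by
    rw [hδn]
    change ‖_ - _‖ ≤ _
    rw [← PerInt.toL1_sub, PerInt.norm_toL1]
    exact hK _ _ (h.perInt s) (h'.perInt s) ((min_le_left _ _).trans (hab s hs).1)
      ((min_le_right _ _).trans (hab' s hs).1) ((hab s hs).2.trans (le_max_left _ _))
      ((hab' s hs).2.trans (le_max_right _ _))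
  rw [← hδn, norm_eq_zero]
  rcases le_total 0 t with ht | ht
  · rw [abs_of_nonneg ht] at hb
    exact eq_zero_of_abs_deriv_le_mul_abs_self_of_eq_zero_right (K := K) (a := 0) (b := t)
      (fun s _ => (hd s).continuousAt.continuousWithinAt)
      (fun s _ => (hd s).hasDerivWithinAt) hz
      (fun s hs => hb s ⟨by linarith [hs.1], hs.2.le⟩) t ⟨ht, le_rfl⟩
  · rw [abs_of_nonpos ht] at hb
    have hd2 : ∀ s, HasDerivAt (fun s => δ (-s)) (-δ' (-s)) s := fun s => by
      have := (hd (-s)).scomp s (hasDerivAt_neg s)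
      rw [neg_one_smul] at this
      exact this
    have := eq_zero_of_abs_deriv_le_mul_abs_self_of_eq_zero_right (f := fun s => δ (-s))
      (f' := fun s => -δ' (-s)) (K := K) (a := 0) (b := -t)
      (fun s _ => (hd2 s).continuousAt.continuousWithinAt)
      (fun s _ => (hd2 s).hasDerivWithinAt) (by simpa using hz)
      (fun s hs => by
        rw [norm_neg]
        exact hb (-s) ⟨by linarith [hs.2], by linarith [hs.1]⟩) (-t) ⟨by linarith, le_rfl⟩
    simpa using this

theorem unique (h : IsFlow X) {X' : ℝ → ℝ → Plane} (h' : IsFlow X') (h0 : X' 0 = X 0) : X' = X := by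
  -- A difference of zero length is constant, so the pointwise derivatives agree everywhere and not
  -- only almost everywhere. The velocities then coincide, which also determines the base points.
  have hae : ∀ t, deriv (X' t) = deriv (X t) := fun t => by
    have h1 := h.len_deriv_sub h' h0 t
    rw [← len_congr_ae ((h.mem t).ae_deriv_sub (h'.mem t))] at h1
    obtain ⟨p, hp⟩ : IsConstantMap (fun u => X t u - X' t u) := by
      by_contra hn
      exact (((h.mem t).sub (h'.mem t)).len_pos hn).ne' h1
    have e : X t = fun u => X' t u + p := funext fun u => by
      rw [← hp u, add_sub_cancel]
    rw [e]
    funext u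
    exact (deriv_add_const (f := X' t) p).symm
  have hb : ∀ t, X' t 0 = X t 0 := fun t => by
    have hd : ∀ t, HasDerivAt (fun t => X' t 0 - X t 0) 0 t := fun t => by
      refine ((h'.hasDerivAt_zero t).sub (h.hasDerivAt_zero t)).congr_deriv ?_
      rw [h.velocity_eq, h'.velocity_eq, hae t, sub_self]
    have h1 := is_const_of_deriv_eq_zero (fun t => (hd t).differentiableAt)
      (fun t => (hd t).deriv) t 0
    simp only [h0, sub_self] at h1
    exact sub_eq_zero.1 h1
  funext t u
  rw [(h'.mem t).isPrim.eq_add 0 u, (h.mem t).isPrim.eq_add 0 u, hb t,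
    hae t]

end IsFlow

/-! ### Double integrals over pairs of points of the circle -/

section DoubleIntegrals

open Set

/-- The integral of `H` over `{(u, v) | 0 < u ≤ 1, u < v ≤ u + 1}`. -/
def dbl (H : ℝ → ℝ → ℝ) : ℝ :=
  ∫ z : ℝ × ℝ, H z.1 (z.1 + z.2)
    ∂((volume.restrict (Ioc (0 : ℝ) 1)).prod (volume.restrict (Ioc (0 : ℝ) 1)))

/-- Integrability over `{(u, v) | 0 < u ≤ 1, u < v ≤ u + 1}`. -/
def DblInt (H : ℝ → ℝ → ℝ) : Prop :=
  Integrable (fun z : ℝ × ℝ => H z.1 (z.1 + z.2))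
    ((volume.restrict (Ioc (0 : ℝ) 1)).prod (volume.restrict (Ioc (0 : ℝ) 1)))

variable {H K : ℝ → ℝ → ℝ}

theorem DblInt.add (hH : DblInt H) (hK : DblInt K) : DblInt (fun u v => H u v + K u v) :=
  Integrable.add hH hK

theorem DblInt.sub (hH : DblInt H) (hK : DblInt K) : DblInt (fun u v => H u v - K u v) :=
  Integrable.sub hH hK

theorem dbl_add (hH : DblInt H) (hK : DblInt K) :
    dbl (fun u v => H u v + K u v) = dbl H + dbl K := integral_add hH hK

theorem dbl_sub (hH : DblInt H) (hK : DblInt K) :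
    dbl (fun u v => H u v - K u v) = dbl H - dbl K := integral_sub hH hK

theorem dbl_nonpos (h : ∀ u v, u ≤ v → v ≤ u + 1 → H u v ≤ 0) : dbl H ≤ 0 := by
  rw [dbl, Measure.prod_restrict]
  refine setIntegral_nonpos (measurableSet_Ioc.prod measurableSet_Ioc) fun z hz => ?_
  exact h _ _ (by linarith [hz.2.1]) (by linarith [hz.2.2])

theorem dbl_eq' (hH : DblInt H) :
    dbl H = ∫ u in (0 : ℝ)..1, ∫ s in (0 : ℝ)..1, H u (u + s) := by
  rw [dbl, integral_prod _ hH]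
  simp only [intervalIntegral.integral_of_le zero_le_one]

theorem dbl_eq (hH : DblInt H) : dbl H = ∫ u in (0 : ℝ)..1, ∫ v in u..(u + 1), H u v := by
  rw [dbl_eq' hH]
  refine intervalIntegral.integral_congr fun u _ => ?_
  have h := intervalIntegral.integral_comp_add_left (a := 0) (b := 1) (H u) u
  rw [add_zero] at h
  exact h

/-- The map `(u, v) ↦ (v, u + 1)` exchanges the two points of a pair and, up to a common period
shift, preserves the fundamental domain. With `v = u + s` it amounts to `s ↦ 1 - s` after a
translation in `u`. -/
theorem dbl_swap (hH : DblInt H) (hK : DblInt (fun u v => H v (u + 1)))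
    (hp : ∀ u v, H (u + 1) (v + 1) = H u v) : dbl (fun u v => H v (u + 1)) = dbl H := by
  have e1 : dbl H = ∫ s in (0 : ℝ)..1, ∫ u in (0 : ℝ)..1, H u (u + s) := by
    rw [dbl_eq' hH]
    simp only [intervalIntegral.integral_of_le zero_le_one]
    exact integral_integral_swap hH
  have e2 : dbl (fun u v => H v (u + 1)) =
      ∫ s in (0 : ℝ)..1, ∫ u in (0 : ℝ)..1, H (u + s) (u + 1) := by
    rw [dbl_eq' hK]
    simp only [intervalIntegral.integral_of_le zero_le_one]
    exact integral_integral_swap hK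
  have e3 : ∀ s, ∫ u in (0 : ℝ)..1, H (u + s) (u + 1) =
      ∫ u in (0 : ℝ)..1, H u (u + (1 - s)) := fun s => by
    have hper : Function.Periodic (fun u => H u (u + (1 - s))) 1 := fun u => by
      have := hp u (u + (1 - s))
      rwa [add_right_comm] at this
    have h1 := intervalIntegral.integral_comp_add_right (a := 0) (b := 1)
      (fun u => H u (u + (1 - s))) s
    have h2 := hper.intervalIntegral_add_eq s 0
    rw [zero_add, add_comm 1 s, h2, zero_add] at h1
    rw [← h1]
    refine intervalIntegral.integral_congr fun u _ => ?_
    congr 1; ring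
  rw [e1, e2]
  simp only [e3]
  have h := intervalIntegral.integral_comp_sub_left (a := 0) (b := 1)
    (fun s => ∫ u in (0 : ℝ)..1, H u (u + s)) 1
  simpa using h

/-- The shear `(u, s) ↦ (u, u + s)` preserves the measure, so a product of integrable functions
stays integrable; a continuous kernel is bounded on the compact domain. -/
theorem dblInt_mul {a b : ℝ → ℝ} {k : ℝ → ℝ → ℝ} (ha : ∀ x y, IntervalIntegrable a volume x y)
    (hb : ∀ x y, IntervalIntegrable b volume x y) (hk : Continuous fun z : ℝ × ℝ => k z.1 z.2) :
    DblInt (fun u v => k u v * (a u * b v)) := by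
  obtain ⟨C, hC⟩ := (isCompact_Icc (a := ((0 : ℝ), (0 : ℝ))) (b := (1, 1))).exists_bound_of_continuousOn
    (f := fun z : ℝ × ℝ => k z.1 (z.1 + z.2))
    (hk.comp (continuous_fst.prodMk (continuous_fst.add continuous_snd))).continuousOn
  have hm : ∀ᵐ z ∂((volume.restrict (Ioc (0 : ℝ) 1)).prod (volume.restrict (Ioc (0 : ℝ) 1))),
      z ∈ Ioc (0 : ℝ) 1 ×ˢ Ioc (0 : ℝ) 1 := by
    rw [Measure.prod_restrict]
    exact ae_restrict_mem (measurableSet_Ioc.prod measurableSet_Ioc)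
  refine Integrable.bdd_mul (c := C) ?_
    (hk.comp (continuous_fst.prodMk (continuous_fst.add continuous_snd))).aestronglyMeasurable ?_
  · have ia : Integrable (indicator (Ioc 0 1) a) volume := by
      have := ha 0 1
      rw [intervalIntegrable_iff_integrableOn_Ioc_of_le zero_le_one] at this
      exact this.integrable_indicator measurableSet_Ioc
    -- The second point `u + s` ranges over `(0, 2]`.
    have ib : Integrable (indicator (Ioc 0 2) b) volume := by
      have := hb 0 2
      rw [intervalIntegrable_iff_integrableOn_Ioc_of_le zero_le_two] at this
      exact this.integrable_indicator measurableSet_Ioc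
    have h := (measurePreserving_prod_add (volume : Measure ℝ)
      (volume : Measure ℝ)).integrable_comp_of_integrable (ia.mul_prod ib)
    have h' := h.integrableOn (s := Ioc (0 : ℝ) 1 ×ˢ Ioc (0 : ℝ) 1)
    rw [IntegrableOn, ← Measure.prod_restrict] at h'
    refine h'.congr ?_
    filter_upwards [hm] with z hz
    simp only [Function.comp]
    rw [indicator_of_mem hz.1, indicator_of_mem]
    exact ⟨by linarith [hz.1.1, hz.2.1], by linarith [hz.1.2, hz.2.2]⟩
  · filter_upwards [hm] with z hz
    exact hC z ⟨⟨hz.1.1.le, hz.2.1.le⟩, ⟨hz.1.2, hz.2.2⟩⟩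

theorem DblInt.congr (hH : DblInt H) (h : ∀ u v, H u v = K u v) : DblInt K := by
  rwa [show K = H from funext fun u => funext fun v => (h u v).symm]

variable {f : ℝ → Plane}

theorem PerInt.intervalIntegrable_coord (hf : PerInt f) (i : Fin 2) (a b : ℝ) :
    IntervalIntegrable (fun u => f u i) volume a b := by
  have h := hf.intervalIntegrable a b
  rw [intervalIntegrable_iff] at h ⊢
  exact (EuclideanSpace.proj (𝕜 := ℝ) (ι := Fin 2) i).integrable_comp h

theorem inner_plane (x y : Plane) : inner ℝ x y = x 0 * y 0 + x 1 * y 1 := by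
  rw [PiLp.inner_apply, Fin.sum_univ_two]
  simp [mul_comm]

theorem PerInt.dblInt_norm (hf : PerInt f) {k : ℝ → ℝ → ℝ}
    (hk : Continuous fun z : ℝ × ℝ => k z.1 z.2) :
    DblInt (fun u v => k u v * (‖f u‖ * ‖f v‖)) :=
  dblInt_mul (fun a b => (hf.intervalIntegrable a b).norm)
    (fun a b => (hf.intervalIntegrable a b).norm) hk

theorem continuous_coord {X : Type*} [TopologicalSpace X] {k : X → Plane} (hk : Continuous k)
    (i : Fin 2) : Continuous fun x => k x i :=
  (EuclideanSpace.proj (𝕜 := ℝ) (ι := Fin 2) i).continuous.comp hk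

theorem PerInt.dblInt_inner (hf : PerInt f) {k : ℝ → ℝ → Plane}
    (hk : Continuous fun z : ℝ × ℝ => k z.1 z.2) :
    DblInt (fun u v => inner ℝ (f u) (k u v) * ‖f v‖) := by
  have h := fun i => dblInt_mul (hf.intervalIntegrable_coord i)
    (fun a b => (hf.intervalIntegrable a b).norm) (k := fun u v => k u v i) (continuous_coord hk i)
  refine ((h 0).add (h 1)).congr fun u v => ?_
  rw [inner_plane]; ring

theorem PerInt.dblInt_inner' (hf : PerInt f) {k : ℝ → ℝ → Plane}
    (hk : Continuous fun z : ℝ × ℝ => k z.1 z.2) :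
    DblInt (fun u v => inner ℝ (f v) (k u v) * ‖f u‖) := by
  have h := fun i => dblInt_mul (fun a b => (hf.intervalIntegrable a b).norm)
    (hf.intervalIntegrable_coord i) (k := fun u v => k u v i) (continuous_coord hk i)
  refine ((h 0).add (h 1)).congr fun u v => ?_
  rw [inner_plane]; ring

end DoubleIntegrals

/-! ### The weighted length -/

section Lyapunov

variable {f γ : ℝ → Plane}

/-- The weight of the weighted length. -/
def wt (x : Plane) : ℝ := Real.exp (2 * ‖x‖ ^ 2)

theorem wt_pos (x : Plane) : 0 < wt x := Real.exp_pos _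

theorem one_le_wt (x : Plane) : 1 ≤ wt x := Real.one_le_exp (by positivity)

theorem continuous_wt : Continuous wt := by unfold wt; fun_prop

theorem wt_sub_le (x y : Plane) : wt y - wt x ≤ wt y * (2 * (‖y‖ ^ 2 - ‖x‖ ^ 2)) := by
  have h : wt x = wt y * Real.exp (-(2 * (‖y‖ ^ 2 - ‖x‖ ^ 2))) := by
    rw [wt, wt, ← Real.exp_add]; congr 1; ring
  have h2 := Real.add_one_le_exp (-(2 * (‖y‖ ^ 2 - ‖x‖ ^ 2)))
  have := mul_le_mul_of_nonneg_left h2 (wt_pos y).le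
  rw [← h] at this
  linarith

/-- With `P` the sum of the weights, `d = ‖y - x‖`, `D = ‖y‖² - ‖x‖²` and `R` the absolute
difference of the weights, the two inner products add up to `-2 P d² - 2 R |D|`. Convexity of the
exponential gives `R ≤ 2 P |D|`, and Young's inequality then gives `2 R d ≤ P d² + 2 R |D|`. The
total is at most `-P d² / 2`. -/
theorem weight_inequality (x y : Plane) :
    inner ℝ ((4 * wt x) • x) (y - x) + inner ℝ ((4 * wt y) • y) (x - y) +
      (wt x + wt y) / 2 * ‖y - x‖ ^ 2 + 2 * (|wt y - wt x| * ‖y - x‖) ≤ 0 := by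
  set P := wt x + wt y
  set D := ‖y‖ ^ 2 - ‖x‖ ^ 2 with hD
  set d := ‖y - x‖
  have hx := wt_pos x
  have hy := wt_pos y
  have hP : 0 < P := add_pos hx hy
  have e1 : inner ℝ ((4 * wt x) • x) (y - x) + inner ℝ ((4 * wt y) • y) (x - y) =
      -2 * P * d ^ 2 - 2 * ((wt y - wt x) * D) := by
    have h1 : d ^ 2 = ‖y‖ ^ 2 - 2 * inner ℝ y x + ‖x‖ ^ 2 := norm_sub_sq_real y x
    have h2 := real_inner_comm x y
    simp only [inner_smul_left, inner_sub_right, real_inner_self_eq_norm_sq, RCLike.conj_to_real]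
    rw [h1, hD, ← h2]
    simp only [P]
    ring
  set R := |wt y - wt x|
  -- The weight is increasing in the norm, so both factors have the same sign.
  have hRD : (wt y - wt x) * D = R * |D| := by
    rw [← abs_mul]
    refine (abs_of_nonneg ?_).symm
    rcases le_total (‖x‖ ^ 2) (‖y‖ ^ 2) with h | h
    · refine mul_nonneg (sub_nonneg.2 (Real.exp_le_exp.2 (by linarith))) (sub_nonneg.2 h)
    · refine mul_nonneg_of_nonpos_of_nonpos (sub_nonpos.2 (Real.exp_le_exp.2 (by linarith)))
        (sub_nonpos.2 h)
  have hR : R ≤ P * (2 * |D|) := by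
    have a1 := wt_sub_le x y
    have a2 := wt_sub_le y x
    have a3 : D ≤ |D| := le_abs_self D
    have a4 : -D ≤ |D| := neg_le_abs D
    have a5 := abs_nonneg D
    refine abs_le.2 ⟨?_, ?_⟩
    · have : wt x * (2 * (‖x‖ ^ 2 - ‖y‖ ^ 2)) ≤ wt x * (2 * |D|) := by
        gcongr; linarith
      have : wt x * (2 * |D|) ≤ P * (2 * |D|) := by gcongr; simp only [P]; linarith
      linarith
    · have : wt y * (2 * (‖y‖ ^ 2 - ‖x‖ ^ 2)) ≤ wt y * (2 * |D|) := by gcongr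
      have : wt y * (2 * |D|) ≤ P * (2 * |D|) := by gcongr; simp only [P]; linarith
      linarith
  have hR0 : 0 ≤ R := abs_nonneg _
  rw [e1, hRD]
  have h3 : R * R ≤ P * (2 * (R * |D|)) := by nlinarith
  -- Young's inequality multiplied by `P`, which avoids dividing by the weights.
  have h4 : 2 * P * (R * d) ≤ P * (P * d ^ 2) + R * R := by nlinarith [sq_nonneg (P * d - R)]
  have h5 : 2 * (R * d) ≤ P * d ^ 2 + 2 * (R * |D|) := by
    refine le_of_mul_le_mul_left ?_ hP
    linarith
  have h6 : 0 ≤ P * d ^ 2 := by positivity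
  linarith

theorem IsPrim.norm_sub_sq (h : IsPrim γ f) (c : Plane) :
    IsPrim (fun v => ‖γ v - c‖ ^ 2) (fun v => 2 * inner ℝ (γ v - c) (f v)) :=
  h.comp' (φ := fun x => ‖x - c‖ ^ 2) ((contDiff_id.sub contDiff_const).norm_sq ℝ)
    fun u d hd he => by rw [he]; exact (hd.sub_const c).norm_sq

/-- Both terms become double integrals: `-nf` averages `γ v - γ u` against the kernel, and `q` is
minus its integral against the derivative of the kernel. If the weight at `u` in the second term is
replaced by the weight at `v`, an integration by parts turns it into the kernel times half the
weighted squared chord. The error of this replacement is bounded by `|kerD| ≤ ker` times the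
difference of the weights. After symmetrizing in the two points the integrand has a sign by
`weight_inequality`. -/
theorem weighted_length_inequality (hf : PerInt f) (hl : 0 < len f) (h : IsPrim γ f)
    (hp : Function.Periodic γ 1) :
    ∫ u in (0 : ℝ)..1, (inner ℝ ((4 * wt (γ u)) • γ u) (-nf f u) * ‖f u‖ +
      wt (γ u) * inner ℝ (f u) (qn f u)) ≤ 0 := by
  set C := cothHalf (len f) with hC
  set S := arc f
  have hS : Continuous S := hf.continuous_arc
  have hγ : Continuous γ := h.continuous
  have hk := continuous_ker C
  have hk' := continuous_kerD C
  have hw := continuous_wt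
  set k1 : ℝ → ℝ → ℝ := fun u v =>
    ker C (S v - S u) * inner ℝ ((4 * wt (γ u)) • γ u) (γ v - γ u) with hk1
  set k4 : ℝ → ℝ → ℝ := fun u v => ker C (S v - S u) * (wt (γ u) * (‖γ v - γ u‖ ^ 2 / 2)) with hk4
  set m2 : ℝ → ℝ → Plane := fun u v => (-kerD C (S v - S u) * wt (γ u)) • (γ v - γ u) with hm2
  set m3 : ℝ → ℝ → Plane := fun u v => (-kerD C (S v - S u) * wt (γ v)) • (γ v - γ u) with hm3
  have ck1 : Continuous fun z : ℝ × ℝ => k1 z.1 z.2 := by simp only [hk1]; fun_prop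
  have ck4 : Continuous fun z : ℝ × ℝ => k4 z.1 z.2 := by simp only [hk4]; fun_prop
  have cm2 : Continuous fun z : ℝ × ℝ => m2 z.1 z.2 := by simp only [hm2]; fun_prop
  have cm3 : Continuous fun z : ℝ × ℝ => m3 z.1 z.2 := by simp only [hm3]; fun_prop
  have cm3s : Continuous fun z : ℝ × ℝ => m3 z.2 (z.1 + 1) := by simp only [hm3]; fun_prop
  have c14 : Continuous fun z : ℝ × ℝ => k1 z.1 z.2 + k4 z.1 z.2 := ck1.add ck4
  have c14s : Continuous fun z : ℝ × ℝ => k1 z.2 (z.1 + 1) + k4 z.2 (z.1 + 1) := by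
    simp only [hk1, hk4]; fun_prop
  have i1 := hf.dblInt_norm ck1
  have i4 := hf.dblInt_norm ck4
  have i2 := hf.dblInt_inner cm2
  have i3 := hf.dblInt_inner cm3
  have hfn : ∀ u, ‖f (u + 1)‖ = ‖f u‖ := hf.norm_periodic
  have i3s : DblInt (fun u v => inner ℝ (f v) (m3 v (u + 1)) * ‖f (u + 1)‖) := by
    simpa only [hfn] using hf.dblInt_inner' (k := fun u v => m3 v (u + 1)) cm3s
  have i14 := hf.dblInt_norm (k := fun u v => k1 u v + k4 u v) c14
  have i14s : DblInt (fun u v => (k1 v (u + 1) + k4 v (u + 1)) * (‖f v‖ * ‖f (u + 1)‖)) := by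
    have := hf.dblInt_norm (k := fun u v => k1 v (u + 1) + k4 v (u + 1)) c14s
    refine this.congr fun u v => ?_
    rw [hfn, mul_comm ‖f u‖]
  -- the first term
  have t1 : ∫ u in (0 : ℝ)..1, inner ℝ ((4 * wt (γ u)) • γ u) (-nf f u) * ‖f u‖ =
      dbl (fun u v => k1 u v * (‖f u‖ * ‖f v‖)) := by
    rw [dbl_eq i1]
    refine intervalIntegral.integral_congr fun u _ => ?_
    have i5 : IntervalIntegrable (fun v => ker C (S v - S u) * ‖f v‖) volume u (u + 1) :=
      (hf.intervalIntegrable _ _).norm.continuousOn_mul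
        (hk.comp (hS.sub continuous_const)).continuousOn
    -- The kernel has mass one, so `γ u` can be moved inside the integral.
    have e : -nf f u = ∫ v in u..(u + 1), (ker C (S v - S u) * ‖f v‖) • (γ v - γ u) := by
      have h1 := hf.integral_ker_smul hl h hp u
      have h2 := hf.integral_ker C u (u + 1)
      rw [hf.arc_add_one, add_sub_cancel_left, hC, kerD_self hl, kerD_zero] at h2
      simp only [smul_sub]
      rw [intervalIntegral.integral_sub (i5.smul_continuousOn hγ.continuousOn)
        (i5.smul_continuousOn continuousOn_const), h1, intervalIntegral.integral_smul_const, h2]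
      module
    have i6 : IntervalIntegrable (fun v => (ker C (S v - S u) * ‖f v‖) • (γ v - γ u)) volume
        u (u + 1) := i5.smul_continuousOn (hγ.sub continuous_const).continuousOn
    change inner ℝ ((4 * wt (γ u)) • γ u) (-nf f u) * ‖f u‖ = _
    have e2 := (innerSL ℝ ((4 * wt (γ u)) • γ u)).intervalIntegral_comp_comm i6
    rw [e, ← innerSL_apply_apply ℝ, ← e2, ← intervalIntegral.integral_mul_const]
    refine intervalIntegral.integral_congr fun v _ => ?_
    simp only [hk1, innerSL_apply_apply, inner_smul_right]
    ring
  -- the second term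
  have t2 : ∫ u in (0 : ℝ)..1, wt (γ u) * inner ℝ (f u) (qn f u) =
      dbl (fun u v => inner ℝ (f u) (m2 u v) * ‖f v‖) := by
    rw [dbl_eq i2]
    refine intervalIntegral.integral_congr fun u _ => ?_
    have i5 : IntervalIntegrable (fun v => kerD C (S v - S u) * ‖f v‖) volume u (u + 1) :=
      (hf.intervalIntegrable _ _).norm.continuousOn_mul
        (hk'.comp (hS.sub continuous_const)).continuousOn
    have i6 : IntervalIntegrable (fun v => (kerD C (S v - S u) * ‖f v‖) • (γ v - γ u)) volume
        u (u + 1) := i5.smul_continuousOn (hγ.sub continuous_const).continuousOn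
    -- By parts with the primitive `γ v - γ u` of `f v`, which vanishes at both ends of the period.
    have e : qn f u = -∫ v in u..(u + 1), (kerD C (S v - S u) * ‖f v‖) • (γ v - γ u) := by
      have hprod := ((hf.isPrim_arc.add_const (-S u)).scomp
        (fun d => hasDerivAt_ker C d) hk').smul (h.add_const (-γ u))
      have h1 := hprod.sub_eq u (u + 1)
      simp only [← sub_eq_add_neg] at h1
      rw [hp, sub_self, smul_zero, smul_zero, sub_zero, intervalIntegral.integral_add
        (by
          refine i6.congr_ae (Eventually.of_forall fun v => ?_)
          simp only [smul_eq_mul, mul_comm]; rfl)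
        (hf.qf_integrable C u u (u + 1))] at h1
      rw [qn, qf, eq_neg_iff_add_eq_zero, add_comm]
      refine Eq.trans ?_ h1.symm
      congr 1
      refine intervalIntegral.integral_congr fun v _ => ?_
      simp only [smul_eq_mul, mul_comm]; rfl
    change wt (γ u) * inner ℝ (f u) (qn f u) = _
    have e2 := (innerSL ℝ (f u)).intervalIntegral_comp_comm i6
    rw [e, inner_neg_right, ← innerSL_apply_apply ℝ, ← e2, ← intervalIntegral.integral_neg,
      ← intervalIntegral.integral_const_mul]
    refine intervalIntegral.integral_congr fun v _ => ?_
    simp only [hm2, innerSL_apply_apply, inner_smul_right]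
    ring
  -- the third term
  have t3 : dbl (fun u v => inner ℝ (f u) (m3 u v) * ‖f v‖) =
      dbl (fun u v => k4 u v * (‖f u‖ * ‖f v‖)) := by
    rw [← dbl_swap i3 i3s fun u v => by
      simp only [hm3, S, hf.arc_add_one, hp _, hf.periodic _, add_sub_add_right_eq_sub],
      dbl_eq i3s, dbl_eq i4]
    refine intervalIntegral.integral_congr fun u _ => ?_
    have hprod := ((hf.isPrim_arc.add_const (-S u)).scomp
        (fun d => hasDerivAt_kerD C d) hk).smul (h.norm_sub_sq (γ u))
    have h1 := hprod.sub_eq u (u + 1)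
    have i5 : IntervalIntegrable (fun v => (‖f v‖ • ker C (S v - S u)) • ‖γ v - γ u‖ ^ 2) volume
        u (u + 1) := by
      have : IntervalIntegrable (fun v => ‖f v‖ • ker C (S v - S u)) volume u (u + 1) :=
        (hf.intervalIntegrable _ _).norm.smul_continuousOn
          (hk.comp (hS.sub continuous_const)).continuousOn
      exact this.smul_continuousOn ((hγ.sub continuous_const).norm.pow 2).continuousOn
    have i6 : IntervalIntegrable (fun v => kerD C (S v - S u) •
        (2 * inner ℝ (γ v - γ u) (f v))) volume u (u + 1) :=
      ((h.norm_sub_sq (γ u)).integrable u (u + 1)).continuousOn_smul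
        (hk'.comp (hS.sub continuous_const)).continuousOn
    simp only [← sub_eq_add_neg] at h1
    rw [hp, sub_self, norm_zero, zero_pow two_ne_zero, smul_zero, smul_zero, sub_zero,
      intervalIntegral.integral_add i5 i6] at h1
    have e1 : ∀ v, inner ℝ (f v) (m3 v (u + 1)) * ‖f (u + 1)‖ =
        (-(wt (γ u) * ‖f u‖) / 2) * (kerD C (S v - S u) • (2 * inner ℝ (γ v - γ u) (f v))) :=
      fun v => by
      -- Under the exchange of the two points the derivative of the kernel is odd, whereas the
      -- kernel is even.
      have hk2 : kerD C (S (u + 1) - S v) = -kerD C (S v - S u) := by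
        simp only [S]
        rw [hf.arc_add_one, hC, kerD_eq hl, kerD_eq hl, ← neg_div, ← Real.sinh_neg]
        congr 2; ring
      simp only [hm3, hk2, hp u, hfn, inner_smul_right, smul_eq_mul, ← neg_sub (γ v) (γ u),
        inner_neg_right, real_inner_comm (γ v - γ u) (f v), neg_neg]
      ring
    have e2 : ∀ v, k4 u v * (‖f u‖ * ‖f v‖) = (wt (γ u) * ‖f u‖ / 2) *
        ((‖f v‖ • ker C (S v - S u)) • ‖γ v - γ u‖ ^ 2) := fun v => by
      simp only [hk4, smul_eq_mul]; ring
    simp only [e1, e2, intervalIntegral.integral_const_mul]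
    have h2 := add_eq_zero_iff_eq_neg.1 h1.symm
    simp only [S] at h2 ⊢
    rw [h2]
    ring
  have t4 : dbl (fun u v => (k1 v (u + 1) + k4 v (u + 1)) * (‖f v‖ * ‖f (u + 1)‖)) =
      dbl (fun u v => (k1 u v + k4 u v) * (‖f u‖ * ‖f v‖)) :=
    dbl_swap i14 i14s fun u v => by
      simp only [hk1, hk4, S, hf.arc_add_one, hp _, hfn, add_sub_add_right_eq_sub]
  have j1 : IntervalIntegrable (fun u => inner ℝ ((4 * wt (γ u)) • γ u) (-nf f u) * ‖f u‖)
      volume 0 1 := by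
    have := hf.nf_continuous
    exact (hf.intervalIntegrable _ _).norm.continuousOn_mul (by fun_prop)
  have j2 : IntervalIntegrable (fun u => wt (γ u) * inner ℝ (f u) (qn f u)) volume 0 1 := by
    have hq := hf.qn_continuous
    have h0 := (hf.intervalIntegrable_coord 0 0 1).mul_continuousOn
      (continuous_coord hq 0).continuousOn
    have h1 := (hf.intervalIntegrable_coord 1 0 1).mul_continuousOn
      (continuous_coord hq 1).continuousOn
    simp only [inner_plane]
    exact (h0.add h1).continuousOn_mul (hw.comp hγ).continuousOn
  rw [intervalIntegral.integral_add j1 j2, t1, t2]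
  -- Twice the quantity to be estimated: the terms `k1 + k4` are symmetrized, and the weight
  -- replacement error `m2 - m3` is counted twice without symmetrization.
  have key := dbl_nonpos (H := fun u v => ((k1 u v + k4 u v) * (‖f u‖ * ‖f v‖) +
      (k1 v (u + 1) + k4 v (u + 1)) * (‖f v‖ * ‖f (u + 1)‖)) +
      ((inner ℝ (f u) (m2 u v) * ‖f v‖ - inner ℝ (f u) (m3 u v) * ‖f v‖) +
      (inner ℝ (f u) (m2 u v) * ‖f v‖ - inner ℝ (f u) (m3 u v) * ‖f v‖))) fun u v huv hvu => by
    have hks : ker C (S (u + 1) - S v) = ker C (S v - S u) := by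
      simp only [S]
      rw [hf.arc_add_one, hC, ← ker_symm hl]
      congr 1; ring
    set g := ker C (S v - S u)
    have hg : 0 < g := ker_pos hl _
    have hg' : |kerD C (S v - S u)| ≤ g := abs_kerD_le hl _
    have hin : inner ℝ (f u) (m2 u v) - inner ℝ (f u) (m3 u v) ≤
        g * (|wt (γ v) - wt (γ u)| * ‖γ v - γ u‖) * ‖f u‖ := by
      rw [← inner_sub_right]
      have e : m2 u v - m3 u v = (kerD C (S v - S u) * (wt (γ v) - wt (γ u))) • (γ v - γ u) := by
        simp only [hm2, hm3]; module
      rw [e]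
      refine (real_inner_le_norm _ _).trans ?_
      rw [norm_smul, Real.norm_eq_abs, abs_mul]
      calc _ ≤ ‖f u‖ * (g * |wt (γ v) - wt (γ u)| * ‖γ v - γ u‖) := by gcongr
        _ = _ := by ring
    have hwt := weight_inequality (γ u) (γ v)
    have hsum : k1 u v + k4 u v + (k1 v (u + 1) + k4 v (u + 1)) +
        2 * (g * (|wt (γ v) - wt (γ u)| * ‖γ v - γ u‖)) ≤ 0 := by
      simp only [hk1, hk4, hks, hp u]
      rw [norm_sub_rev (γ u) (γ v)]
      have := mul_nonpos_of_nonneg_of_nonpos hg.le hwt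
      refine le_trans (le_of_eq ?_) this
      ring
    have hn : 0 ≤ ‖f u‖ * ‖f v‖ := by positivity
    have h1 := mul_nonpos_of_nonpos_of_nonneg hsum hn
    have h2 := mul_le_mul_of_nonneg_right hin (norm_nonneg (f v))
    rw [hfn]
    nlinarith
  rw [dbl_add (i14.add i14s) ((i2.sub i3).add (i2.sub i3)), dbl_add i14 i14s,
    dbl_add (i2.sub i3) (i2.sub i3), dbl_sub i2 i3, t4, t3] at key
  have e14 : dbl (fun u v => (k1 u v + k4 u v) * (‖f u‖ * ‖f v‖)) =
      dbl (fun u v => k1 u v * (‖f u‖ * ‖f v‖)) + dbl (fun u v => k4 u v * (‖f u‖ * ‖f v‖)) := by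
    rw [← dbl_add i1 i4]
    simp only [add_mul]
  rw [e14] at key
  linarith

end Lyapunov

/-! ### Convergence for exponentially decaying generators -/

section Limits

variable {F : Type*} [NormedAddCommGroup F] [NormedSpace ℝ F]

/-- Comparison with an explicit barrier whose growth rate is integrable in time. Replacing `c` by `c
+ 1` and `‖x 0‖` by `‖x 0‖ + 1` makes the barrier positive and the differential inequality strict.
-/
theorem norm_le_of_norm_deriv_le_exp {x x' : ℝ → F} {c : ℝ} (hc : 0 ≤ c)
    (hx : ∀ t, HasDerivAt x (x' t) t)
    (hb : ∀ t, 0 ≤ t → ‖x' t‖ ≤ c * Real.exp (-2 * t) * ‖x t‖) {t : ℝ} (ht : 0 ≤ t) :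
    ‖x t‖ ≤ (‖x 0‖ + 1) * Real.exp (c + 1) := by
  set B : ℝ → ℝ := fun s => (‖x 0‖ + 1) * Real.exp ((c + 1) * (1 - Real.exp (-s)))
  have hB : ∀ s, HasDerivAt B ((c + 1) * Real.exp (-s) * B s) s := fun s => by
    have h := ((((hasDerivAt_neg s).exp.const_sub 1).const_mul (c + 1)).exp).const_mul (‖x 0‖ + 1)
    refine h.congr_deriv ?_
    simp only [B]; ring
  have h := image_norm_le_of_norm_deriv_right_lt_deriv_boundary (a := 0) (b := t)
    (fun s _ => (hx s).continuousAt.continuousWithinAt) (fun s _ => (hx s).hasDerivWithinAt)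
    (B := B) (by simp [B]) hB (fun s hs he => by
      have hBs : 0 < B s := by positivity
      refine (hb s hs.1).trans_lt ?_
      rw [he]
      have h1 : Real.exp (-2 * s) ≤ Real.exp (-s) := Real.exp_le_exp.2 (by linarith [hs.1])
      have h2 : c * Real.exp (-2 * s) < (c + 1) * Real.exp (-s) := by
        have := Real.exp_pos (-s)
        nlinarith
      exact mul_lt_mul_of_pos_right h2 hBs) (Set.right_mem_Icc.2 ht)
  refine h.trans ?_
  simp only [B]
  gcongr
  have := Real.exp_pos (-t)
  nlinarith

theorem exists_tendsto_of_norm_deriv_le_exp [CompleteSpace F] {x x' : ℝ → F} {c : ℝ} (hc : 0 ≤ c)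
    (hx : ∀ t, HasDerivAt x (x' t) t) (hx' : Continuous x')
    (hb : ∀ t, 0 ≤ t → ‖x' t‖ ≤ c * Real.exp (-2 * t) * ‖x t‖) :
    ∃ y, Tendsto x atTop (𝓝 y) := by
  refine ⟨_, tendsto_limUnder_of_hasDerivAt_of_integrableOn_Ioi (a := 0) (fun t _ => hx t) ?_⟩
  have h1 := (exp_neg_integrableOn_Ioi 0 two_pos).const_mul
    (c * ((‖x 0‖ + 1) * Real.exp (c + 1)))
  refine Integrable.mono' h1 hx'.aestronglyMeasurable
    ((ae_restrict_iff' measurableSet_Ioi).2 (Eventually.of_forall fun t ht => ?_))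
  have ht0 : 0 ≤ t := le_of_lt ht
  calc _ ≤ c * Real.exp (-2 * t) * ‖x t‖ := hb t ht0
    _ ≤ c * Real.exp (-2 * t) * ((‖x 0‖ + 1) * Real.exp (c + 1)) := by
        gcongr
        exact norm_le_of_norm_deriv_le_exp hc hx hb ht0
    _ = _ := by ring

end Limits

/-! ### Decay of the length and convergence of the profile -/

namespace Evolution

variable {z₀ : ℝ → Plane} (ev : Evolution z₀) (x₀ : Plane)

/-- Only the base point was constructed by integrating the velocity in time. At other parameters the
time derivative of the primitive of `f` supplies the difference of the velocities at `u` and `0`. -/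
theorem hasDerivAt_curve (t u : ℝ) :
    HasDerivAt (fun t => ev.curve x₀ t u) (-nf (ev.f t) u) t := by
  have h1 := ev.hasDerivAt_curve_zero x₀ t
  have h2 := (primVec ev.perInt 0 u).hasFDerivAt.comp_hasDerivAt t (ev.hasDerivAt_A t)
  have h3 := (ev.isPrim_velocity t).sub_eq 0 u
  rw [primVec_apply, ← h3] at h2
  have h4 := h1.add h2
  have e : -nf (ev.f t) 0 + (-nf (ev.f t) u - -nf (ev.f t) 0) = -nf (ev.f t) u := by abel
  rw [e] at h4
  refine h4.congr_of_eventuallyEq (Eventually.of_forall fun s => ?_)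
  exact (ev.isPrim_curve x₀ s).eq_add 0 u

theorem norm_curve_le (t u : ℝ) : ‖ev.curve x₀ t u‖ ≤ ‖ev.curve x₀ t 0‖ + len (ev.f t) := by
  rw [← periodic_fract (ev.curve_periodic x₀ t) u, (ev.isPrim_curve x₀ t).eq_add 0 (Int.fract u)]
  refine (norm_add_le _ _).trans (add_le_add le_rfl ?_)
  have hm := (ev.perInt_f t).arc_sub_mem (u := 0) (v := Int.fract u)
    ⟨Int.fract_nonneg u, by simpa using (Int.fract_lt_one u).le⟩
  rw [(ev.perInt_f t).arc_sub] at hm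
  exact (intervalIntegral.norm_integral_le_integral_norm (Int.fract_nonneg u)).trans hm.2

theorem norm_qn_le_one (t u : ℝ) : ‖qn (ev.f t) u‖ ≤ 1 :=
  (ev.perInt_f t).norm_qn_le_one (ev.len_f_pos t) u

theorem abs_inner_qn_le (t u : ℝ) : |inner ℝ (qn (ev.f t) u) (ev.Z t u)| ≤
    ‖qn (ev.f t) u‖ * ev.E t u := by
  rw [← norm_Z]; exact abs_real_inner_le_norm _ _

theorem intervalIntegrable_E (t a b : ℝ) : IntervalIntegrable (ev.E t) volume a b :=
  intervalIntegrable_tim ev.perInt _ a b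

/-- The weighted length, rescaled by `exp t`. -/
def weightedLength (t : ℝ) : ℝ := ∫ u in (0 : ℝ)..1, wt (ev.curve x₀ t u) * ev.E t u

theorem hasDerivAt_wt_curve (t u : ℝ) : HasDerivAt (fun t => wt (ev.curve x₀ t u))
    (inner ℝ ((4 * wt (ev.curve x₀ t u)) • ev.curve x₀ t u) (-nf (ev.f t) u)) t := by
  refine (((ev.hasDerivAt_curve x₀ t u).norm_sq.const_mul 2).exp).congr_deriv ?_
  rw [inner_smul_left, wt, RCLike.conj_to_real]
  ring

theorem exists_bound_near (t : ℝ) : ∃ R K : ℝ, 0 ≤ R ∧ 0 ≤ K ∧ ∀ s ∈ Metric.ball t 1,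
    len (ev.f s) ≤ R ∧ (∀ u, ‖ev.curve x₀ s u‖ ≤ R) ∧ ‖ev.fam s‖ ≤ K := by
  have hc : Continuous fun s => ‖ev.curve x₀ s 0‖ + len (ev.f s) := by
    have h1 : Continuous fun s => ev.curve x₀ s 0 :=
      continuous_iff_continuousAt.2 fun s => (ev.hasDerivAt_curve_zero x₀ s).continuousAt
    have h2 := ev.continuous_len_f
    fun_prop
  obtain ⟨R, hR⟩ := (isCompact_closedBall t 1).exists_bound_of_continuousOn hc.continuousOn
  obtain ⟨K, hK⟩ := (isCompact_closedBall t 1).exists_bound_of_continuousOn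
    ev.continuous_fam.continuousOn
  have h0 : t ∈ Metric.closedBall t 1 := Metric.mem_closedBall_self zero_le_one
  refine ⟨R, K, (norm_nonneg _).trans (hR t h0), (norm_nonneg _).trans (hK t h0), fun s hs => ?_⟩
  have hs' := Metric.ball_subset_closedBall hs
  have h1 := (le_abs_self _).trans (hR s hs')
  exact ⟨by linarith [norm_nonneg (ev.curve x₀ s 0)],
    fun u => (ev.norm_curve_le x₀ s u).trans h1, hK s hs'⟩

theorem hasDerivAt_weightedLength (t : ℝ) : HasDerivAt (ev.weightedLength x₀)
    (∫ u in (0 : ℝ)..1,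
      (inner ℝ ((4 * wt (ev.curve x₀ t u)) • ev.curve x₀ t u) (-nf (ev.f t) u) * ev.E t u +
      wt (ev.curve x₀ t u) * inner ℝ (qn (ev.f t) u) (ev.Z t u))) t := by
  obtain ⟨R, K, hR, hK, hb⟩ := ev.exists_bound_near x₀ t
  have hmE : ∀ s, AEStronglyMeasurable (ev.E s) (volume.restrict (Set.uIoc (0 : ℝ) 1)) :=
    fun s => (intervalIntegrable_iff.1 (ev.intervalIntegrable_E s 0 1)).aestronglyMeasurable
  have hmZ : ∀ s, AEStronglyMeasurable (ev.Z s) (volume.restrict (Set.uIoc (0 : ℝ) 1)) :=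
    fun s => (intervalIntegrable_iff.1 (ev.perInt_Z s).integrable).aestronglyMeasurable
  have hcX : ∀ s, Continuous (ev.curve x₀ s) := fun s => (ev.isPrim_curve x₀ s).continuous
  have hcn := (ev.perInt_f t).nf_continuous
  have hcq := (ev.perInt_f t).qn_continuous
  have hw := continuous_wt
  refine (intervalIntegral.hasDerivAt_integral_of_dominated_loc_of_deriv_le
    (F := fun s u => wt (ev.curve x₀ s u) * ev.E s u)
    (F' := fun s u => inner ℝ ((4 * wt (ev.curve x₀ s u)) • ev.curve x₀ s u)
      (-nf (ev.f s) u) * ev.E s u + wt (ev.curve x₀ s u) * inner ℝ (qn (ev.f s) u) (ev.Z s u))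
    (bound := fun u => ((4 * Real.exp (2 * R ^ 2)) * R * (R / 2) + Real.exp (2 * R ^ 2)) *
      (K * ‖z₀ u‖)) (Metric.ball_mem_nhds t one_pos) ?_ ?_ ?_ ?_ ?_ ?_).2
  · exact Eventually.of_forall fun s => (hw.comp (hcX s)).aestronglyMeasurable.mul (hmE s)
  · exact (ev.intervalIntegrable_E t 0 1).continuousOn_mul (hw.comp (hcX t)).continuousOn
  · refine AEStronglyMeasurable.add (AEStronglyMeasurable.mul ?_ (hmE t))
      ((hw.comp (hcX t)).aestronglyMeasurable.mul (hcq.aestronglyMeasurable.inner (hmZ t)))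
    have := hcX t
    exact Continuous.aestronglyMeasurable (by fun_prop)
  · refine Eventually.of_forall fun u _ s hs => ?_
    obtain ⟨h1, h2, h3⟩ := hb s hs
    have hwt : wt (ev.curve x₀ s u) ≤ Real.exp (2 * R ^ 2) := by
      have := h2 u
      unfold wt
      gcongr
    have hwp := wt_pos (ev.curve x₀ s u)
    have hE : ev.E s u ≤ K * ‖z₀ u‖ := (ev.E_le s u).trans (by gcongr)
    have hE0 := ev.E_nonneg s u
    have hn : ‖nf (ev.f s) u‖ ≤ R / 2 :=
      ((ev.perInt_f s).norm_nf_le (ev.len_f_pos s) u).trans (by linarith)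
    refine (norm_add_le _ _).trans ?_
    rw [add_mul]
    refine add_le_add ?_ ?_
    · rw [norm_mul, Real.norm_of_nonneg hE0]
      gcongr
      refine (norm_inner_le_norm _ _).trans ?_
      rw [norm_smul, norm_neg, Real.norm_of_nonneg (by positivity)]
      gcongr
      exact h2 u
    · rw [norm_mul, Real.norm_of_nonneg hwp.le]
      gcongr
      refine (ev.abs_inner_qn_le s u).trans ?_
      exact (mul_le_of_le_one_left hE0 (ev.norm_qn_le_one s u)).trans hE
  · exact ((ev.perInt.integrable.norm.const_mul K).const_mul _)
  · exact Eventually.of_forall fun u _ s _ =>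
      (ev.hasDerivAt_wt_curve x₀ s u).mul (ev.hasDerivAt_E s u)

theorem antitone_weightedLength : Antitone (ev.weightedLength x₀) := by
  refine antitone_of_deriv_nonpos (fun t => (ev.hasDerivAt_weightedLength x₀ t).differentiableAt)
    fun t => ?_
  rw [(ev.hasDerivAt_weightedLength x₀ t).deriv]
  have h := weighted_length_inequality (ev.perInt_f t) (ev.len_f_pos t) (ev.isPrim_curve x₀ t)
    (ev.curve_periodic x₀ t)
  have e : ∀ u, inner ℝ ((4 * wt (ev.curve x₀ t u)) • ev.curve x₀ t u) (-nf (ev.f t) u) *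
      ev.E t u + wt (ev.curve x₀ t u) * inner ℝ (qn (ev.f t) u) (ev.Z t u) = Real.exp t *
      (inner ℝ ((4 * wt (ev.curve x₀ t u)) • ev.curve x₀ t u) (-nf (ev.f t) u) * ‖ev.f t u‖ +
      wt (ev.curve x₀ t u) * inner ℝ (ev.f t u) (qn (ev.f t) u)) := fun u => by
    rw [ev.E_eq, ev.Z_eq, inner_smul_right, real_inner_comm (ev.f t u) (qn _ u)]; ring
  simp only [e, intervalIntegral.integral_const_mul]
  exact mul_nonpos_of_nonneg_of_nonpos (Real.exp_pos t).le h

/-- The length, rescaled by `exp t`. -/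
def ell (t : ℝ) : ℝ := ∫ u in (0 : ℝ)..1, ev.E t u

theorem len_f_eq (t : ℝ) : len (ev.f t) = Real.exp (-t) * ev.ell t := ev.len_f t

/-- The weight is at least one at all times and at most `exp (2 M²)` initially, so monotonicity of
the weighted length bounds the rescaled length. -/
theorem ell_le {M : ℝ} (hM : ∀ u, ‖ev.curve x₀ 0 u‖ ≤ M) {t : ℝ} (ht : 0 ≤ t) :
    ev.ell t ≤ Real.exp (2 * M ^ 2) * len z₀ := by
  have hc : ∀ s, IntervalIntegrable (fun u => wt (ev.curve x₀ s u) * ev.E s u) volume 0 1 :=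
    fun s => (ev.intervalIntegrable_E s 0 1).continuousOn_mul
      (continuous_wt.comp (ev.isPrim_curve x₀ s).continuous).continuousOn
  calc ev.ell t ≤ ev.weightedLength x₀ t :=
        intervalIntegral.integral_mono zero_le_one (ev.intervalIntegrable_E t 0 1) (hc t)
          fun u => le_mul_of_one_le_left (ev.E_nonneg t u) (one_le_wt _)
    _ ≤ ev.weightedLength x₀ 0 := ev.antitone_weightedLength x₀ ht
    _ ≤ ∫ u in (0 : ℝ)..1, Real.exp (2 * M ^ 2) * ‖z₀ u‖ := by
        refine intervalIntegral.integral_mono zero_le_one (hc 0)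
          (ev.perInt.integrable.norm.const_mul _) fun u => ?_
        simp only [ev.E_zero]
        have := hM u
        unfold wt
        gcongr
    _ = _ := by rw [intervalIntegral.integral_const_mul]; rfl

theorem norm_qn_le_sq (t u : ℝ) : ‖qn (ev.f t) u‖ ≤ len (ev.f t) ^ 2 / 8 :=
  (ev.perInt_f t).norm_qf_le_sq (ev.len_f_pos t) (ev.integral_f t) u

/-- The length is `O(e^{-t})` and the generator is quadratic in the length. -/
theorem exists_norm_gen_le : ∃ c K : ℝ, 0 ≤ c ∧ 0 ≤ K ∧
    (∀ t, 0 ≤ t → ‖gen ev.perInt t (ev.fam t)‖ ≤ c * Real.exp (-2 * t)) ∧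
    (∀ t, 0 ≤ t → len (ev.f t) ≤ K * Real.exp (-t)) ∧
    (∀ t u, 0 ≤ t → ‖qn (ev.f t) u‖ ≤ c * Real.exp (-2 * t)) := by
  -- Lengths do not depend on the base point, so the curve with base point `0` serves for the bound.
  set M := ‖ev.curve 0 0 0‖ + len (ev.f 0)
  set K := Real.exp (2 * M ^ 2) * len z₀
  have hK : 0 ≤ K := by have := len_nonneg z₀; positivity
  have hlen : ∀ t, 0 ≤ t → len (ev.f t) ≤ K * Real.exp (-t) := fun t ht => by
    rw [len_f_eq, mul_comm]
    gcongr
    exact ev.ell_le 0 (ev.norm_curve_le 0 0) ht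
  have hq : ∀ t u, 0 ≤ t → ‖qn (ev.f t) u‖ ≤ K ^ 2 / 8 * Real.exp (-2 * t) := fun t u ht => by
    refine (ev.norm_qn_le_sq t u).trans ?_
    have h1 := hlen t ht
    have h0 := ev.len_f_pos t
    have e : Real.exp (-2 * t) = Real.exp (-t) ^ 2 := by
      rw [← Real.exp_nat_mul]; congr 1; push_cast; ring
    rw [e]
    calc _ ≤ (K * Real.exp (-t)) ^ 2 / 8 := by gcongr
      _ = _ := by ring
  refine ⟨K ^ 2 / 8, K, by positivity, hK, fun t ht => Fam.norm_le (by positivity) fun u => ?_,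
    hlen, hq⟩
  rw [ev.gen_at]
  exact (norm_boost_le _).trans (hq t u ht)

theorem exists_tendsto_fam : ∃ x, Tendsto ev.fam atTop (𝓝 x) := by
  obtain ⟨c, K, hc, -, h, -⟩ := ev.exists_norm_gen_le
  exact exists_tendsto_of_norm_deriv_le_exp hc ev.hasDerivAt_fam
    (ev.continuous_gen.mul ev.continuous_fam) fun t ht =>
    (norm_mul_le _ _).trans (mul_le_mul_of_nonneg_right (h t ht) (norm_nonneg _))

theorem continuous_inv : Continuous ev.inv :=
  continuous_iff_continuousAt.2 fun t => (ev.hasDerivAt_inv t).continuousAt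

theorem exists_tendsto_inv : ∃ x, Tendsto ev.inv atTop (𝓝 x) := by
  obtain ⟨c, K, hc, -, h, -⟩ := ev.exists_norm_gen_le
  refine exists_tendsto_of_norm_deriv_le_exp hc ev.hasDerivAt_inv
    (ev.continuous_inv.mul ev.continuous_gen).neg fun t ht => ?_
  rw [norm_neg, mul_comm (c * _)]
  exact (norm_mul_le _ _).trans (mul_le_mul_of_nonneg_left (h t ht) (norm_nonneg _))

/-- The limit of the evolution. -/
def famLim : Fam := ev.exists_tendsto_fam.choose

/-- The limit of the inverse evolution. -/
def invLim : Fam := ev.exists_tendsto_inv.choose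

theorem tendsto_fam : Tendsto ev.fam atTop (𝓝 ev.famLim) := ev.exists_tendsto_fam.choose_spec

theorem tendsto_inv : Tendsto ev.inv atTop (𝓝 ev.invLim) := ev.exists_tendsto_inv.choose_spec

theorem invLim_mul_famLim : ev.invLim * ev.famLim = 1 := by
  refine tendsto_nhds_unique (ev.tendsto_inv.mul ev.tendsto_fam) ?_
  simp only [ev.inv_mul_fam]
  exact tendsto_const_nhds

/-- The derivative of the limit of the profile. -/
def Zlim (u : ℝ) : Plane := vec z₀ ev.famLim u

theorem tendsto_apply (u : ℝ) : Tendsto (fun t => (ev.fam t).at u (light z₀ u)) atTop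
    (𝓝 (ev.famLim.at u (light z₀ u))) :=
  (((ContinuousLinearMap.apply ℝ Mink (light z₀ u)).comp (Fam.evalCLM u)).continuous.tendsto
    _).comp ev.tendsto_fam

theorem tendsto_Z (u : ℝ) : Tendsto (fun t => ev.Z t u) atTop (𝓝 (ev.Zlim u)) :=
  (continuous_snd.tendsto _).comp (ev.tendsto_apply u)

theorem tendsto_E (u : ℝ) : Tendsto (fun t => ev.E t u) atTop (𝓝 ‖ev.Zlim u‖) := by
  simp only [← ev.norm_Z]
  exact (ev.tendsto_Z u).norm

/-- The relation with the inverse survives in the limit and recovers the initial lightlike vector.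
This gives non-triviality of the limit, and its immersedness at every parameter where `z₀` does not
vanish. -/
theorem norm_le_norm_Zlim (u : ℝ) : ‖z₀ u‖ ≤ ‖ev.invLim‖ * ‖ev.Zlim u‖ := by
  have h1 : ev.famLim.at u (light z₀ u) = (‖ev.Zlim u‖, ev.Zlim u) :=
    Prod.ext (tendsto_nhds_unique ((continuous_fst.tendsto _).comp (ev.tendsto_apply u))
      (ev.tendsto_E u)) rfl
  have h2 : ev.invLim.at u (ev.famLim.at u (light z₀ u)) = light z₀ u :=
    congrArg (fun x : Fam => x.at u (light z₀ u)) ev.invLim_mul_famLim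
  have h3 := ev.invLim.norm_apply_le u (ev.famLim.at u (light z₀ u))
  rw [h2, h1, norm_light, Prod.norm_mk, norm_norm, max_self] at h3
  exact h3

theorem perInt_Zlim : PerInt ev.Zlim := perInt_vec ev.perInt _

theorem len_Zlim_pos : 0 < len ev.Zlim := by
  have h := len_le_of_norm_le ev.perInt ev.perInt_Zlim ev.norm_le_norm_Zlim
  have := ev.len_pos
  by_contra! hn
  nlinarith [norm_nonneg ev.invLim]

theorem integral_Zlim : ∫ u in (0 : ℝ)..1, ev.Zlim u = 0 := by
  have h := ((primVec ev.perInt 0 1).continuous.tendsto _).comp ev.tendsto_fam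
  refine tendsto_nhds_unique h ?_
  have : ∀ t, ((primVec ev.perInt 0 1) ∘ ev.fam) t = 0 := fun t => ev.integral_Z t
  rw [funext this]
  exact tendsto_const_nhds

theorem tendsto_ell : Tendsto ev.ell atTop (𝓝 (len ev.Zlim)) := by
  have h := ((primTim ev.perInt 0 1).continuous.tendsto _).comp ev.tendsto_fam
  have e : primTim ev.perInt 0 1 ev.famLim = len ev.Zlim := by
    rw [primTim_apply, len]
    refine intervalIntegral.integral_congr fun u _ => ?_
    exact tendsto_nhds_unique ((continuous_fst.tendsto _).comp (ev.tendsto_apply u))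
      (ev.tendsto_E u)
  rw [e] at h
  exact h

/-- The limit of the profile. -/
def limit (u : ℝ) : Plane := ∫ x in (0 : ℝ)..u, ev.Zlim x

theorem isPrim_limit : IsPrim ev.limit ev.Zlim :=
  isPrim_integral ev.perInt_Zlim.intervalIntegrable 0

theorem limit_periodic : Function.Periodic ev.limit 1 :=
  ev.isPrim_limit.periodic ev.perInt_Zlim.periodic ev.integral_Zlim

theorem limit_memH1 (h2 : MemLp z₀ 2 (volume.restrict (Set.Ioc (0 : ℝ) 1))) : MemH1 ev.limit :=
  ev.isPrim_limit.memH1 ev.limit_periodic (memLp_vec ev.perInt h2 _)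

theorem not_isConstantMap_limit : ¬ IsConstantMap ev.limit := by
  refine not_isConstantMap_of_len_pos ?_
  rw [len_congr_ae ev.isPrim_limit.ae_deriv]
  exact ev.len_Zlim_pos

theorem profile_eq (t u : ℝ) : profile (ev.curve x₀) t u = ∫ x in (0 : ℝ)..u, ev.Z t x := by
  rw [profile, (ev.isPrim_curve x₀ t).sub_eq, ← intervalIntegral.integral_smul]
  simp only [ev.Z_eq]

theorem profile_periodic (t : ℝ) : Function.Periodic (profile (ev.curve x₀) t) 1 := fun u => by
  simp only [profile, ev.curve_periodic x₀ t u]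

/-- The difference is the primitive of the vector part of `fam t - famLim`, so convergence of
families gives uniform convergence of the profile. -/
theorem norm_profile_sub_limit_le (t u : ℝ) :
    ‖profile (ev.curve x₀) t u - ev.limit u‖ ≤ ‖ev.fam t - ev.famLim‖ * len z₀ := by
  rw [← periodic_fract (ev.profile_periodic x₀ t) u, ← periodic_fract ev.limit_periodic u]
  have h0 := Int.fract_nonneg u
  have h1 := (Int.fract_lt_one u).le
  rw [profile_eq, limit, ← intervalIntegral.integral_sub ((ev.perInt_Z t).intervalIntegrable _ _)
    (ev.perInt_Zlim.intervalIntegrable _ _)]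
  refine (intervalIntegral.norm_integral_le_of_norm_le h0
    (g := fun u => ‖ev.fam t - ev.famLim‖ * ‖z₀ u‖)
    (Eventually.of_forall fun u _ => norm_vec_le (ev.fam t - ev.famLim) u)
    ((ev.perInt.intervalIntegrable _ _).norm.const_mul _)).trans ?_
  rw [intervalIntegral.integral_const_mul]
  gcongr
  exact ev.perInt.monotone_arc h1

theorem tendstoUniformly_profile : TendstoUniformly (profile (ev.curve x₀)) ev.limit atTop := by
  rw [Metric.tendstoUniformly_iff]
  intro ε hε
  have h : Tendsto (fun t => ‖ev.fam t - ev.famLim‖ * len z₀) atTop (𝓝 0) := by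
    have := (tendsto_iff_norm_sub_tendsto_zero.1 ev.tendsto_fam).mul_const (len z₀)
    rwa [zero_mul] at this
  filter_upwards [h.eventually_lt_const hε] with t ht u
  rw [dist_comm, dist_eq_norm]
  exact (ev.norm_profile_sub_limit_le x₀ t u).trans_lt ht

end Evolution

/-! ### The chord-arc condition and embeddedness of the limit -/

theorem le_exp_mul_of_deriv_le {E E' B b : ℝ → ℝ} {a : ℝ} (hE : ∀ t, HasDerivAt E (E' t) t)
    (hB : ∀ t, HasDerivAt B (b t) t) (h : ∀ t, a ≤ t → E' t ≤ b t * E t) {t : ℝ} (ht : a ≤ t) :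
    E t ≤ E a * Real.exp (B t - B a) := by
  have hd : ∀ t, HasDerivAt (fun t => Real.exp (-B t) * E t)
      (Real.exp (-B t) * -b t * E t + Real.exp (-B t) * E' t) t := fun t =>
    (hB t).neg.exp.mul (hE t)
  have hanti : AntitoneOn (fun t => Real.exp (-B t) * E t) (Set.Ici a) := by
    refine antitoneOn_of_deriv_nonpos (convex_Ici a)
      (fun t _ => (hd t).continuousAt.continuousWithinAt)
      (fun t _ => (hd t).differentiableAt.differentiableWithinAt) fun t ht => ?_
    rw [interior_Ici] at ht
    rw [(hd t).deriv, mul_assoc, ← mul_add]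
    exact mul_nonpos_of_nonneg_of_nonpos (Real.exp_pos _).le (by linarith [h t (le_of_lt ht)])
  have h1 := hanti Set.self_mem_Ici ht ht
  calc E t = Real.exp (B t) * (Real.exp (-B t) * E t) := by
        rw [← mul_assoc, ← Real.exp_add]; simp
    _ ≤ Real.exp (B t) * (Real.exp (-B a) * E a) := by gcongr
    _ = _ := by rw [sub_eq_add_neg, Real.exp_add]; ring

namespace Evolution

variable {z₀ : ℝ → Plane} (ev : Evolution z₀) (x₀ : Plane)

theorem inner_qn_le {b t u : ℝ} (hq : ‖qn (ev.f t) u‖ ≤ b) :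
    inner ℝ (qn (ev.f t) u) (ev.Z t u) ≤ b * ev.E t u :=
  (le_abs_self _).trans ((ev.abs_inner_qn_le t u).trans
    (mul_le_mul_of_nonneg_right hq (ev.E_nonneg t u)))

theorem len_f_le_of_norm_qn_le {b t₀ t : ℝ} (ht : t₀ ≤ t)
    (hq : ∀ s u, t₀ ≤ s → ‖qn (ev.f s) u‖ ≤ b) :
    len (ev.f t) ≤ Real.exp (-((1 - b) * (t - t₀))) * len (ev.f t₀) := by
  rw [len, len, ← intervalIntegral.integral_const_mul]
  refine intervalIntegral.integral_mono zero_le_one (ev.perInt_f t).integrable.norm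
    ((ev.perInt_f t₀).integrable.norm.const_mul _) fun u => ?_
  have h := le_exp_mul_of_deriv_le (B := fun s => b * s) (b := fun _ => b)
    (fun s => ev.hasDerivAt_E s u) (fun s => by simpa using (hasDerivAt_id s).const_mul b)
    (fun s hs => ev.inner_qn_le (hq s u hs)) ht
  change ‖ev.f t u‖ ≤ _ * ‖ev.f t₀ u‖
  rw [norm_f, norm_f]
  calc _ ≤ Real.exp (-t) * (ev.E t₀ u * Real.exp (b * t - b * t₀)) := by gcongr
    _ = (Real.exp (-t) * Real.exp (b * t - b * t₀)) * ev.E t₀ u := by ring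
    _ = (Real.exp (-((1 - b) * (t - t₀))) * Real.exp (-t₀)) * ev.E t₀ u := by
        rw [← Real.exp_add, ← Real.exp_add]; ring_nf
    _ = _ := by ring

theorem len_f_antitone {t₀ t : ℝ} (ht : t₀ ≤ t) : len (ev.f t) ≤ len (ev.f t₀) := by
  simpa using ev.len_f_le_of_norm_qn_le (b := 1) ht fun s u _ => ev.norm_qn_le_one s u

/-- Length at most `2` gives `|q| ≤ 1/2` from then on, so the length decays at least like `e^{-(t -
t₀)/2}`. Inserting this into the quadratic bound for `q` doubles the rate. -/
theorem norm_qn_le_exp {t₀ : ℝ} (hL : len (ev.f t₀) ≤ 2) {t : ℝ} (ht : t₀ ≤ t) (u : ℝ) :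
    ‖qn (ev.f t) u‖ ≤ len (ev.f t₀) ^ 2 / 8 * Real.exp (-(t - t₀)) := by
  have h1 := ev.len_f_le_of_norm_qn_le (b := 1 / 2) ht fun s u hs => by
    have h2 := ev.len_f_antitone hs
    have h3 := (ev.len_f_pos s).le
    refine (ev.norm_qn_le_sq s u).trans ?_
    nlinarith
  have h0 := (ev.len_f_pos t).le
  calc _ ≤ len (ev.f t) ^ 2 / 8 := ev.norm_qn_le_sq t u
    _ ≤ (Real.exp (-((1 - 1 / 2) * (t - t₀))) * len (ev.f t₀)) ^ 2 / 8 := by gcongr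
    _ = len (ev.f t₀) ^ 2 / 8 * Real.exp (-((1 - 1 / 2) * (t - t₀))) ^ 2 := by ring
    _ = _ := by
        rw [← Real.exp_nat_mul]
        congr 2
        push_cast
        ring

/-- The bound for `q` integrates over `[t₀, ∞)` to `Q = L² / 8`, so `E` grows by at most the factor
`e^Q`, and the length of the path of `Z` is at most `e^Q - 1` times `E` at time `t₀`. -/
theorem norm_Zlim_sub_le {t₀ : ℝ} (hL : len (ev.f t₀) ≤ 2) (u : ℝ) :
    ‖ev.Zlim u - ev.Z t₀ u‖ ≤ (Real.exp (len (ev.f t₀) ^ 2 / 8) - 1) * ev.E t₀ u := by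
  set Q := len (ev.f t₀) ^ 2 / 8
  have hQ : 0 ≤ Q := by positivity
  set B : ℝ → ℝ := fun s => Q * (1 - Real.exp (-(s - t₀)))
  have hB : ∀ s, HasDerivAt B (Q * Real.exp (-(s - t₀))) s := fun s => by
    have h := (((((hasDerivAt_id s).sub_const t₀).neg).exp.const_sub 1).const_mul Q)
    refine h.congr_deriv ?_
    simp
  have hB0 : B t₀ = 0 := by simp [B]
  have hBQ : ∀ s, B s ≤ Q := fun s => by
    have := Real.exp_pos (-(s - t₀))
    simp only [B]
    nlinarith
  have hE0 := ev.E_nonneg t₀ u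
  have hE : ∀ s, t₀ ≤ s → ev.E s u ≤ ev.E t₀ u * Real.exp (B s) := fun s hs => by
    have h := le_exp_mul_of_deriv_le (fun s => ev.hasDerivAt_E s u) hB
      (fun s hs => ev.inner_qn_le (ev.norm_qn_le_exp hL hs u)) hs
    rwa [hB0, sub_zero] at h
  have hmain : ∀ t, t₀ ≤ t → ‖ev.Z t u - ev.Z t₀ u‖ ≤ (Real.exp Q - 1) * ev.E t₀ u := fun t ht => by
    have h := image_norm_le_of_norm_deriv_right_le_deriv_boundary (a := t₀) (b := t)
      (f := fun s => ev.Z s u - ev.Z t₀ u) (f' := fun s => ev.E s u • qn (ev.f s) u)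
      (B := fun s => ev.E t₀ u * (Real.exp (B s) - 1))
      (B' := fun s => ev.E t₀ u * (Real.exp (B s) * (Q * Real.exp (-(s - t₀)))))
      (fun s _ => ((ev.hasDerivAt_Z s u).sub_const _).continuousAt.continuousWithinAt)
      (fun s _ => ((ev.hasDerivAt_Z s u).sub_const _).hasDerivWithinAt)
      (by simp [hB0])
      (fun s => ((hB s).exp.sub_const 1).const_mul _)
      (fun s hs => by
        rw [norm_smul, Real.norm_of_nonneg (ev.E_nonneg s u), ← mul_assoc]
        have h1 := hE s hs.1
        have h2 := ev.norm_qn_le_exp hL hs.1 u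
        gcongr) (Set.right_mem_Icc.2 ht)
    refine h.trans ?_
    rw [mul_comm]
    gcongr
    exact hBQ t
  refine le_of_tendsto ((ev.tendsto_Z u).sub_const _).norm ?_
  filter_upwards [eventually_ge_atTop t₀] with t ht using hmain t ht

/-- An arc that closes up in the limit must already have a short chord, relative to its length, at
time `t₀`. -/
theorem norm_integral_Zlim_sub_le {t₀ a b : ℝ} (hab : a ≤ b) (hL : len (ev.f t₀) ≤ 2)
    (h : ∫ u in a..b, ev.Zlim u = 0) : ‖∫ u in a..b, ev.f t₀ u‖ ≤
      (Real.exp (len (ev.f t₀) ^ 2 / 8) - 1) * ∫ u in a..b, ‖ev.f t₀ u‖ := by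
  have h1 := intervalIntegral.norm_integral_le_of_norm_le hab
    (Eventually.of_forall fun u _ => ev.norm_Zlim_sub_le hL u)
    ((ev.intervalIntegrable_E t₀ a b).const_mul _)
  rw [intervalIntegral.integral_sub (ev.perInt_Zlim.intervalIntegrable _ _)
    ((ev.perInt_Z t₀).intervalIntegrable _ _), h, zero_sub, norm_neg,
    intervalIntegral.integral_const_mul] at h1
  simp only [norm_f, intervalIntegral.integral_const_mul]
  simp only [f_eq, intervalIntegral.integral_smul]
  rw [norm_smul, Real.norm_of_nonneg (Real.exp_pos _).le, mul_left_comm]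
  gcongr

/-- A positive infimum rules out arcs of zero length and gives the chord-arc inequality for all
pairs. The bound by one comes from a single pair, since a chord is no longer than either arc. -/
theorem chordArcInf_spec {γ f : ℝ → Plane} (hf : PerInt f) (h : IsPrim γ f)
    (hper : Function.Periodic γ 1) (hpos : 0 < chordArcInf γ) : chordArcInf γ ≤ 1 ∧ ∀ u v, 0 ≤ u → u < v → v < 1 →
      0 < min (∫ x in u..v, ‖f x‖) (∫ x in v..(u + 1), ‖f x‖) ∧
      chordArcInf γ * min (∫ x in u..v, ‖f x‖) (∫ x in v..(u + 1), ‖f x‖) ≤ ‖γ v - γ u‖ := by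
  have hd : ∀ᵐ u, deriv γ u = f u := h.ae_deriv
  have hlen : ∀ u v, (∫ x in u..v, ‖deriv γ x‖) = ∫ x in u..v, ‖f x‖ := fun u v =>
    intervalIntegral.integral_congr_ae (hd.mono fun x hx _ => by rw [hx])
  have harc : ∀ u v, arcDist γ u v = min (∫ x in u..v, ‖f x‖) (∫ x in v..(u + 1), ‖f x‖) :=
    fun u v => by
    rw [arcDist, length_eq, len_congr_ae hd, hlen]
    congr 1
    rw [← hf.arc_sub, ← hf.arc_sub, hf.arc_add_one]
    ring
  have hbdd : BddBelow {r : ℝ | ∃ u v : ℝ, 0 ≤ u ∧ u < v ∧ v < 1 ∧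
      r = dist (γ u) (γ v) / arcDist γ u v} := by
    refine ⟨0, ?_⟩
    rintro r ⟨u, v, h0, h1, h2, rfl⟩
    rw [harc]
    refine div_nonneg dist_nonneg (le_min ?_ ?_)
    · exact intervalIntegral.integral_nonneg h1.le fun _ _ => norm_nonneg _
    · exact intervalIntegral.integral_nonneg (by linarith) fun _ _ => norm_nonneg _
  have key : ∀ u v, 0 ≤ u → u < v → v < 1 →
      0 < min (∫ x in u..v, ‖f x‖) (∫ x in v..(u + 1), ‖f x‖) ∧
      chordArcInf γ * min (∫ x in u..v, ‖f x‖) (∫ x in v..(u + 1), ‖f x‖) ≤ ‖γ v - γ u‖ :=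
    fun u v h0 h1 h2 => by
    have hle : chordArcInf γ ≤ dist (γ u) (γ v) / arcDist γ u v :=
      csInf_le hbdd ⟨u, v, h0, h1, h2, rfl⟩
    have hm : 0 ≤ min (∫ x in u..v, ‖f x‖) (∫ x in v..(u + 1), ‖f x‖) := le_min
      (intervalIntegral.integral_nonneg h1.le fun _ _ => norm_nonneg _)
      (intervalIntegral.integral_nonneg (by linarith) fun _ _ => norm_nonneg _)
    rw [harc] at hle
    -- A degenerate arc would contribute the quotient `0`, by the convention for division by zero.
    have hm' : 0 < min (∫ x in u..v, ‖f x‖) (∫ x in v..(u + 1), ‖f x‖) := by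
      refine hm.lt_of_ne fun he => ?_
      rw [← he, div_zero] at hle
      linarith
    refine ⟨hm', ?_⟩
    rwa [le_div_iff₀ hm', dist_comm, dist_eq_norm] at hle
  refine ⟨?_, key⟩
  obtain ⟨h1, h2⟩ := key 0 (1 / 2) le_rfl (by norm_num) (by norm_num)
  have h3 : ‖γ (1 / 2) - γ 0‖ ≤ ∫ x in (0 : ℝ)..(1 / 2), ‖f x‖ := by
    rw [h.sub_eq]
    exact intervalIntegral.norm_integral_le_integral_norm (by norm_num)
  have h4 : ‖γ (1 / 2) - γ 0‖ ≤ ∫ x in (1 / 2 : ℝ)..(0 + 1), ‖f x‖ := by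
    rw [norm_sub_rev, ← hper 0, h.sub_eq]
    exact intervalIntegral.norm_integral_le_integral_norm (by norm_num)
  have h5 := h2.trans (le_min h3 h4)
  exact le_of_mul_le_mul_right (by linarith) h1

/-- A coincidence in the limit closes up both arcs between the two parameters, so at time `t₀` the
chord is at most `e^Q - 1` times the shorter arc. On the other hand `e^Q - 1 ≤ Q e^Q ≤ θ e^θ`, which
is less than the chord-arc infimum. -/
theorem injOn_limit {t₀ : ℝ} (h : ChordArcCondition (ev.curve x₀ t₀)) :
    Set.InjOn ev.limit (Set.Ico 0 1) := by
  have hprim := ev.isPrim_curve x₀ t₀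
  have hf := ev.perInt_f t₀
  set L := len (ev.f t₀) with hLdef
  have hL0 : 0 < L := ev.len_f_pos t₀
  have hlength : length (ev.curve x₀ t₀) = L := by
    rw [length_eq, len_congr_ae (ev.ae_deriv_curve x₀ t₀)]
  rw [ChordArcCondition, hlength] at h
  set θ := L ^ 2 * Real.sqrt (2 + supNorm (ev.curve x₀ t₀) ^ 2) / 4
  set κ := chordArcInf (ev.curve x₀ t₀)
  have hθ0 : 0 ≤ θ := by positivity
  have hs : 1 ≤ Real.sqrt (2 + supNorm (ev.curve x₀ t₀) ^ 2) := by
    rw [Real.one_le_sqrt]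
    nlinarith [sq_nonneg (supNorm (ev.curve x₀ t₀))]
  have hLθ : L ^ 2 / 4 ≤ θ := by
    simp only [θ]
    have := le_mul_of_one_le_right (sq_nonneg L) hs
    linarith
  have hκ : 0 < κ := lt_of_le_of_lt (by positivity) h
  obtain ⟨hκ1, hspec⟩ := chordArcInf_spec hf hprim (ev.curve_periodic x₀ t₀) hκ
  -- The infimum is at most one, hence `θ e^θ < 1`. Together with `L² / 4 ≤ θ` this provides the
  -- smallness `L ≤ 2`.
  have hθ1 : θ < 1 := by
    by_contra! hge
    have := Real.one_le_exp hθ0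
    nlinarith
  have hL2 : L ≤ 2 := by nlinarith
  set Q := L ^ 2 / 8 with hQ
  have hQθ : Q ≤ θ := by simp only [hQ]; nlinarith [sq_nonneg L]
  have hexp : Real.exp Q - 1 < κ := by
    have h1 : Real.exp Q - 1 ≤ Q * Real.exp Q := by
      have h2 := Real.add_one_le_exp (-Q)
      have h3 := mul_le_mul_of_nonneg_right h2 (Real.exp_pos Q).le
      rw [← Real.exp_add, neg_add_cancel, Real.exp_zero] at h3
      linarith
    have h2 : Q * Real.exp Q ≤ θ * Real.exp θ := by gcongr
    linarith
  have hQ0 : 0 ≤ Real.exp Q - 1 := by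
    have := Real.one_le_exp (x := Q) (by positivity)
    linarith
  have main : ∀ u v, 0 ≤ u → u < v → v < 1 → ev.limit u ≠ ev.limit v := fun u v h0 huv h1 he => by
    obtain ⟨hm, hc⟩ := hspec u v h0 huv h1
    have z1 : ∫ x in u..v, ev.Zlim x = 0 := by
      rw [← ev.isPrim_limit.sub_eq, he, sub_self]
    have z2 : ∫ x in v..(u + 1), ev.Zlim x = 0 := by
      rw [← ev.isPrim_limit.sub_eq, ev.limit_periodic, he, sub_self]
    have b1 := ev.norm_integral_Zlim_sub_le huv.le hL2 z1
    have b2 := ev.norm_integral_Zlim_sub_le (by linarith) hL2 z2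
    rw [← hprim.sub_eq] at b1 b2
    rw [ev.curve_periodic, norm_sub_rev] at b2
    have b3 : ‖ev.curve x₀ t₀ v - ev.curve x₀ t₀ u‖ ≤ (Real.exp Q - 1) *
        min (∫ x in u..v, ‖ev.f t₀ x‖) (∫ x in v..(u + 1), ‖ev.f t₀ x‖) := by
      rw [mul_min_of_nonneg _ _ hQ0]
      exact le_min b1 b2
    have := mul_lt_mul_of_pos_right hexp hm
    linarith
  intro u hu v hv he
  rcases lt_trichotomy u v with huv | huv | huv
  · exact absurd he (main u v hu.1 huv hv.2)
  · exact huv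
  · exact absurd he.symm (main v u hv.1 huv hu.2)

theorem isEmbedded_limit {t₀ : ℝ} (h : ChordArcCondition (ev.curve x₀ t₀)) :
    IsEmbedded ev.limit :=
  ⟨ev.isPrim_limit.continuous, ev.limit_periodic, ev.injOn_limit x₀ h⟩

theorem continuous_Zlim (hz : Continuous z₀) : Continuous ev.Zlim :=
  continuous_snd.comp (ev.famLim.continuous_at.clm_apply (hz.norm.prodMk hz))

theorem hasDerivAt_limit (hz : Continuous z₀) (u : ℝ) : HasDerivAt ev.limit (ev.Zlim u) u :=
  intervalIntegral.integral_hasDerivAt_right (ev.perInt_Zlim.intervalIntegrable 0 u)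
    ((ev.continuous_Zlim hz).stronglyMeasurableAtFilter _ _) (ev.continuous_Zlim hz).continuousAt

theorem Zlim_ne_zero {u : ℝ} (hu : z₀ u ≠ 0) : ev.Zlim u ≠ 0 := fun h => by
  have := ev.norm_le_norm_Zlim u
  rw [h, norm_zero, mul_zero] at this
  exact hu (norm_le_zero_iff.1 this)

theorem memImm_one_limit (hz : Continuous z₀) (h0 : ∀ u, z₀ u ≠ 0) : MemImm 1 ev.limit := by
  refine ⟨⟨ev.limit_periodic, contDiff_one_of_hasDerivAt (ev.hasDerivAt_limit hz)
    (ev.continuous_Zlim hz)⟩, fun u => ?_⟩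
  rw [(ev.hasDerivAt_limit hz u).deriv]
  exact ev.Zlim_ne_zero (h0 u)

end Evolution

theorem IsPrim.hasDerivAt {E : Type*} [NormedAddCommGroup E] [NormedSpace ℝ E] [CompleteSpace E]
    {F f : ℝ → E} (h : IsPrim F f) (hf : Continuous f) (u : ℝ) : HasDerivAt F (f u) u := by
  have h1 := (intervalIntegral.integral_hasDerivAt_right (hf.intervalIntegrable 0 u)
    (hf.stronglyMeasurableAtFilter _ _) hf.continuousAt).const_add (F 0)
  rwa [show F = fun u => F 0 + ∫ x in (0 : ℝ)..u, f x from funext fun u => h.eq_add 0 u]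

theorem Function.Periodic.exists_norm_le {E : Type*} [NormedAddCommGroup E] {h : ℝ → E}
    (hp : Function.Periodic h 1) (hc : Continuous h) : ∃ C, 0 ≤ C ∧ ∀ u, ‖h u‖ ≤ C := by
  obtain ⟨C, hC⟩ := (isCompact_Icc (a := (0 : ℝ)) (b := 1)).exists_bound_of_continuousOn
    hc.continuousOn
  have h1 : ∀ u, ‖h u‖ ≤ C := fun u => by
    rw [← periodic_fract hp u]
    exact hC _ ⟨Int.fract_nonneg u, (Int.fract_lt_one u).le⟩
  exact ⟨C, (norm_nonneg _).trans (h1 0), h1⟩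

/-! ### Differentiability of the limit evolution in the parameter -/

namespace Evolution

variable {z₀ : ℝ → Plane} (ev : Evolution z₀)

theorem exists_norm_fam_inv_le : ∃ C : ℝ, 0 ≤ C ∧ ∀ t, 0 ≤ t → ‖ev.fam t‖ ≤ C ∧ ‖ev.inv t‖ ≤ C := by
  obtain ⟨c, K, hc, -, h, -⟩ := ev.exists_norm_gen_le
  refine ⟨max ((‖ev.fam 0‖ + 1) * Real.exp (c + 1)) ((‖ev.inv 0‖ + 1) * Real.exp (c + 1)),
    le_max_of_le_left (by positivity), fun t ht => ⟨le_max_of_le_left ?_, le_max_of_le_right ?_⟩⟩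
  · exact norm_le_of_norm_deriv_le_exp hc ev.hasDerivAt_fam (fun t ht =>
      (norm_mul_le _ _).trans (mul_le_mul_of_nonneg_right (h t ht) (norm_nonneg _))) ht
  · refine norm_le_of_norm_deriv_le_exp hc ev.hasDerivAt_inv (fun t ht => ?_) ht
    rw [norm_neg, mul_comm (c * _)]
    exact (norm_mul_le _ _).trans (mul_le_mul_of_nonneg_left (h t ht) (norm_nonneg _))

theorem continuous_f_right (hz : Continuous z₀) (t : ℝ) : Continuous (ev.f t) := by
  have h : Continuous (vec z₀ (ev.fam t)) :=
    continuous_snd.comp ((ev.fam t).continuous_at.clm_apply (hz.norm.prodMk hz))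
  unfold f fld
  fun_prop

theorem hasDerivAt_qn (hz : Continuous z₀) (t u : ℝ) :
    HasDerivAt (qn (ev.f t)) (‖ev.f t u‖ • -nf (ev.f t) u) u :=
  ((ev.perInt_f t).isPrim_qn (ev.len_f_pos t)).hasDerivAt
    ((ev.continuous_f_right hz t).norm.smul (ev.perInt_f t).nf_continuous.neg) u

/-- One factor `e^{-t}` comes from `‖f‖`, using that `z₀` is bounded, the other from the velocity,
which is at most half the length. -/
theorem exists_norm_deriv_qn_le (hz : Continuous z₀) : ∃ C : ℝ, 0 ≤ C ∧ ∀ t u, 0 ≤ t →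
    ‖‖ev.f t u‖ • -nf (ev.f t) u‖ ≤ C * Real.exp (-2 * t) := by
  obtain ⟨C, hC0, hC⟩ := ev.exists_norm_fam_inv_le
  obtain ⟨c, K, -, hK, -, hlen, -⟩ := ev.exists_norm_gen_le
  obtain ⟨R, hR0, hR⟩ := Function.Periodic.exists_norm_le ev.perInt.periodic hz
  refine ⟨C * R * (K / 2), by positivity, fun t u ht => ?_⟩
  rw [norm_smul, norm_norm, norm_neg, norm_f]
  have h1 : ev.E t u ≤ C * R := (ev.E_le t u).trans (by
    have := (hC t ht).1
    have := hR u
    gcongr)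
  have h2 : ‖nf (ev.f t) u‖ ≤ K * Real.exp (-t) / 2 :=
    ((ev.perInt_f t).norm_nf_le (ev.len_f_pos t) u).trans (by linarith [hlen t ht])
  calc _ ≤ Real.exp (-t) * (C * R) * (K * Real.exp (-t) / 2) := by gcongr
    _ = C * R * (K / 2) * (Real.exp (-t) * Real.exp (-t)) := by ring
    _ = _ := by rw [← Real.exp_add]; ring_nf

theorem exists_norm_qn_sub_le (hz : Continuous z₀) : ∃ C : ℝ, 0 ≤ C ∧ ∀ t u v, 0 ≤ t →
    ‖qn (ev.f t) v - qn (ev.f t) u‖ ≤ C * Real.exp (-2 * t) * ‖v - u‖ := by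
  obtain ⟨C, hC0, hC⟩ := ev.exists_norm_deriv_qn_le hz
  refine ⟨C, hC0, fun t u v ht => ?_⟩
  exact convex_univ.norm_image_sub_le_of_norm_hasDerivWithin_le
    (fun x _ => (ev.hasDerivAt_qn hz t x).hasDerivWithinAt) (fun x _ => hC t x ht)
    (Set.mem_univ u) (Set.mem_univ v)

/-- The derivative of the inverse evolution at `u` times the evolution at `v`. -/
def crossDeriv (u v t : ℝ) : Mink →L[ℝ] Mink :=
  (ev.inv t).at u * (boost (qn (ev.f t) v - qn (ev.f t) u)) * (ev.fam t).at v

theorem hasDerivAt_fam_at (t u : ℝ) : HasDerivAt (fun t => (ev.fam t).at u)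
    (boost (qn (ev.f t) u) * (ev.fam t).at u) t := by
  have h := (Fam.evalCLM u).hasFDerivAt.comp_hasDerivAt t (ev.hasDerivAt_fam t)
  rw [← ev.gen_at]
  exact h

theorem hasDerivAt_inv_at (t u : ℝ) : HasDerivAt (fun t => (ev.inv t).at u)
    (-((ev.inv t).at u * boost (qn (ev.f t) u))) t := by
  have h := (Fam.evalCLM u).hasFDerivAt.comp_hasDerivAt t (ev.hasDerivAt_inv t)
  rw [← ev.gen_at]
  exact h

/-- The generators at `u` and `v` enter with opposite signs, so only their difference remains. It is
small of order `v - u`, even though `fam` itself is only known to be continuous in the parameter. -/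
theorem hasDerivAt_cross (t u v : ℝ) : HasDerivAt (fun t => (ev.inv t).at u * (ev.fam t).at v)
    (ev.crossDeriv u v t) t := by
  refine ((ev.hasDerivAt_inv_at t u).mul (ev.hasDerivAt_fam_at t v)).congr_deriv ?_
  rw [crossDeriv, boost_sub]
  refine ContinuousLinearMap.ext fun w => ?_
  change -(ev.inv t).at u (boost (qn (ev.f t) u) ((ev.fam t).at v w)) +
    (ev.inv t).at u (boost (qn (ev.f t) v) ((ev.fam t).at v w)) = (ev.inv t).at u
      (boost (qn (ev.f t) v) ((ev.fam t).at v w) - boost (qn (ev.f t) u) ((ev.fam t).at v w))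
  rw [map_sub, neg_add_eq_sub]

theorem continuous_fam_at (u : ℝ) : Continuous fun t => (ev.fam t).at u :=
  (Fam.evalCLM u).continuous.comp ev.continuous_fam

theorem continuous_inv_at (u : ℝ) : Continuous fun t => (ev.inv t).at u :=
  (Fam.evalCLM u).continuous.comp ev.continuous_inv

theorem continuous_boost_qn (u : ℝ) : Continuous fun t => boost (qn (ev.f t) u) := by
  simp only [← ev.gen_at]
  exact (Fam.evalCLM u).continuous.comp ev.continuous_gen

theorem continuous_crossDeriv (u v : ℝ) : Continuous (ev.crossDeriv u v) := by
  have h : ev.crossDeriv u v = fun t => (ev.inv t).at u *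
      (boost (qn (ev.f t) v) - boost (qn (ev.f t) u)) * (ev.fam t).at v := by
    funext t; rw [crossDeriv, boost_sub]
  rw [h]
  exact ((ev.continuous_inv_at u).mul ((ev.continuous_boost_qn v).sub
    (ev.continuous_boost_qn u))).mul (ev.continuous_fam_at v)

theorem exists_norm_mul_boost_mul_le : ∃ C : ℝ, 0 ≤ C ∧ ∀ t u v p, 0 ≤ t →
    ‖(ev.inv t).at u * boost p * (ev.fam t).at v‖ ≤ C * ‖p‖ := by
  obtain ⟨C, hC0, hC⟩ := ev.exists_norm_fam_inv_le
  refine ⟨C * C, by positivity, fun t u v p ht => ?_⟩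
  obtain ⟨h1, h2⟩ := hC t ht
  calc _ ≤ ‖(ev.inv t).at u‖ * ‖boost p‖ * ‖(ev.fam t).at v‖ :=
        (norm_mul_le _ _).trans (mul_le_mul_of_nonneg_right (norm_mul_le _ _) (norm_nonneg _))
    _ ≤ C * ‖p‖ * C := by
        have := ((ev.inv t).norm_at_le u).trans h2
        have := ((ev.fam t).norm_at_le v).trans h1
        have := norm_boost_le p
        gcongr
    _ = _ := by ring

theorem integrableOn_exp_two (C : ℝ) :
    IntegrableOn (fun t => C * Real.exp (-2 * t)) (Set.Ioi 0) volume :=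
  (exp_neg_integrableOn_Ioi 0 two_pos).const_mul C

theorem exists_norm_crossDeriv_le (hz : Continuous z₀) : ∃ C : ℝ, 0 ≤ C ∧ ∀ u v t, 0 ≤ t →
    ‖ev.crossDeriv u v t‖ ≤ C * Real.exp (-2 * t) * ‖v - u‖ := by
  obtain ⟨C, hC0, hC⟩ := ev.exists_norm_mul_boost_mul_le
  obtain ⟨D, hD0, hD⟩ := ev.exists_norm_qn_sub_le hz
  refine ⟨C * D, by positivity, fun u v t ht => (hC t u v _ ht).trans ?_⟩
  calc _ ≤ C * (D * Real.exp (-2 * t) * ‖v - u‖) := by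
        have := hD t u v ht
        gcongr
    _ = _ := by ring

theorem integral_crossDeriv (hz : Continuous z₀) (u v : ℝ) :
    ∫ t in Set.Ioi (0 : ℝ), ev.crossDeriv u v t = ev.invLim.at u * ev.famLim.at v - 1 := by
  obtain ⟨C, hC0, hC⟩ := ev.exists_norm_crossDeriv_le hz
  have hint : IntegrableOn (ev.crossDeriv u v) (Set.Ioi 0) := by
    refine Integrable.mono' (integrableOn_exp_two (C * ‖v - u‖))
      (ev.continuous_crossDeriv u v).aestronglyMeasurable
      ((ae_restrict_iff' measurableSet_Ioi).2 (Eventually.of_forall fun t ht => ?_))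
    exact (hC u v t (le_of_lt ht)).trans_eq (by ring)
  have hlim : Tendsto (fun t => (ev.inv t).at u * (ev.fam t).at v) atTop
      (𝓝 (ev.invLim.at u * ev.famLim.at v)) :=
    (((Fam.evalCLM u).continuous.tendsto _).comp ev.tendsto_inv).mul
      (((Fam.evalCLM v).continuous.tendsto _).comp ev.tendsto_fam)
  have h := integral_Ioi_of_hasDerivAt_of_tendsto' (fun t _ => ev.hasDerivAt_cross t u v) hint hlim
  rw [h, ev.fam_zero, ev.inv_zero]
  rfl

/-- The logarithmic derivative of the limit of the evolution with respect to the parameter. -/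
def logDeriv (u : ℝ) : Mink →L[ℝ] Mink :=
  ∫ t in Set.Ioi (0 : ℝ),
    (ev.inv t).at u * boost (‖ev.f t u‖ • -nf (ev.f t) u) * (ev.fam t).at u

/-- The increment of the product is the time integral of `crossDeriv`. Its quotient by `v - u` is
dominated by `C e^{-2t}` and converges pointwise in `t`, since `q` is differentiable in the
parameter. -/
theorem hasDerivAt_invLim_mul (hz : Continuous z₀) (u : ℝ) :
    HasDerivAt (fun v => ev.invLim.at u * ev.famLim.at v) (ev.logDeriv u) u := by
  obtain ⟨C, hC0, hC⟩ := ev.exists_norm_crossDeriv_le hz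
  rw [hasDerivAt_iff_tendsto_slope]
  have e : slope (fun v => ev.invLim.at u * ev.famLim.at v) u = fun v =>
      ∫ t in Set.Ioi (0 : ℝ), (v - u)⁻¹ • ev.crossDeriv u v t := by
    funext v
    rw [integral_smul, ev.integral_crossDeriv hz, slope, vsub_eq_sub]
    have : ev.invLim.at u * ev.famLim.at u = 1 :=
      congrArg (fun x : Fam => x.at u) ev.invLim_mul_famLim
    rw [this]
  rw [e]
  refine tendsto_integral_filter_of_dominated_convergence
    (fun t => C * Real.exp (-2 * t)) ?_ ?_ (integrableOn_exp_two C) ?_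
  · exact Eventually.of_forall fun v =>
      (ev.continuous_crossDeriv u v).aestronglyMeasurable.const_smul ((v - u)⁻¹)
  · refine eventually_nhdsWithin_of_forall fun v hv => (ae_restrict_iff' measurableSet_Ioi).2
      (Eventually.of_forall fun t ht => ?_)
    have hne : 0 < ‖v - u‖ := norm_pos_iff.2 (sub_ne_zero.2 hv)
    rw [norm_smul, norm_inv, inv_mul_le_iff₀ hne, mul_comm]
    exact hC u v t (le_of_lt ht)
  · refine (ae_restrict_iff' measurableSet_Ioi).2 (Eventually.of_forall fun t _ => ?_)
    have h1 : Tendsto (slope (qn (ev.f t)) u) (𝓝[≠] u) (𝓝 (‖ev.f t u‖ • -nf (ev.f t) u)) :=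
      hasDerivAt_iff_tendsto_slope.1 (ev.hasDerivAt_qn hz t u)
    have h2 := (continuous_boost.tendsto _).comp h1
    have h3 : Tendsto (fun v => (ev.fam t).at v) (𝓝[≠] u) (𝓝 ((ev.fam t).at u)) :=
      ((ev.fam t).continuous_at.tendsto u).mono_left nhdsWithin_le_nhds
    refine ((tendsto_const_nhds.mul h2).mul h3).congr fun v => ?_
    simp only [Function.comp, slope, vsub_eq_sub, boost_smul, crossDeriv]
    refine ContinuousLinearMap.ext fun w => ?_
    exact map_smul ((ev.inv t).at u) ((v - u)⁻¹) _

theorem continuous_logDeriv (hz : Continuous z₀) : Continuous ev.logDeriv := by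
  obtain ⟨C, hC0, hC⟩ := ev.exists_norm_mul_boost_mul_le
  obtain ⟨D, hD0, hD⟩ := ev.exists_norm_deriv_qn_le hz
  refine continuous_of_dominated (bound := fun t => C * D * Real.exp (-2 * t)) (fun u => ?_)
    (fun u => ?_) (integrableOn_exp_two (C * D)) ?_
  · refine Continuous.aestronglyMeasurable (((ev.continuous_inv_at u).mul
      (continuous_boost.comp ?_)).mul (ev.continuous_fam_at u))
    exact (ev.continuous_f u).norm.smul (ev.continuous_nf u).neg
  · refine (ae_restrict_iff' measurableSet_Ioi).2 (Eventually.of_forall fun t ht => ?_)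
    refine (hC t u u _ (le_of_lt ht)).trans ?_
    rw [mul_assoc]
    exact mul_le_mul_of_nonneg_left (hD t u (le_of_lt ht)) hC0
  · refine Eventually.of_forall fun t => ((ev.inv t).continuous_at.mul
      (continuous_boost.comp ?_)).mul (ev.fam t).continuous_at
    exact (ev.continuous_f_right hz t).norm.smul (ev.perInt_f t).nf_continuous.neg

/-- Minkowski space is finite-dimensional, so the left inverse at each parameter is also a right
inverse. -/
theorem famLim_mul_invLim_at (u : ℝ) : ev.famLim.at u * ev.invLim.at u = 1 := by
  have h : ev.invLim.at u * ev.famLim.at u = 1 :=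
    congrArg (fun x : Fam => x.at u) ev.invLim_mul_famLim
  have h1 : (ev.invLim.at u).toLinearMap * (ev.famLim.at u).toLinearMap = 1 :=
    congrArg ContinuousLinearMap.toLinearMap h
  rw [mul_eq_one_comm] at h1
  exact ContinuousLinearMap.ext fun y => LinearMap.congr_fun h1 y

theorem hasDerivAt_famLim_at (hz : Continuous z₀) (u : ℝ) :
    HasDerivAt ev.famLim.at (ev.famLim.at u * ev.logDeriv u) u := by
  have h := (ev.hasDerivAt_invLim_mul hz u).const_mul (ev.famLim.at u)
  simp only [← mul_assoc, ev.famLim_mul_invLim_at, one_mul] at h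
  exact h

/-- The limit derivative is a `C¹` family applied to the lightlike lift of `z₀`. Immersedness enters
because the lift contains `‖z₀‖`. -/
theorem contDiff_Zlim (hz : ContDiff ℝ 1 z₀) (h0 : ∀ u, z₀ u ≠ 0) : ContDiff ℝ 1 ev.Zlim := by
  have h1 : ContDiff ℝ 1 ev.famLim.at :=
    contDiff_one_of_hasDerivAt (ev.hasDerivAt_famLim_at hz.continuous)
      (ev.famLim.continuous_at.mul (ev.continuous_logDeriv hz.continuous))
  have h2 : ContDiff ℝ 1 (light z₀) := (hz.norm ℝ h0).prodMk hz
  exact contDiff_snd.comp (h1.clm_apply h2)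

theorem memImm_two_limit (hz : ContDiff ℝ 1 z₀) (h0 : ∀ u, z₀ u ≠ 0) : MemImm 2 ev.limit := by
  have hd : deriv ev.limit = ev.Zlim := funext fun u => (ev.hasDerivAt_limit hz.continuous u).deriv
  refine ⟨⟨ev.limit_periodic, ?_⟩, fun u => by rw [hd]; exact ev.Zlim_ne_zero (h0 u)⟩
  have : ((2 : ℕ) : WithTop ℕ∞) = 1 + 1 := by norm_num
  rw [this, contDiff_succ_iff_deriv]
  refine ⟨fun u => (ev.hasDerivAt_limit hz.continuous u).differentiableAt, by simp, ?_⟩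
  rw [hd]
  exact ev.contDiff_Zlim hz h0

end Evolution

/-! ### Bounded curvature of closed `C²` immersions -/

theorem MemImm.exists_abs_curvature_le {γ : ℝ → Plane} (h : MemImm 2 γ) :
    ∃ C : ℝ, ∀ u, |curvature γ u| ≤ C := by
  have h2 : ContDiff ℝ (1 + 1) γ := by
    have : ((2 : ℕ) : WithTop ℕ∞) = 1 + 1 := by norm_num
    have h3 := h.1.2
    rwa [this] at h3
  have hd : ContDiff ℝ 1 (deriv γ) := (contDiff_succ_iff_deriv.1 h2).2.2
  have c1 := hd.continuous
  have c2 : Continuous (deriv (deriv γ)) := hd.continuous_deriv_one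
  have p1 := periodic_deriv h.1.1
  have p2 := periodic_deriv p1
  have hp : Function.Periodic (curvature γ) 1 := fun u => by simp only [curvature, p1 u, p2 u]
  have hc : Continuous (curvature γ) := by
    refine Continuous.div ?_ (c1.norm.pow 3) fun u => pow_ne_zero _ (norm_ne_zero_iff.2 (h.2 u))
    exact ((continuous_coord c1 0).mul (continuous_coord c2 1)).sub
      ((continuous_coord c1 1).mul (continuous_coord c2 0))
  obtain ⟨C, -, hC⟩ := Function.Periodic.exists_norm_le hp hc
  exact ⟨C, hC⟩

/-! ### Fourier series of the deficit and of its growth rate -/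

section Fourier

open Complex

local notation "μ₁" => volume.restrict (Set.Ioc (0 : ℝ) 1)

/-- The Fourier coefficients of a function on `[0, 1]`. -/
def fc (h : ℝ → ℂ) (n : ℤ) : ℂ := fourierCoeffOn (zero_lt_one' ℝ) h n

/-- The exponential with frequency `-n`. -/
def em (n : ℤ) (x : ℝ) : ℂ := Complex.exp (-(2 * Real.pi * I * n) * x)

theorem fc_eq (h : ℝ → ℂ) (n : ℤ) : fc h n = ∫ x in (0 : ℝ)..1, em n x * h x := by
  rw [fc, fourierCoeffOn_eq_integral]
  simp only [sub_zero, div_one, one_smul]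
  refine intervalIntegral.integral_congr fun x _ => ?_
  simp only [smul_eq_mul, em]
  rw [fourier_coe_apply]
  congr 2
  push_cast
  ring

theorem hasDerivAt_em (n : ℤ) (x : ℝ) :
    HasDerivAt (em n) (-(2 * Real.pi * I * n) * em n x) x := by
  have h := (((hasDerivAt_id x).ofReal_comp).const_mul (-(2 * Real.pi * I * n))).cexp
  refine h.congr_deriv ?_
  simp only [id, em]
  push_cast
  ring

theorem continuous_em (n : ℤ) : Continuous (em n) :=
  continuous_iff_continuousAt.2 fun x => (hasDerivAt_em n x).continuousAt

theorem em_zero (n : ℤ) : em n 0 = 1 := by simp [em]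

theorem em_one (n : ℤ) : em n 1 = 1 := by
  rw [em, Complex.exp_eq_one_iff]
  exact ⟨-n, by push_cast; ring⟩

theorem fc_add {h k : ℝ → ℂ} (hh : IntervalIntegrable h volume 0 1)
    (hk : IntervalIntegrable k volume 0 1) (n : ℤ) :
    fc (fun x => h x + k x) n = fc h n + fc k n := by
  simp only [fc_eq, mul_add]
  exact intervalIntegral.integral_add (hh.continuousOn_mul (continuous_em n).continuousOn)
    (hk.continuousOn_mul (continuous_em n).continuousOn)

theorem fc_const_mul (c : ℂ) (h : ℝ → ℂ) (n : ℤ) : fc (fun x => c * h x) n = c * fc h n := by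
  simp only [fc_eq, mul_left_comm _ c, intervalIntegral.integral_const_mul]

theorem fc_sub {h k : ℝ → ℂ} (hh : IntervalIntegrable h volume 0 1)
    (hk : IntervalIntegrable k volume 0 1) (n : ℤ) :
    fc (fun x => h x - k x) n = fc h n - fc k n := by
  simp only [fc_eq, mul_sub]
  exact intervalIntegral.integral_sub (hh.continuousOn_mul (continuous_em n).continuousOn)
    (hk.continuousOn_mul (continuous_em n).continuousOn)

theorem IsPrim.fc_eq {F φ : ℝ → ℂ} (h : IsPrim F φ) (h1 : F 1 = F 0) (n : ℤ) :
    fc φ n = 2 * Real.pi * I * n * fc F n := by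
  have he : IsPrim (em n) (fun x => -(2 * Real.pi * I * n) * em n x) :=
    isPrim_of_hasDerivAt (hasDerivAt_em n) (continuous_const.mul (continuous_em n))
  have hp := IsPrim.bilin (ContinuousLinearMap.mul ℝ ℂ) he h
  have h0 := hp.integral_eq_zero (by simp only [em_zero, em_one, h1])
  simp only [ContinuousLinearMap.mul_apply'] at h0
  have i1 : IntervalIntegrable (fun x => -(2 * Real.pi * I * n) * em n x * F x) volume 0 1 :=
    ((continuous_const.mul (continuous_em n)).mul h.continuous).intervalIntegrable _ _
  have i2 : IntervalIntegrable (fun x => em n x * φ x) volume 0 1 :=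
    (h.integrable 0 1).continuousOn_mul (continuous_em n).continuousOn
  rw [intervalIntegral.integral_add i1 i2] at h0
  simp only [mul_assoc _ (em n _), intervalIntegral.integral_const_mul] at h0
  rw [H1CSF.fc_eq, H1CSF.fc_eq]
  linear_combination h0

theorem re_conj_mul (a b : ℂ) :
    ((starRingEnd ℂ) a * b).re = (‖a + b‖ ^ 2 - ‖a - b‖ ^ 2) / 4 := by
  rw [Complex.sq_norm, Complex.sq_norm, Complex.normSq_apply, Complex.normSq_apply]
  simp only [Complex.mul_re, Complex.conj_re, Complex.conj_im, Complex.add_re, Complex.add_im,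
    Complex.sub_re, Complex.sub_im]
  ring

/-- Parseval's identity for `h + k` and `h - k`, combined by polarization. -/
theorem hasSum_re_conj_mul {h k : ℝ → ℂ} (hh : MemLp h 2 μ₁) (hk : MemLp k 2 μ₁) :
    HasSum (fun n => ((starRingEnd ℂ) (fc h n) * fc k n).re)
      (∫ x in (0 : ℝ)..1, ((starRingEnd ℂ) (h x) * k x).re) := by
  have ii : ∀ {g : ℝ → ℂ}, MemLp g 2 μ₁ → IntervalIntegrable g volume 0 1 := fun hg => by
    rw [intervalIntegrable_iff_integrableOn_Ioc_of_le zero_le_one]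
    exact hg.integrable one_le_two
  have iq : ∀ {g : ℝ → ℂ}, MemLp g 2 μ₁ →
      IntervalIntegrable (fun x => ‖g x‖ ^ 2) volume 0 1 := fun hg => by
    rw [intervalIntegrable_iff_integrableOn_Ioc_of_le zero_le_one]
    exact hg.integrable_norm_pow two_ne_zero
  have h1 := hasSum_sq_fourierCoeffOn (zero_lt_one' ℝ) (hh.add hk)
  have h2 := hasSum_sq_fourierCoeffOn (zero_lt_one' ℝ) (hh.sub hk)
  have h3 := (h1.sub h2).div_const 4
  simp only [sub_zero, inv_one, one_smul] at h3
  rw [← intervalIntegral.integral_sub (iq (hh.add hk)) (iq (hh.sub hk)),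
    ← intervalIntegral.integral_div] at h3
  have e1 : ∀ n, fourierCoeffOn (zero_lt_one' ℝ) (h + k) n = fc h n + fc k n :=
    fun n => fc_add (ii hh) (ii hk) n
  have e2 : ∀ n, fourierCoeffOn (zero_lt_one' ℝ) (h - k) n = fc h n - fc k n :=
    fun n => fc_sub (ii hh) (ii hk) n
  simp only [e1, e2, Pi.add_apply, Pi.sub_apply, ← re_conj_mul] at h3
  exact h3

theorem memLp_two_of_continuous {h : ℝ → ℂ} (hc : Continuous h) : MemLp h 2 μ₁ := by
  obtain ⟨K, hK⟩ := (isCompact_Icc (a := (0 : ℝ)) (b := 1)).exists_bound_of_continuousOn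
    hc.continuousOn
  exact MemLp.of_bound hc.aestronglyMeasurable K ((ae_restrict_iff' measurableSet_Ioc).2
    (Eventually.of_forall fun x hx => hK x (Set.Ioc_subset_Icc_self hx)))

theorem mul_self_sub_nonneg (n : ℤ) : (0 : ℝ) ≤ n * n - n := by
  have h : 0 ≤ n * n - n := by
    rcases le_or_gt n 0 with h | h
    · nlinarith
    · nlinarith [show (1 : ℤ) ≤ n from h]
  exact_mod_cast h

theorem re_conj_mul_self (c : ℝ) (z : ℂ) :
    ((starRingEnd ℂ) z * ((c : ℂ) * z)).re = c * Complex.normSq z := by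
  rw [Complex.normSq_apply]
  simp only [Complex.mul_re, Complex.conj_re, Complex.conj_im, Complex.mul_im, Complex.ofReal_re,
    Complex.ofReal_im]
  ring

/-- The coefficients of `η' - 2πi η` and `η'` are `2πi (n - 1)` and `2πi n` times those of `η`. The
weights `n² - n` are nonnegative at the integers, which is Hurwitz's proof of the isoperimetric
inequality. -/
theorem hasSum_deficit {η η' : ℝ → ℂ} (hη : IsPrim η η') (h1 : η 1 = η 0)
    (h2 : MemLp η' 2 μ₁) :
    HasSum (fun n : ℤ => 4 * Real.pi ^ 2 * (n * n - n) * Complex.normSq (fc η n))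
      (∫ x in (0 : ℝ)..1, ((starRingEnd ℂ) (η' x - 2 * Real.pi * I * η x) * η' x).re) := by
  have hc : MemLp (fun x => 2 * Real.pi * I * η x) 2 μ₁ :=
    memLp_two_of_continuous (continuous_const.mul hη.continuous)
  have ii : ∀ {g : ℝ → ℂ}, MemLp g 2 μ₁ → IntervalIntegrable g volume 0 1 := fun hg => by
    rw [intervalIntegrable_iff_integrableOn_Ioc_of_le zero_le_one]
    exact hg.integrable one_le_two
  have h := hasSum_re_conj_mul (h := fun x => η' x - 2 * Real.pi * I * η x) (h2.sub hc) h2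
  convert h using 1
  funext n
  rw [fc_sub (ii h2) (ii hc), fc_const_mul, hη.fc_eq h1, ← re_conj_mul_self]
  congr 1
  simp only [map_sub, map_mul, Complex.conj_I, Complex.conj_ofReal, map_ofNat, map_intCast]
  push_cast
  linear_combination (4 * Real.pi ^ 2 * (n * n - n) * (starRingEnd ℂ) (fc η n) * fc η n) * I_sq

/-- Here `π` solves `(1 - ∂_s²) π = η` and `κ = π_s`, so `L² η̂ = a π̂` with `a = L² + 4π² n²` in
frequency `n`. With `m = 4π² (n² - n)`, both sides times `L²` have the summands `4π² m a |π̂|²` and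
`m a² |π̂|²`. They compare because `m = 0` for `n = 0` and `a ≥ 4π²` otherwise. -/
theorem fourier_velocity_inequality {L : ℝ} (hL : 0 < L) {η η' π κ : ℝ → ℂ} (hη : IsPrim η η')
    (h1 : η 1 = η 0) (h2 : MemLp η' 2 μ₁) (hπ : IsPrim π fun x => L * κ x) (hπ1 : π 1 = π 0)
    (hκ : IsPrim κ fun x => L * (π x - η x)) (hκ1 : κ 1 = κ 0) :
    0 ≤ (∫ x in (0 : ℝ)..1, ((starRingEnd ℂ) (η' x - 2 * Real.pi * I * η x) * η' x).re) ∧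
    4 * Real.pi ^ 2 * (∫ x in (0 : ℝ)..1, ((starRingEnd ℂ) (η x) *
      (L ^ 2 * (η x - π x) + 2 * Real.pi * I * (L * κ x))).re) ≤
    L ^ 2 * ∫ x in (0 : ℝ)..1, ((starRingEnd ℂ) (η' x - 2 * Real.pi * I * η x) * η' x).re := by
  have hD := hasSum_deficit hη h1 h2
  have cη := hη.continuous
  have cπ := hπ.continuous
  have cκ := hκ.continuous
  refine ⟨hD.nonneg fun n => ?_, ?_⟩
  · have := mul_self_sub_nonneg n
    have := Complex.normSq_nonneg (fc η n)
    positivity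
  have hb := hasSum_re_conj_mul (memLp_two_of_continuous cη)
    (k := fun x => L ^ 2 * (η x - π x) + 2 * Real.pi * I * (L * κ x))
    (memLp_two_of_continuous (by fun_prop))
  have e1 : ∀ n : ℤ, L * fc κ n = 2 * Real.pi * I * n * fc π n := fun n => by
    rw [← fc_const_mul, hπ.fc_eq hπ1]
  have e2 : ∀ n : ℤ, L * (fc π n - fc η n) = 2 * Real.pi * I * n * fc κ n := fun n => by
    rw [← fc_sub (cπ.intervalIntegrable _ _) (cη.intervalIntegrable _ _), ← fc_const_mul,
      hκ.fc_eq hκ1]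
  have e3 : ∀ n : ℤ, (L : ℂ) ^ 2 * fc η n = ((L ^ 2 + 4 * Real.pi ^ 2 * (n * n) : ℝ) : ℂ) * fc π n :=
    fun n => by
    push_cast
    linear_combination (-(2 * Real.pi * I * n)) * e1 n - L * e2 n -
      (4 * Real.pi ^ 2 * n ^ 2 * fc π n) * I_sq
  have e4 : ∀ n : ℤ, fc (fun x => L ^ 2 * (η x - π x) + 2 * Real.pi * I * (L * κ x)) n =
      ((4 * Real.pi ^ 2 * (n * n - n) : ℝ) : ℂ) * fc π n := fun n => by
    rw [fc_add (Continuous.intervalIntegrable (by fun_prop) _ _)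
      (Continuous.intervalIntegrable (by fun_prop) _ _), fc_const_mul, fc_const_mul, fc_const_mul,
      fc_sub (cη.intervalIntegrable _ _) (cπ.intervalIntegrable _ _)]
    have := e3 n
    push_cast at this ⊢
    linear_combination this + (2 * Real.pi * I) * e1 n +
      (4 * Real.pi ^ 2 * n * fc π n) * I_sq
  have hb2 := hb.mul_left (4 * Real.pi ^ 2 * L ^ 2)
  have hD2 := hD.mul_left (L ^ 4)
  have key := hasSum_le (fun n => ?_) hb2 hD2
  · have hL2 : 0 < L ^ 2 := by positivity
    refine le_of_mul_le_mul_left ?_ hL2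
    calc _ = _ := by ring
      _ ≤ _ := key
      _ = _ := by ring
  · rw [e4]
    set p := Complex.normSq (fc π n)
    have hp : 0 ≤ p := Complex.normSq_nonneg _
    set a := L ^ 2 + 4 * Real.pi ^ 2 * (n * n)
    set m : ℝ := 4 * Real.pi ^ 2 * (n * n - n)
    have hm : 0 ≤ m := mul_nonneg (by positivity) (mul_self_sub_nonneg n)
    have e5 : L ^ 2 * ((starRingEnd ℂ) (fc η n) * ((m : ℂ) * fc π n)).re = a * (m * p) := by
      have h6 : (starRingEnd ℂ) ((L : ℂ) ^ 2 * fc η n) = a * (starRingEnd ℂ) (fc π n) := by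
        rw [e3 n, map_mul, Complex.conj_ofReal]
      rw [map_mul, map_pow, Complex.conj_ofReal] at h6
      rw [← re_conj_mul_self, ← Complex.re_ofReal_mul, ← Complex.re_ofReal_mul]
      congr 1
      push_cast
      linear_combination ((m : ℂ) * fc π n) * h6
    have e6 : L ^ 4 * Complex.normSq (fc η n) = a ^ 2 * p := by
      have h7 := congrArg Complex.normSq (e3 n)
      rw [Complex.normSq_mul, Complex.normSq_mul, ← Complex.ofReal_pow, Complex.normSq_ofReal,
        Complex.normSq_ofReal] at h7
      linear_combination h7
    calc _ = 4 * Real.pi ^ 2 * (L ^ 2 * ((starRingEnd ℂ) (fc η n) * ((m : ℂ) * fc π n)).re) := by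
          ring
      _ = 4 * Real.pi ^ 2 * (a * (m * p)) := by rw [e5]
      _ ≤ a * (a * (m * p)) := by
          rcases eq_or_ne n 0 with hn | hn
          · have : m = 0 := by simp [m, hn]
            simp [this]
          · have hn2 : (1 : ℝ) ≤ n * n := by
              have : 1 ≤ n * n := by
                rcases lt_or_gt_of_ne hn with h | h <;> nlinarith
              exact_mod_cast this
            have ha : 4 * Real.pi ^ 2 ≤ a := by
              simp only [a]
              nlinarith [sq_nonneg L, sq_nonneg Real.pi]
            have : 0 ≤ a := le_trans (by positivity) ha
            gcongr
      _ = m * (a ^ 2 * p) := by ring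
      _ = _ := by rw [← e6]; ring

end Fourier

/-! ### The determinant and complex notation -/

section Wedge

/-- The determinant of two vectors of the plane, as a bilinear form. -/
def wedge : Plane →L[ℝ] Plane →L[ℝ] ℝ :=
  (ContinuousLinearMap.mul ℝ ℝ).bilinearComp (EuclideanSpace.proj (0 : Fin 2))
    (EuclideanSpace.proj (1 : Fin 2)) -
  (ContinuousLinearMap.mul ℝ ℝ).bilinearComp (EuclideanSpace.proj (1 : Fin 2))
    (EuclideanSpace.proj (0 : Fin 2))

theorem wedge_apply (x y : Plane) : wedge x y = x 0 * y 1 - x 1 * y 0 := rfl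

theorem abs_wedge_le (x y : Plane) : |wedge x y| ≤ ‖x‖ * ‖y‖ := by
  refine abs_le_of_sq_le_sq ?_ (by positivity)
  have h1 : ‖x‖ ^ 2 = x 0 * x 0 + x 1 * x 1 := by rw [← real_inner_self_eq_norm_sq, inner_plane]
  have h2 : ‖y‖ ^ 2 = y 0 * y 0 + y 1 * y 1 := by rw [← real_inner_self_eq_norm_sq, inner_plane]
  rw [mul_pow, h1, h2, wedge_apply]
  nlinarith [sq_nonneg (x 0 * y 0 + x 1 * y 1)]

theorem wedge_self (x : Plane) : wedge x x = 0 := by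
  rw [wedge_apply]; ring

theorem wedge_swap (x y : Plane) : wedge y x = -wedge x y := by
  rw [wedge_apply, wedge_apply]; ring

/-- The identification of the plane with the complex numbers. -/
def toC : Plane →L[ℝ] ℂ :=
  (EuclideanSpace.proj (0 : Fin 2) : Plane →L[ℝ] ℝ).smulRight (1 : ℂ) +
  (EuclideanSpace.proj (1 : Fin 2) : Plane →L[ℝ] ℝ).smulRight Complex.I

theorem toC_re (x : Plane) : (toC x).re = x 0 := by simp [toC]

theorem toC_im (x : Plane) : (toC x).im = x 1 := by simp [toC]

theorem intervalIntegrable_wedge {γ f : ℝ → Plane} (hγ : Continuous γ) {a b : ℝ}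
    (hf : IntervalIntegrable f volume a b) :
    IntervalIntegrable (fun u => wedge (γ u) (f u)) volume a b :=
  intervalIntegrable_clm_apply (wedge.continuous.comp hγ) hf

end Wedge

/-! ### Lipschitz curves and quadratic estimates -/

section Calculus

variable {E E' : Type*} [NormedAddCommGroup E] [NormedSpace ℝ E]
  [NormedAddCommGroup E'] [NormedSpace ℝ E']

theorem IsPrim.clm [CompleteSpace E] [CompleteSpace E'] {F f : ℝ → E} (h : IsPrim F f)
    (T : E →L[ℝ] E') : IsPrim (fun u => T (F u)) (fun u => T (f u)) :=
  ⟨fun a b => by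
    have := h.integrable a b
    rw [intervalIntegrable_iff] at this ⊢
    exact T.integrable_comp this, fun a b => by
    rw [T.intervalIntegral_comp_comm (h.integrable a b), ← h.sub_eq, map_sub]⟩

theorem isPrim_deriv_of_lipschitzWith [FiniteDimensional ℝ E] {F : ℝ → E} {K : NNReal}
    (h : LipschitzWith K F) : IsPrim F (deriv F) := by
  have : CompleteSpace E := FiniteDimensional.complete ℝ E
  have hid : IsPrim (fun u : ℝ => u) (fun _ => (1 : ℝ)) :=
    isPrim_of_hasDerivAt (fun u => hasDerivAt_id u) continuous_const
  refine isPrim_of_absolutelyContinuous (fun a b => ?_) (fun a b => ?_) ?_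
  · refine (intervalIntegrable_const (c := (K : ℝ))).mono_fun'
      (aestronglyMeasurable_deriv F _) (Eventually.of_forall fun u => ?_)
    exact norm_deriv_le_of_lipschitz h
  · exact absolutelyContinuous_of_dist_le (hid.absolutelyContinuous a b)
      (C := K) fun x _ y _ => h.dist_le_mul x y
  · filter_upwards [h.ae_differentiableAt] with u hu using hu.hasDerivAt

/-- Increments of quadratic order force the derivative to vanish everywhere. -/
theorem eq_of_abs_sub_le_sq {k : ℝ → ℝ} {C : ℝ}
    (h : ∀ a b, a ≤ b → |k b - k a| ≤ C * (b - a) ^ 2) (a b : ℝ) : k a = k b := by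
  have h' : ∀ a b, |k b - k a| ≤ C * (b - a) ^ 2 := fun a b => by
    rcases le_total a b with hab | hab
    · exact h a b hab
    · rw [abs_sub_comm]
      exact (h b a hab).trans_eq (by ring)
  have hd : ∀ x, HasDerivAt k 0 x := fun x => by
    rw [hasDerivAt_iff_isLittleO]
    simp only [smul_zero, sub_zero]
    have h1 : (fun y => k y - k x) =O[𝓝 x] fun y => (y - x) ^ 2 :=
      Asymptotics.IsBigO.of_bound C (Eventually.of_forall fun y => by
        rw [Real.norm_eq_abs, Real.norm_eq_abs, abs_of_nonneg (sq_nonneg (y - x))]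
        exact h' x y)
    refine h1.trans_isLittleO ?_
    have h2 : Tendsto (fun y => y - x) (𝓝 x) (𝓝 0) := by
      have : Continuous fun y : ℝ => y - x := by fun_prop
      simpa using this.tendsto x
    have h3 := (Asymptotics.isLittleO_pow_id (𝕜 := ℝ) one_lt_two).comp_tendsto h2
    exact h3
  exact is_const_of_deriv_eq_zero (fun x => (hd x).differentiableAt) (fun x => (hd x).deriv) a b

/-- Freezing `γ` at `a` gives the determinant of the end points exactly; the remainder is at most
the displacement times the length of the arc. -/
theorem IsPrim.abs_integral_wedge_sub_le {γ f : ℝ → Plane} (h : IsPrim γ f) {a b : ℝ}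
    (hab : a ≤ b) :
    |(∫ u in a..b, wedge (γ u) (f u)) - wedge (γ a) (γ b)| ≤ (∫ u in a..b, ‖f u‖) ^ 2 := by
  have hi := h.integrable a b
  have h1 : wedge (γ a) (γ b) = ∫ u in a..b, wedge (γ a) (f u) := by
    rw [(wedge (γ a)).intervalIntegral_comp_comm hi, ← h.sub_eq, map_sub, wedge_self, sub_zero]
  rw [h1, ← intervalIntegral.integral_sub (intervalIntegrable_wedge h.continuous hi)
    (intervalIntegrable_wedge continuous_const hi), sq, ← intervalIntegral.integral_const_mul,
    ← Real.norm_eq_abs]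
  refine intervalIntegral.norm_integral_le_of_norm_le hab (Eventually.of_forall fun u hu => ?_)
    (hi.norm.const_mul _)
  rw [← sub_apply, ← map_sub, Real.norm_eq_abs]
  refine (abs_wedge_le _ _).trans (mul_le_mul_of_nonneg_right ?_ (norm_nonneg _))
  rw [h.sub_eq]
  refine (intervalIntegral.norm_integral_le_integral_norm hu.1.le).trans ?_
  exact intervalIntegral.integral_mono_interval le_rfl hu.1.le hu.2
    (Eventually.of_forall fun _ => norm_nonneg _) hi.norm

end Calculus

/-! ### Reparametrization by arclength -/

section ArclengthParametrization

variable {f : ℝ → Plane}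

theorem PerInt.arc_int (hf : PerInt f) (n : ℤ) : arc f n = n * len f := by
  have hp : Function.Periodic (fun u => arc f u - u * len f) 1 := fun u => by
    simp only [hf.arc_add_one]; ring
  have := hp.int_mul n 0
  simp only [arc_zero, zero_mul, sub_zero, zero_add, mul_one] at this
  linarith

/-- The intermediate value theorem between the integers next to `s`. Arclength may be constant on
intervals, so the preimages of `0` and `1` are fixed explicitly. -/
theorem PerInt.exists_arc_eq (hf : PerInt f) (hl : 0 < len f) (s : ℝ) :
    ∃ u, arc f u = s * len f ∧ (s = 0 → u = 0) ∧ (s = 1 → u = 1) := by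
  by_cases h0 : s = 0
  · exact ⟨0, by simp [h0, arc_zero], fun _ => rfl, fun h => absurd (h0.symm.trans h) zero_ne_one⟩
  by_cases h1 : s = 1
  · exact ⟨1, by simp [h1, arc_one], fun h => absurd h h0, fun _ => rfl⟩
  obtain ⟨u, hu⟩ := mem_range_of_exists_le_of_exists_ge hf.continuous_arc
    (c := s * len f)
    ⟨⌊s⌋, by rw [hf.arc_int]; exact mul_le_mul_of_nonneg_right (Int.floor_le s) hl.le⟩
    ⟨⌈s⌉, by rw [hf.arc_int]; exact mul_le_mul_of_nonneg_right (Int.le_ceil s) hl.le⟩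
  exact ⟨u, hu, fun h => absurd h h0, fun h => absurd h h1⟩

/-- `r` is a right inverse of the normalized arclength. -/
structure IsArcInverse (f : ℝ → Plane) (r : ℝ → ℝ) : Prop where
  arc_eq : ∀ s, arc f (r s) = s * len f
  zero : r 0 = 0
  one : r 1 = 1

theorem PerInt.exists_isArcInverse (hf : PerInt f) (hl : 0 < len f) : ∃ r, IsArcInverse f r := by
  choose r h1 h2 h3 using hf.exists_arc_eq hl
  exact ⟨r, h1, h2 0 rfl, h3 1 rfl⟩

/-- `φ` is Lipschitz with respect to arclength. -/
def ArcLip {E : Type*} [NormedAddCommGroup E] (f : ℝ → Plane) (φ : ℝ → E) (C : ℝ) : Prop :=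
  ∀ a b, ‖φ b - φ a‖ ≤ C * |arc f b - arc f a|

variable {E : Type*} [NormedAddCommGroup E]

theorem PerInt.arcLip [NormedSpace ℝ E] (hf : PerInt f) {φ φ' : ℝ → E} (h : IsPrim φ φ') {C : ℝ}
    (hC : ∀ u, ‖φ' u‖ ≤ C * ‖f u‖) : ArcLip f φ C := fun a b => by
  have key : ∀ a b, a ≤ b → ‖φ b - φ a‖ ≤ C * |arc f b - arc f a| := fun a b hab => by
    rw [abs_of_nonneg (sub_nonneg.2 (hf.monotone_arc hab)), h.sub_eq, hf.arc_sub,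
      ← intervalIntegral.integral_const_mul]
    exact intervalIntegral.norm_integral_le_of_norm_le hab
      (Eventually.of_forall fun u _ => hC u) ((hf.intervalIntegrable a b).norm.const_mul _)
  rcases le_total a b with hab | hab
  · exact key a b hab
  · rw [norm_sub_rev, abs_sub_comm]
    exact key b a hab

theorem ArcLip.bilin [NormedSpace ℝ E] {B : E →L[ℝ] E →L[ℝ] ℝ} (hB : ∀ x y, ‖B x y‖ ≤ ‖x‖ * ‖y‖)
    {φ ψ : ℝ → E} {C C' M M' : ℝ} (hφ : ArcLip f φ C) (hψ : ArcLip f ψ C') (hM : ∀ u, ‖φ u‖ ≤ M)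
    (hM' : ∀ u, ‖ψ u‖ ≤ M') : ArcLip f (fun u => B (φ u) (ψ u)) (C * M' + M * C') := fun a b => by
  have e : B (φ b) (ψ b) - B (φ a) (ψ a) = B (φ b - φ a) (ψ b) + B (φ a) (ψ b - ψ a) := by
    simp only [map_sub, sub_apply]; ring
  simp only [e]
  refine (norm_add_le _ _).trans ?_
  have h1 := (hB (φ b - φ a) (ψ b)).trans
    (mul_le_mul (hφ a b) (hM' b) (norm_nonneg _) ((norm_nonneg _).trans (hφ a b)))
  have h2 := (hB (φ a) (ψ b - ψ a)).trans
    (mul_le_mul (hM a) (hψ a b) (norm_nonneg _) ((norm_nonneg _).trans (hM a)))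
  linarith

variable {r : ℝ → ℝ}

theorem IsArcInverse.lipschitz (hr : IsArcInverse f r) (hl : 0 < len f) {φ : ℝ → E} {C : ℝ}
    (hφ : ArcLip f φ C) : LipschitzWith (C * len f).toNNReal fun s => φ (r s) := by
  refine LipschitzWith.of_dist_le' fun s t => ?_
  rw [dist_eq_norm, Real.dist_eq]
  refine (hφ (r t) (r s)).trans_eq ?_
  rw [hr.arc_eq, hr.arc_eq, ← sub_mul, abs_mul, abs_of_pos hl]
  ring

/-- The inverse `r` may jump, but only across intervals of constant arclength, and there `φ` is
constant. -/
theorem IsArcInverse.comp_arc (hr : IsArcInverse f r) (hl : 0 < len f) {φ : ℝ → E} {C : ℝ}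
    (hφ : ArcLip f φ C) (u : ℝ) : φ (r (arc f u / len f)) = φ u := by
  have h := hφ u (r (arc f u / len f))
  rw [hr.arc_eq, div_mul_cancel₀ _ hl.ne', sub_self, abs_zero, mul_zero] at h
  exact sub_eq_zero.1 (norm_le_zero_iff.1 h)

theorem IsArcInverse.integral_smul [NormedSpace ℝ E] [CompleteSpace E] (hr : IsArcInverse f r) (hf : PerInt f)
    (hl : 0 < len f) {φ : ℝ → E} {C : ℝ} (hφ : ArcLip f φ C) (a b : ℝ) :
    ∫ u in (r a)..(r b), ‖f u‖ • φ u = len f • ∫ s in a..b, φ (r s) := by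
  have hc : Continuous fun s => φ (r s) := (hr.lipschitz hl hφ).continuous
  have h := hf.isPrim_arc.integral_smul_comp (φ := fun σ => φ (r (σ / len f)))
    (hc.comp (continuous_id.div_const _))
    (r a) (r b)
  simp only [hr.comp_arc hl hφ, hr.arc_eq] at h
  rw [h, intervalIntegral.integral_comp_div (fun s => φ (r s)) hl.ne', mul_div_cancel_right₀ _ hl.ne',
    mul_div_cancel_right₀ _ hl.ne']

theorem IsArcInverse.isPrim [NormedSpace ℝ E] [CompleteSpace E] (hr : IsArcInverse f r) (hf : PerInt f)
    (hl : 0 < len f) {φ ψ : ℝ → E} {C : ℝ} (h : IsPrim φ fun u => ‖f u‖ • ψ u)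
    (hψ : ArcLip f ψ C) : IsPrim (fun s => φ (r s)) fun s => len f • ψ (r s) := by
  have hc : Continuous fun s => ψ (r s) := (hr.lipschitz hl hψ).continuous
  refine ⟨fun a b => (hc.const_smul _).intervalIntegrable a b, fun a b => ?_⟩
  rw [h.sub_eq, hr.integral_smul hf hl hψ, intervalIntegral.integral_smul]

/-- The substitution formula for continuous integrands does not apply, since derivatives of the
curve occur. Instead, over corresponding arcs both integrals differ from the same determinant of end
points by at most the square of the arclength, so their difference is constant. -/
theorem IsArcInverse.integral_wedge (hr : IsArcInverse f r) (hf : PerInt f) (hl : 0 < len f)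
    {γ : ℝ → Plane} (h : IsPrim γ f) (hη : IsPrim (fun s => γ (r s)) (deriv fun s => γ (r s)))
    (hd : ∀ s, ‖deriv (fun s => γ (r s)) s‖ ≤ len f) :
    ∫ s in (0 : ℝ)..1, wedge (γ (r s)) (deriv (fun s => γ (r s)) s) =
      ∫ u in (0 : ℝ)..1, wedge (γ u) (f u) := by
  set η' := deriv fun s => γ (r s)
  have i1 : ∀ a b, IntervalIntegrable (fun s => wedge (γ (r s)) (η' s)) volume a b := fun a b =>
    intervalIntegrable_wedge hη.continuous (hη.integrable a b)
  have i2 : ∀ a b, IntervalIntegrable (fun u => wedge (γ u) (f u)) volume a b := fun a b =>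
    intervalIntegrable_wedge h.continuous (hf.intervalIntegrable a b)
  have hmono : ∀ a b, a ≤ b → r a ≤ r b := fun a b hab => by
    rcases hab.eq_or_lt with rfl | hab
    · exact le_rfl
    by_contra! hlt
    have := hf.monotone_arc hlt.le
    rw [hr.arc_eq, hr.arc_eq] at this
    nlinarith
  have key := eq_of_abs_sub_le_sq (C := 2 * len f ^ 2)
    (k := fun s => (∫ x in (0 : ℝ)..s, wedge (γ (r x)) (η' x)) -
      ∫ u in (0 : ℝ)..(r s), wedge (γ u) (f u)) (fun a b hab => ?_) 0 1
  · simp only [intervalIntegral.integral_same, hr.zero, hr.one, sub_zero] at key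
    linarith
  · have h1 := hη.abs_integral_wedge_sub_le hab
    have h2 := h.abs_integral_wedge_sub_le (hmono a b hab)
    have h3 : ∫ s in a..b, ‖η' s‖ ≤ (b - a) * len f := by
      have := intervalIntegral.integral_mono_on hab (hη.integrable a b).norm
        (intervalIntegrable_const (c := len f)) fun s _ => hd s
      simpa using this
    have h4 : ∫ u in (r a)..(r b), ‖f u‖ = (b - a) * len f := by
      rw [← hf.arc_sub, hr.arc_eq, hr.arc_eq, sub_mul]
    have h5 : 0 ≤ ∫ s in a..b, ‖η' s‖ :=
      intervalIntegral.integral_nonneg hab fun _ _ => norm_nonneg _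
    have e1 := intervalIntegral.integral_interval_sub_left (i1 0 b) (i1 0 a)
    have e2 := intervalIntegral.integral_interval_sub_left (i2 0 (r b)) (i2 0 (r a))
    rw [h4] at h2
    have h6 := pow_le_pow_left₀ h5 h3 2
    rw [abs_le] at h1 h2 ⊢
    constructor <;> nlinarith

end ArclengthParametrization

/-! ### The isoperimetric inequality and the growth of the deficit -/

section IsoperimetricInequality

variable {f γ : ℝ → Plane}

/-- Integration by parts replaces `f` by `γ` and the derivative of `q` by the velocity; the new
integrand is continuous apart from `‖f‖`, so it can be transferred to arclength. -/
theorem PerInt.integral_inner_qn (hf : PerInt f) (hl : 0 < len f) (h : IsPrim γ f)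
    (hp : Function.Periodic γ 1) :
    ∫ u in (0 : ℝ)..1, inner ℝ (qn f u) (f u) =
      ∫ u in (0 : ℝ)..1, ‖f u‖ • (inner ℝ (γ u) (nf f u) : ℝ) := by
  have hb := (h.bilin (innerSL ℝ) (hf.isPrim_qn hl)).integral_eq_zero (by
    have h1 := hp 0
    have h2 := hf.qn_periodic 0
    rw [zero_add] at h1 h2
    rw [h1, h2])
  have i1 : IntervalIntegrable (fun u => (inner ℝ (qn f u) (f u) : ℝ)) volume 0 1 :=
    intervalIntegrable_clm_apply (A := fun u => innerSL ℝ (qn f u))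
      ((innerSL ℝ).continuous.comp hf.qn_continuous)
      (hf.intervalIntegrable 0 1)
  have i2 : IntervalIntegrable (fun u => ‖f u‖ • (inner ℝ (γ u) (nf f u) : ℝ)) volume 0 1 :=
    (hf.intervalIntegrable 0 1).norm.mul_continuousOn
      (h.continuous.inner hf.nf_continuous).continuousOn
  rw [← sub_eq_zero, ← intervalIntegral.integral_sub i1 i2]
  refine (intervalIntegral.integral_congr fun u _ => ?_).trans hb
  change inner ℝ (qn f u) (f u) - ‖f u‖ * inner ℝ (γ u) (nf f u) =
    inner ℝ (f u) (qn f u) + inner ℝ (γ u) (‖f u‖ • -nf f u)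
  rw [real_inner_comm, inner_smul_right, inner_neg_right]
  ring

-- The Fourier inequalities are applied to the constant-speed curve `γ ∘ r`, with `π` the smoothed
-- curve `γ - nf f` and `κ` the convolution `q`. The conclusion is expressed in the original
-- parametrization, because the flow preserves the parameter and not arclength.
set_option maxHeartbeats 1000000 in
theorem isoperimetric_and_velocity_inequality (hf : PerInt f) (hl : 0 < len f) (h : IsPrim γ f)
    (hp : Function.Periodic γ 1) :
    0 ≤ len f ^ 2 - 2 * Real.pi * ∫ u in (0 : ℝ)..1, wedge (γ u) (f u) ∧
    4 * Real.pi ^ 2 * (len f * (∫ u in (0 : ℝ)..1, inner ℝ (qn f u) (f u)) -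
        2 * Real.pi * ∫ u in (0 : ℝ)..1, ‖f u‖ * wedge (γ u) (qn f u)) ≤
      len f ^ 2 * (len f ^ 2 - 2 * Real.pi * ∫ u in (0 : ℝ)..1, wedge (γ u) (f u)) := by
  obtain ⟨r, hr⟩ := hf.exists_isArcInverse hl
  have hγL : ArcLip f γ 1 := hf.arcLip h fun u => by rw [one_mul]
  have hq := hf.isPrim_qn hl
  have hqL : ArcLip f (qn f) (len f / 2) := hf.arcLip hq fun u => by
    rw [norm_smul, norm_neg, norm_norm, mul_comm]
    exact mul_le_mul_of_nonneg_right (hf.norm_nf_le hl u) (norm_nonneg _)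
  have hP : IsPrim (fun u => γ u - nf f u) fun u => ‖f u‖ • qn f u :=
    (h.sub (hf.isPrim_nf hl)).congr_ae (Eventually.of_forall fun u => by abel)
  have hPL : ArcLip f (fun u => γ u - nf f u) 1 := hf.arcLip hP fun u => by
    rw [norm_smul, norm_norm, mul_comm]
    exact mul_le_mul_of_nonneg_right (hf.norm_qn_le_one hl u) (norm_nonneg _)
  have hNL : ArcLip f (fun u => -nf f u) 2 := fun a b => by
    have h1 := hPL a b
    have h2 := hγL a b
    calc ‖-nf f b - -nf f a‖ = ‖(γ b - nf f b - (γ a - nf f a)) - (γ b - γ a)‖ := by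
          congr 1; abel
      _ ≤ _ := (norm_sub_le _ _).trans (by linarith)
  have hηlip := hr.lipschitz hl hγL
  have hη := isPrim_deriv_of_lipschitzWith hηlip
  have hd : ∀ s, ‖deriv (fun s => γ (r s)) s‖ ≤ len f := fun s => by
    refine (norm_deriv_le_of_lipschitz hηlip).trans_eq ?_
    rw [one_mul, Real.coe_toNNReal _ hl.le]
  have hκ := hr.isPrim hf hl hq hNL
  have hπ := hr.isPrim hf hl hP hqL
  have hend : ∀ {φ : ℝ → Plane}, Function.Periodic φ 1 → φ (r 1) = φ (r 0) := fun hφ => by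
    rw [hr.one, hr.zero]; simpa using hφ 0
  have hA := hr.integral_wedge hf hl h hη hd
  set η' := deriv fun s => γ (r s)
  have cη := hη.continuous
  have cκ := hκ.continuous
  have cπ := hπ.continuous
  have cw : Continuous fun z : Plane × Plane => wedge z.1 z.2 :=
    wedge.isBoundedBilinearMap.continuous
  have cwη : Continuous fun s => wedge (γ (r s)) (qn f (r s)) := cw.comp (cη.prodMk cκ)
  obtain ⟨M, -, hM⟩ := Function.Periodic.exists_norm_le hp h.continuous
  have k1 : ∫ u in (0 : ℝ)..1, inner ℝ (qn f u) (f u) =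
      len f * ∫ s in (0 : ℝ)..1, inner ℝ (γ (r s)) (γ (r s) - (γ (r s) - nf f (r s))) := by
    rw [hf.integral_inner_qn hl h hp, ← smul_eq_mul]
    have hB : ∀ x y : Plane, ‖innerSL ℝ x y‖ ≤ ‖x‖ * ‖y‖ := fun x y => norm_inner_le_norm x y
    have := hr.integral_smul hf hl (hγL.bilin hB hNL hM fun u => (norm_neg _).trans_le
      (hf.norm_nf_le hl u)) 0 1
    rw [hr.zero, hr.one] at this
    simp only [map_neg, smul_neg, intervalIntegral.integral_neg, neg_inj] at this
    simp only [sub_sub_cancel]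
    exact this
  have k2 : ∫ u in (0 : ℝ)..1, ‖f u‖ * wedge (γ u) (qn f u) =
      len f * ∫ s in (0 : ℝ)..1, wedge (γ (r s)) (qn f (r s)) := by
    have := hr.integral_smul hf hl (hγL.bilin abs_wedge_le hqL hM (hf.norm_qn_le_one hl)) 0 1
    rw [hr.zero, hr.one] at this
    exact this
  have m2 : MemLp (fun s => toC (η' s)) 2 (volume.restrict (Set.Ioc (0 : ℝ) 1)) := by
    refine MemLp.of_bound ?_ (‖toC‖ * len f) (Eventually.of_forall fun s =>
      toC.le_opNorm_of_le (hd s))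
    exact toC.continuous.comp_aestronglyMeasurable (aestronglyMeasurable_deriv _ _)
  obtain ⟨F1, F2⟩ := fourier_velocity_inequality hl (hη.clm toC)
    (congrArg toC (hend hp)) m2 (π := fun s => toC (γ (r s) - nf f (r s)))
    (κ := fun s => toC (qn f (r s)))
    ((hπ.clm toC).congr_ae (Eventually.of_forall fun s => by
      rw [map_smul, Complex.real_smul]))
    (congrArg toC (hend (φ := fun u => γ u - nf f u) fun u => by
      simp only [hp u, hf.nf_periodic u]))
    ((hκ.clm toC).congr_ae (Eventually.of_forall fun s => by
      rw [map_smul, Complex.real_smul, ← map_sub]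
      congr 2
      abel))
    (congrArg toC (hend hf.qn_periodic))
  -- The bound `‖η'‖ ≤ len f` suffices in the direction needed; that the speed equals `len f` almost
  -- everywhere is not required.
  have k3 : ∫ x in (0 : ℝ)..1, ((starRingEnd ℂ) (toC (η' x) - 2 * Real.pi * Complex.I *
      toC (γ (r x))) * toC (η' x)).re ≤
      len f ^ 2 - 2 * Real.pi * ∫ u in (0 : ℝ)..1, wedge (γ u) (f u) := by
    have e : ∀ x, ((starRingEnd ℂ) (toC (η' x) - 2 * Real.pi * Complex.I *
        toC (γ (r x))) * toC (η' x)).re =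
        ‖η' x‖ ^ 2 - 2 * Real.pi * wedge (γ (r x)) (η' x) := fun x => by
      rw [← real_inner_self_eq_norm_sq, inner_plane, wedge_apply]
      simp only [Complex.mul_re, Complex.mul_im, Complex.conj_re, Complex.conj_im,
        Complex.sub_re, Complex.sub_im, Complex.ofReal_re, Complex.ofReal_im, Complex.I_re,
        Complex.I_im, toC_re, toC_im, Complex.re_ofNat, Complex.im_ofNat]
      ring
    simp only [e]
    have i1 : IntervalIntegrable (fun x => ‖η' x‖ ^ 2) volume 0 1 := by
      refine (intervalIntegrable_const (c := len f ^ 2)).mono_fun'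
        ((aestronglyMeasurable_deriv _ _).norm.pow 2) (Eventually.of_forall fun s => ?_)
      simp only [norm_pow, norm_norm]
      exact pow_le_pow_left₀ (norm_nonneg _) (hd s) 2
    have i2 := (intervalIntegrable_wedge cη (hη.integrable 0 1)).const_mul (2 * Real.pi)
    rw [intervalIntegral.integral_sub i1 i2, intervalIntegral.integral_const_mul, hA]
    have := intervalIntegral.integral_mono_on zero_le_one i1
      (intervalIntegrable_const (c := len f ^ 2)) fun s _ =>
        pow_le_pow_left₀ (norm_nonneg _) (hd s) 2
    simp only [intervalIntegral.integral_const, sub_zero, one_smul] at this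
    linarith
  have k4 : ∫ x in (0 : ℝ)..1, ((starRingEnd ℂ) (toC (γ (r x))) *
      (len f ^ 2 * (toC (γ (r x)) - toC (γ (r x) - nf f (r x))) +
        2 * Real.pi * Complex.I * (len f * toC (qn f (r x))))).re =
      len f ^ 2 * (∫ s in (0 : ℝ)..1, inner ℝ (γ (r s)) (γ (r s) - (γ (r s) - nf f (r s)))) -
        2 * Real.pi * len f * ∫ s in (0 : ℝ)..1, wedge (γ (r s)) (qn f (r s)) := by
    have c1 : Continuous fun s => (inner ℝ (γ (r s)) (γ (r s) - (γ (r s) - nf f (r s))) : ℝ) :=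
      cη.inner (cη.sub cπ)
    rw [← intervalIntegral.integral_const_mul, ← intervalIntegral.integral_const_mul,
      ← intervalIntegral.integral_sub ((c1.intervalIntegrable _ _).const_mul _)
      ((cwη.intervalIntegrable _ _).const_mul _)]
    refine intervalIntegral.integral_congr fun x _ => ?_
    simp only [← map_sub]
    rw [inner_plane, wedge_apply, ← Complex.ofReal_pow]
    simp only [Complex.mul_re, Complex.mul_im, Complex.conj_re, Complex.conj_im, Complex.add_re,
        Complex.add_im, Complex.ofReal_re, Complex.ofReal_im, Complex.I_re,
        Complex.I_im, toC_re, toC_im, Complex.re_ofNat, Complex.im_ofNat]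
    ring
  refine ⟨F1.trans k3, ?_⟩
  rw [k1, k2]
  refine le_trans (le_of_eq ?_) (F2.trans (mul_le_mul_of_nonneg_left k3 (sq_nonneg _)))
  rw [k4]
  ring

end IsoperimetricInequality

/-! ### The deficit of a closed curve -/

section Deficit

variable {f γ : ℝ → Plane}

theorem IsPrim.deficit_eq (h : IsPrim γ f) :
    deficit γ = len f ^ 2 - 2 * Real.pi * ∫ u in (0 : ℝ)..1, wedge (γ u) (f u) := by
  have e : ∫ u in (0 : ℝ)..1, (γ u 0 * deriv γ u 1 - γ u 1 * deriv γ u 0) =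
      ∫ u in (0 : ℝ)..1, wedge (γ u) (f u) :=
    intervalIntegral.integral_congr_ae (h.ae_deriv.mono fun u hu _ => by rw [hu, wedge_apply])
  rw [deficit, signedArea, e, length_eq, len_congr_ae h.ae_deriv]
  ring

theorem IsPrim.abs_integral_wedge_le (h : IsPrim γ f) {M : ℝ}
    (hM : ∀ u ∈ Set.Icc (0 : ℝ) 1, ‖γ u‖ ≤ M) :
    |∫ u in (0 : ℝ)..1, wedge (γ u) (f u)| ≤ M * len f := by
  rw [len, ← intervalIntegral.integral_const_mul, ← Real.norm_eq_abs]
  refine intervalIntegral.norm_integral_le_of_norm_le zero_le_one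
    (Eventually.of_forall fun u hu => ?_) ((h.integrable 0 1).norm.const_mul _)
  exact (abs_wedge_le _ _).trans (mul_le_mul_of_nonneg_right (hM u (Set.Ioc_subset_Icc_self hu))
    (norm_nonneg _))

theorem integral_wedge_sub_const {c : Plane} (h : IsPrim γ f) (h0 : ∫ u in (0 : ℝ)..1, f u = 0) :
    ∫ u in (0 : ℝ)..1, wedge (γ u - c) (f u) = ∫ u in (0 : ℝ)..1, wedge (γ u) (f u) := by
  have hi := h.integrable 0 1
  simp only [map_sub, sub_apply]
  rw [intervalIntegral.integral_sub (intervalIntegrable_wedge h.continuous hi)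
    (intervalIntegrable_wedge continuous_const hi),
    (wedge c).intervalIntegral_comp_comm hi, h0, map_zero, sub_zero]

end Deficit

/-! ### The area as a bilinear form on families -/

section AreaForm

variable {z₀ : ℝ → Plane}

theorem continuous_integral_vec (hz : PerInt z₀) (x : Fam) :
    Continuous fun u => ∫ v in (0 : ℝ)..u, vec z₀ x v :=
  (isPrim_integral (perInt_vec hz x).intervalIntegrable 0).continuous

theorem intervalIntegrable_area (hz : PerInt z₀) (x y : Fam) :
    IntervalIntegrable (fun u => wedge (∫ v in (0 : ℝ)..u, vec z₀ x v) (vec z₀ y u)) volume 0 1 :=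
  intervalIntegrable_wedge (continuous_integral_vec hz x) ((perInt_vec hz y).intervalIntegrable _ _)

/-- The polarization of twice the enclosed area, on the family algebra. -/
def areaForm (hz : PerInt z₀) : Fam →L[ℝ] Fam →L[ℝ] ℝ :=
  LinearMap.mkContinuous₂ (LinearMap.mk₂ ℝ
    (fun x y => ∫ u in (0 : ℝ)..1, wedge (∫ v in (0 : ℝ)..u, vec z₀ x v) (vec z₀ y u))
    (fun x x' y => by
      rw [← intervalIntegral.integral_add (intervalIntegrable_area hz x y)
        (intervalIntegrable_area hz x' y)]
      refine intervalIntegral.integral_congr fun u _ => ?_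
      change wedge (primVec hz 0 u (x + x')) _ = wedge (primVec hz 0 u x) _ +
        wedge (primVec hz 0 u x') _
      rw [map_add, map_add]; rfl)
    (fun c x y => by
      rw [smul_eq_mul, ← intervalIntegral.integral_const_mul]
      refine intervalIntegral.integral_congr fun u _ => ?_
      change wedge (primVec hz 0 u (c • x)) _ = c * wedge (primVec hz 0 u x) _
      rw [map_smul, map_smul]; rfl)
    (fun x y y' => by
      rw [← intervalIntegral.integral_add (intervalIntegrable_area hz x y)
        (intervalIntegrable_area hz x y')]
      refine intervalIntegral.integral_congr fun u _ => ?_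
      exact map_add _ (vec z₀ y u) (vec z₀ y' u))
    (fun c x y => by
      rw [smul_eq_mul, ← intervalIntegral.integral_const_mul]
      refine intervalIntegral.integral_congr fun u _ => ?_
      exact map_smul _ c (vec z₀ y u)))
    (len z₀ ^ 2) fun x y => by
      rw [LinearMap.mk₂_apply]
      have h := (isPrim_integral (perInt_vec hz x).intervalIntegrable 0)
      calc _ ≤ ∫ u in (0 : ℝ)..1, (‖x‖ * len z₀) * (‖y‖ * ‖z₀ u‖) := by
            refine intervalIntegral.norm_integral_le_of_norm_le zero_le_one
              (Eventually.of_forall fun u hu => ?_)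
              ((hz.integrable.norm.const_mul _).const_mul _)
            refine (abs_wedge_le _ _).trans (mul_le_mul ?_ (norm_vec_le y u) (norm_nonneg _)
              (mul_nonneg (norm_nonneg _) (len_nonneg _)))
            refine (intervalIntegral.norm_integral_le_of_norm_le hu.1.le
              (g := fun v => ‖x‖ * ‖z₀ v‖) (Eventually.of_forall fun v _ => norm_vec_le x v)
              ((hz.intervalIntegrable _ _).norm.const_mul _)).trans ?_
            rw [intervalIntegral.integral_const_mul]
            exact mul_le_mul_of_nonneg_left (hz.monotone_arc hu.2) (norm_nonneg _)
        _ = len z₀ ^ 2 * ‖x‖ * ‖y‖ := by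
            rw [intervalIntegral.integral_const_mul, intervalIntegral.integral_const_mul, len]
            ring

theorem areaForm_apply (hz : PerInt z₀) (x y : Fam) : areaForm hz x y =
    ∫ u in (0 : ℝ)..1, wedge (∫ v in (0 : ℝ)..u, vec z₀ x v) (vec z₀ y u) := rfl

/-- Integration by parts over the period; the boundary term vanishes as soon as one of the two
curves is closed. -/
theorem areaForm_comm (hz : PerInt z₀) {x y : Fam} (hx : ∫ u in (0 : ℝ)..1, vec z₀ x u = 0) :
    areaForm hz y x = areaForm hz x y := by
  have h := ((isPrim_integral (perInt_vec hz x).intervalIntegrable 0).bilin wedge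
    (isPrim_integral (perInt_vec hz y).intervalIntegrable 0)).integral_eq_zero (by
      simp only [hx, intervalIntegral.integral_same, map_zero, zero_apply])
  have e : ∀ u, wedge (vec z₀ x u) (∫ v in (0 : ℝ)..u, vec z₀ y v) +
      wedge (∫ v in (0 : ℝ)..u, vec z₀ x v) (vec z₀ y u) =
      wedge (∫ v in (0 : ℝ)..u, vec z₀ x v) (vec z₀ y u) -
      wedge (∫ v in (0 : ℝ)..u, vec z₀ y v) (vec z₀ x u) := fun u => by
    rw [wedge_swap (∫ v in (0 : ℝ)..u, vec z₀ y v)]; ring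
  simp only [e] at h
  rw [intervalIntegral.integral_sub (intervalIntegrable_area hz x y)
    (intervalIntegrable_area hz y x)] at h
  rw [areaForm_apply, areaForm_apply]
  linarith

end AreaForm

/-! ### The deficit along the flow and in the limit -/

/-- A bound for the ratio of the isoperimetric deficits of the limit and of the initial curve. -/
def deficitConst (M : ℝ) : ℝ :=
  Real.exp ((Real.exp (2 * M ^ 2) * (4 * Real.pi * M)) ^ 2 / (4 * Real.pi ^ 2)) +
    2 * (1 + 2 * Real.pi) * Real.exp (2 * M ^ 2) ^ 2

namespace Evolution

variable {z₀ : ℝ → Plane} (ev : Evolution z₀)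

/-- The isoperimetric deficit, rescaled by `exp (2 t)`. -/
def scaledDeficit (t : ℝ) : ℝ :=
  ev.ell t ^ 2 - 2 * Real.pi * areaForm ev.perInt (ev.fam t) (ev.fam t)

/-- The area is a continuous bilinear form evaluated on the differentiable curve `fam`. Closedness
of the curve makes the two terms of the product rule equal. -/
theorem hasDerivAt_scaledDeficit (t : ℝ) : HasDerivAt ev.scaledDeficit
    (2 * ev.ell t * (∫ u in (0 : ℝ)..1, inner ℝ (qn (ev.f t) u) (ev.Z t u)) -
      4 * Real.pi * ∫ u in (0 : ℝ)..1, wedge (∫ v in (0 : ℝ)..u, ev.Z t v)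
        (ev.E t u • qn (ev.f t) u)) t := by
  have h1 : HasDerivAt ev.ell _ t := ev.hasDerivAt_integral_E t 0 1
  have hB : HasDerivAt (fun s => areaForm ev.perInt (ev.fam s) (ev.fam s)) _ t :=
    (((areaForm ev.perInt).hasFDerivAt.comp_hasDerivAt t (ev.hasDerivAt_fam t)).clm_apply
      (ev.hasDerivAt_fam t))
  refine ((h1.pow 2).sub (hB.const_mul (2 * Real.pi))).congr_deriv ?_
  have e : areaForm ev.perInt (ev.fam t) (gen ev.perInt t (ev.fam t) * ev.fam t) =
      ∫ u in (0 : ℝ)..1, wedge (∫ v in (0 : ℝ)..u, ev.Z t v) (ev.E t u • qn (ev.f t) u) := by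
    rw [areaForm_apply]
    simp only [ev.vec_gen_mul]
    rfl
  rw [areaForm_comm ev.perInt (ev.integral_Z t), Function.comp_apply, e]
  push_cast
  ring

theorem scaledDeficit_eq (t : ℝ) : ev.scaledDeficit t = Real.exp t ^ 2 * (len (ev.f t) ^ 2 -
    2 * Real.pi * ∫ u in (0 : ℝ)..1, wedge (∫ v in (0 : ℝ)..u, ev.f t v) (ev.f t u)) := by
  have e1 : areaForm ev.perInt (ev.fam t) (ev.fam t) = Real.exp t ^ 2 *
      ∫ u in (0 : ℝ)..1, wedge (∫ v in (0 : ℝ)..u, ev.f t v) (ev.f t u) := by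
    rw [areaForm_apply, ← intervalIntegral.integral_const_mul]
    refine intervalIntegral.integral_congr fun u _ => ?_
    change wedge (∫ v in (0 : ℝ)..u, ev.Z t v) (ev.Z t u) = _
    simp only [ev.Z_eq, intervalIntegral.integral_smul, map_smul, smul_apply, smul_eq_mul]
    ring
  have e2 : ev.ell t = Real.exp t * len (ev.f t) := by
    rw [ev.len_f_eq, ← mul_assoc, ← Real.exp_add]; simp
  rw [scaledDeficit, e1, e2]
  ring

theorem scaledDeficit_nonneg_and_deriv_le (t : ℝ) : 0 ≤ ev.scaledDeficit t ∧
    2 * ev.ell t * (∫ u in (0 : ℝ)..1, inner ℝ (qn (ev.f t) u) (ev.Z t u)) -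
      4 * Real.pi * (∫ u in (0 : ℝ)..1, wedge (∫ v in (0 : ℝ)..u, ev.Z t v)
        (ev.E t u • qn (ev.f t) u)) ≤
    len (ev.f t) ^ 2 / (2 * Real.pi ^ 2) * ev.scaledDeficit t := by
  have hP := isPrim_integral (ev.perInt_f t).intervalIntegrable 0
  obtain ⟨h1, h2⟩ := isoperimetric_and_velocity_inequality (ev.perInt_f t) (ev.len_f_pos t) hP
    (hP.periodic (ev.perInt_f t).periodic (ev.integral_f t))
  have e1 : ∫ u in (0 : ℝ)..1, inner ℝ (qn (ev.f t) u) (ev.Z t u) =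
      Real.exp t * ∫ u in (0 : ℝ)..1, inner ℝ (qn (ev.f t) u) (ev.f t u) := by
    simp only [ev.Z_eq, inner_smul_right, intervalIntegral.integral_const_mul]
  have e2 : ∫ u in (0 : ℝ)..1, wedge (∫ v in (0 : ℝ)..u, ev.Z t v) (ev.E t u • qn (ev.f t) u) =
      Real.exp t ^ 2 * ∫ u in (0 : ℝ)..1, ‖ev.f t u‖ *
        wedge (∫ v in (0 : ℝ)..u, ev.f t v) (qn (ev.f t) u) := by
    rw [← intervalIntegral.integral_const_mul]
    refine intervalIntegral.integral_congr fun u _ => ?_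
    simp only [ev.Z_eq, ev.E_eq, intervalIntegral.integral_smul, map_smul, smul_apply, smul_eq_mul]
    ring
  have e3 : ev.ell t = Real.exp t * len (ev.f t) := by
    rw [ev.len_f_eq, ← mul_assoc, ← Real.exp_add]; simp
  have hx := sq_nonneg (Real.exp t)
  rw [ev.scaledDeficit_eq, e1, e2, e3]
  refine ⟨mul_nonneg hx h1, ?_⟩
  have h3 := mul_le_mul_of_nonneg_left h2 hx
  rw [div_mul_eq_mul_div, le_div_iff₀ (by positivity)]
  linarith

/-- Gronwall with rate `L² / (2π²) ≤ K² e^{-2t} / (2π²)`, whose integral over `[0, ∞)` is `K² /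
(4π²)`. -/
theorem scaledDeficit_le {M : ℝ} {x₀ : Plane} (hM : ∀ u, ‖ev.curve x₀ 0 u‖ ≤ M) {t : ℝ}
    (ht : 0 ≤ t) : ev.scaledDeficit t ≤ ev.scaledDeficit 0 *
      Real.exp ((Real.exp (2 * M ^ 2) * len z₀) ^ 2 / (4 * Real.pi ^ 2)) := by
  set K := Real.exp (2 * M ^ 2) * len z₀
  have hB : ∀ s, HasDerivAt (fun s => -(K ^ 2 / (4 * Real.pi ^ 2) * Real.exp (-2 * s)))
      (K ^ 2 / (2 * Real.pi ^ 2) * Real.exp (-2 * s)) s := fun s => by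
    have := ((((hasDerivAt_id s).const_mul (-2)).exp).const_mul (K ^ 2 / (4 * Real.pi ^ 2))).neg
    refine this.congr_deriv ?_
    simp only [id]
    field_simp
    ring
  refine (le_exp_mul_of_deriv_le ev.hasDerivAt_scaledDeficit hB (fun s hs => ?_) ht).trans ?_
  · obtain ⟨h1, h2⟩ := ev.scaledDeficit_nonneg_and_deriv_le s
    refine h2.trans (mul_le_mul_of_nonneg_right ?_ h1)
    have h3 : len (ev.f s) ≤ Real.exp (-s) * K := by
      rw [ev.len_f_eq]
      exact mul_le_mul_of_nonneg_left (ev.ell_le x₀ hM hs) (Real.exp_pos _).le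
    have e : Real.exp (-2 * s) = Real.exp (-s) ^ 2 := by
      rw [← Real.exp_nat_mul]; congr 1; push_cast; ring
    rw [e, div_mul_eq_mul_div, ← mul_pow, mul_comm K]
    exact div_le_div_of_nonneg_right (pow_le_pow_left₀ (len_nonneg _) h3 2) (by positivity)
  · refine mul_le_mul_of_nonneg_left (Real.exp_le_exp.2 ?_)
      (ev.scaledDeficit_nonneg_and_deriv_le 0).1
    have h1 : 0 ≤ K ^ 2 / (4 * Real.pi ^ 2) * Real.exp (-2 * t) := by positivity
    simp only [mul_zero, Real.exp_zero]
    linarith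

theorem deficit_limit_eq : deficit ev.limit =
    len ev.Zlim ^ 2 - 2 * Real.pi * areaForm ev.perInt ev.famLim ev.famLim :=
  ev.isPrim_limit.deficit_eq

theorem tendsto_scaledDeficit : Tendsto ev.scaledDeficit atTop (𝓝 (deficit ev.limit)) := by
  rw [deficit_limit_eq]
  have h := (areaForm ev.perInt).isBoundedBilinearMap.continuous.tendsto (ev.famLim, ev.famLim)
  exact (ev.tendsto_ell.pow 2).sub
    ((h.comp (ev.tendsto_fam.prodMk_nhds ev.tendsto_fam)).const_mul _)

theorem scaledDeficit_zero (x₀ : Plane) : ev.scaledDeficit 0 = deficit (ev.curve x₀ 0) := by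
  rw [ev.scaledDeficit_eq, (ev.isPrim_curve x₀ 0).deficit_eq, Real.exp_zero, one_pow, one_mul,
    ← integral_wedge_sub_const (c := ev.curve x₀ 0 0) (ev.isPrim_curve x₀ 0) (ev.integral_f 0)]
  simp only [(ev.isPrim_curve x₀ 0).sub_eq]

/-- Gronwall alone gives a factor depending on the initial length, which is harmless while that
length is at most `4π M`. For a longer curve twice the area is at most `M L`, so the deficit is at
least `L² / 2`, whereas the limit has deficit at most `(1 + 2π)` times the square of its length, and
that length is controlled by `L`. The constant is the sum of the two factors. -/
theorem deficit_limit_le {M : ℝ} {x₀ : Plane} (hM : ∀ u, ‖ev.curve x₀ 0 u‖ ≤ M) :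
    deficit ev.limit ≤ deficitConst M * deficit (ev.curve x₀ 0) := by
  have hD0 : 0 ≤ deficit (ev.curve x₀ 0) := by
    rw [← ev.scaledDeficit_zero x₀]; exact (ev.scaledDeficit_nonneg_and_deriv_le 0).1
  have hL := ev.len_pos
  have hπ := Real.pi_pos
  rcases le_total (len z₀) (4 * Real.pi * M) with hc | hc
  · have h1 : deficit ev.limit ≤ deficit (ev.curve x₀ 0) *
        Real.exp ((Real.exp (2 * M ^ 2) * len z₀) ^ 2 / (4 * Real.pi ^ 2)) := by
      refine le_of_tendsto ev.tendsto_scaledDeficit ?_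
      filter_upwards [eventually_ge_atTop 0] with t ht
      rw [← ev.scaledDeficit_zero x₀]
      exact ev.scaledDeficit_le hM ht
    have h2 : Real.exp ((Real.exp (2 * M ^ 2) * len z₀) ^ 2 / (4 * Real.pi ^ 2)) ≤
        Real.exp ((Real.exp (2 * M ^ 2) * (4 * Real.pi * M)) ^ 2 / (4 * Real.pi ^ 2)) := by
      gcongr
    rw [mul_comm]
    refine h1.trans (mul_le_mul_of_nonneg_left (h2.trans ?_) hD0)
    rw [deficitConst]
    have : 0 ≤ 2 * (1 + 2 * Real.pi) * Real.exp (2 * M ^ 2) ^ 2 := by positivity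
    linarith
  · have hlen : len (ev.f 0) = len z₀ := by
      rw [ev.len_f_eq, neg_zero, Real.exp_zero, one_mul, ell]
      simp only [ev.E_zero]
      rfl
    have h1 : len z₀ ^ 2 / 2 ≤ deficit (ev.curve x₀ 0) := by
      rw [(ev.isPrim_curve x₀ 0).deficit_eq, hlen]
      have h := (abs_le.1 ((ev.isPrim_curve x₀ 0).abs_integral_wedge_le fun u _ => hM u)).2
      rw [hlen] at h
      nlinarith
    have h2 : len ev.Zlim ≤ Real.exp (2 * M ^ 2) * len z₀ := by
      refine le_of_tendsto ev.tendsto_ell ?_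
      filter_upwards [eventually_ge_atTop 0] with t ht using ev.ell_le x₀ hM ht
    have h3 : deficit ev.limit ≤ (1 + 2 * Real.pi) * len ev.Zlim ^ 2 := by
      rw [ev.isPrim_limit.deficit_eq]
      -- The limit curve starts at the origin, so its norm is bounded by its length.
      have h := (abs_le.1 (ev.isPrim_limit.abs_integral_wedge_le (M := len ev.Zlim)
        fun u hu => ?_)).1
      · nlinarith
      · exact (intervalIntegral.norm_integral_le_integral_norm hu.1).trans
          (ev.perInt_Zlim.monotone_arc hu.2)
    have h4 : len ev.Zlim ^ 2 ≤ (Real.exp (2 * M ^ 2) * len z₀) ^ 2 :=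
      pow_le_pow_left₀ (len_nonneg _) h2 2
    calc deficit ev.limit ≤ (1 + 2 * Real.pi) * (Real.exp (2 * M ^ 2) * len z₀) ^ 2 :=
          h3.trans (mul_le_mul_of_nonneg_left h4 (by positivity))
      _ = 2 * (1 + 2 * Real.pi) * Real.exp (2 * M ^ 2) ^ 2 * (len z₀ ^ 2 / 2) := by ring
      _ ≤ 2 * (1 + 2 * Real.pi) * Real.exp (2 * M ^ 2) ^ 2 * deficit (ev.curve x₀ 0) :=
          mul_le_mul_of_nonneg_left h1 (by positivity)
      _ ≤ _ := by
          refine mul_le_mul_of_nonneg_right ?_ hD0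
          rw [deficitConst]
          have := Real.exp_pos ((Real.exp (2 * M ^ 2) * (4 * Real.pi * M)) ^ 2 / (4 * Real.pi ^ 2))
          linarith

end Evolution

end H1CSF

end

/-! ### The theorem -/

theorem mainTheorem4 :
    ∃ c : ℝ → ℝ, ∀ (k : ℕ) (X₀ : ℝ → H1CSF.Plane), H1CSF.InitialData k X₀ →
      ∃ X : ℝ → ℝ → H1CSF.Plane,
        -- the flow that starts at `X₀` exists and is unique
        H1CSF.IsFlow X ∧ X 0 = X₀ ∧
        (∀ X' : ℝ → ℝ → H1CSF.Plane, H1CSF.IsFlow X' → X' 0 = X₀ → X' = X) ∧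
        ∃ Y : ℝ → H1CSF.Plane,
          -- convergence of its asymptotic profile in `C⁰`
          H1CSF.MemH1 Y ∧ ¬ H1CSF.IsConstantMap Y ∧
          TendstoUniformly (H1CSF.profile X) Y atTop ∧
          -- embeddedness of the limit
          ((∃ t : ℝ, H1CSF.ChordArcCondition (X t)) →
            H1CSF.IsEmbedded Y ∧ (H1CSF.MemImm 1 X₀ → H1CSF.MemImm 1 Y)) ∧
          -- immersed limit with bounded curvature
          (2 ≤ k → (∀ u, deriv X₀ u ≠ 0) →
            H1CSF.MemImm 2 Y ∧ ∃ C : ℝ, ∀ u, |H1CSF.curvature Y u| ≤ C) ∧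
          -- the isoperimetric deficit
          H1CSF.deficit Y ≤ c (H1CSF.supNorm X₀) * H1CSF.deficit X₀ := by
  refine ⟨H1CSF.deficitConst, fun k X₀ h => ?_⟩
  have h1 := h.memH1
  obtain ⟨ev⟩ := h1.nonempty_evolution h.2
  have h2 := h1.2.1
  have hflow := ev.isFlow_curve (X₀ 0) h2
  have h0 := H1CSF.Evolution.curve_zero h1 ev
  refine ⟨ev.curve (X₀ 0), hflow, h0, fun X' hX' hX0 => hflow.unique hX' (hX0.trans h0.symm),
    ev.limit, ev.limit_memH1 h2, ev.not_isConstantMap_limit,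
    ev.tendstoUniformly_profile (X₀ 0), fun ⟨t, ht⟩ => ⟨ev.isEmbedded_limit (X₀ 0) ht,
    fun hi => ev.memImm_one_limit ?_ hi.2⟩, fun hk hi => ?_, ?_⟩
  · exact hi.1.2.continuous_deriv le_rfl
  · have hC : ContDiff ℝ (k : WithTop ℕ∞) X₀ := by
      have := h.1
      rw [if_neg (by omega)] at this
      exact this.2
    have hC2 : ContDiff ℝ (1 + 1) X₀ := hC.of_le (by exact_mod_cast hk)
    have hY := ev.memImm_two_limit (contDiff_succ_iff_deriv.1 hC2).2.2 hi
    exact ⟨hY, hY.exists_abs_curvature_le⟩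
  · have hM : ∀ u, ‖ev.curve (X₀ 0) 0 u‖ ≤ H1CSF.supNorm X₀ := fun u => by
      rw [h0]
      -- Periodicity and continuity make the family of norms bounded, so the supremum defining the
      -- sup norm is a genuine upper bound and not the default value.
      obtain ⟨M, -, hM⟩ := H1CSF.Function.Periodic.exists_norm_le h1.1 h1.isPrim.continuous
      exact le_ciSup ⟨M, Set.forall_mem_range.2 hM⟩ u
    have := ev.deficit_limit_le hM
    rwa [h0] at this
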